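/- Let $\mathcal A$ be an abelian category and let $\mathfrak M=(\mathcal Q,\mathcal W,\mathcal R)$ be a hereditary abelian model structure on $\mathcal A$: $\mathcal Q$ (cofibrant objects), $\mathcal W$ (trivial objects) and $\mathcal R$ (fibrant objects) are classes of objects such that $\mathcal W$ has the 2-out-of-3 property on short exact sequences, both $(\mathcal Q,\mathcal W\cap\mathcal R)$ and $(\mathcal Q\cap\mathcal W,\mathcal R)$ are complete cotorsion pairs, and both are hereditary, i.e. $\operatorname{Ext}^i_{\mathcal A}(X,Y)=0$ for all $i\ge 1$ whenever $X$ lies in the left and $Y$ in the right class of the pair. *Homotopy category.* Put $\omega=\mathcal Q\cap\mathcal W\cap\mathcal R$ and let $\underline{\operatorname{Hom}}_\omega(X,Y)$ be $\operatorname{Hom}_{\mathcal A}(X,Y)$ modulo the morphisms factoring through an object of $\omega$. For each $A$ choose short exact sequences $0\to K\to QA\to A\to 0$ with $QA\in\mathcal Q$, $K\in\mathcal W\cap\mathcal R$, and $0\to QA\to RQA\to L\to 0$ with $RQA\in\mathcal R$, $L\in\mathcal Q\cap\mathcal W$. The category $\operatorname{Ho}(\mathfrak M)$ has the objects of $\mathcal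 A$ and morphisms $\operatorname{Ho}(\mathfrak M)(A,B)=\underline{\operatorname{Hom}}_\omega(RQA,RQB)$; the canonical functor $\gamma:\mathcal A\to\operatorname{Ho}(\mathfrak M)$ is the identity on objects and sends $f$ to the class of $R(Q(f))$. *Loop and suspension.* $\Omega,\Sigma:\operatorname{Ho}(\mathfrak M)\to\operatorname{Ho}(\mathfrak M)$ are the loop and suspension functors. They are well defined up to canonical isomorphism and are computed here as follows: $\Omega A$ is the kernel of an epimorphism $P\to RQA$ with $P\in\mathcal Q\cap\mathcal W$ and fibrant kernel, $\Sigma A$ is the cokernel of a monomorphism $RQA\to E$ with $E\in\mathcal W\cap\mathcal R$ and cofibrant cokernel, and a morphism represented by $f:RQA\to RQB$ is sent to the image under $\gamma$ of the map that $f$ induces on kernels, respectively cokernels, after completing $f$ to a morphism of the chosen short exact sequences. For $n\in\mathbb Z$, $\Omega^n$ and $\Sigma^n$ denote iterates, with $\Omega^{-n}=\Sigma^n$. *Resolutions and Ext functors.* An $\mathfrak M$-resolution of $A$ is an exact chain complex $W_A=(\cdots\to W_1\to W_0\to W_{-1}\to W_{-2}\to\cdots)$ with a factorization $W_0\xrightarrow{\varepsilon}A\xrightarrow{\eta}W_{-1}$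 of $d_0$ into an epimorphism and a monomorphism, such that $W_n\in\mathcal Q\cap\mathcal W$ for $n\ge 0$, $W_n\in\mathcal W\cap\mathcal R$ for $n\le -1$, the kernels of $\varepsilon$ and of $d_n:W_n\to W_{n-1}$ ($n\ge 1$) lie in $\mathcal R$, and the cokernels of $\eta$ and of $d_n$ ($n\le -1$) lie in $\mathcal Q$. An $\mathfrak M$-coresolution $W^B$ of $B$ is the same thing in cochain notation, $W^n=W_{-n-1}$, so that $\cdots\to W^{-1}\xrightarrow{\varepsilon}B\xrightarrow{\eta}W^0\to\cdots$. Choose an $\mathfrak M$-resolution $W_A$ and an $\mathfrak M$-coresolution $W^B$ for all objects $A$ and $B$, and for $n\in\mathbb Z$ put $$\ell\mathrm{Ext}^n_{\mathfrak M}(A,B)=H^n[\operatorname{Hom}_{\mathcal A}(W_A,B)],\qquad r\mathrm{Ext}^n_{\mathfrak M}(A,B)=H^n[\operatorname{Hom}_{\mathcal A}(A,W^B)].$$ These are bifunctors $\mathcal A^{op}\times\mathcal A\to\mathbf{Ab}$: a morphism $f:A\to A'$ acts on $\ell\mathrm{Ext}$ through any chain map $W_A\to W_{A'}$ compatible with $f$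 via $\varepsilon$ and $\eta$ (such a chain map exists and is unique up to chain homotopy), and similarly for $r\mathrm{Ext}$ in the second variable; in the remaining variables they act by composition. **Theorem.** For any such choice of $\mathfrak M$-resolutions and $\mathfrak M$-coresolutions and every $n\in\mathbb Z$, there are isomorphisms of abelian groups $$\ell\mathrm{Ext}^n_{\mathfrak M}(A,B)\;\cong\;\operatorname{Ho}(\mathfrak M)(\Omega^nA,B)\;\cong\;\operatorname{Ho}(\mathfrak M)(A,\Sigma^nB)\;\cong\;r\mathrm{Ext}^n_{\mathfrak M}(A,B),$$ each natural in the cofibrant object $A$ and in the fibrant object $B$; that is, they are isomorphisms of functors $\mathcal Q^{op}\times\mathcal R\to\mathbf{Ab}$ on the full subcategories of cofibrant and of fibrant objects. -/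

import Mathlib

open CategoryTheory CategoryTheory.Limits CategoryTheory.Abelian Opposite

universe w v u

noncomputable section

namespace AbelianModel

section CotorsionPairs

variable {C : Type u} [Category.{v} C] [Abelian C]

/-- A short exact sequence `0 ⟶ K ⟶ P ⟶ A ⟶ 0` with `P` in `X` and `K` in `Y`. -/
structure SpecialPrecover (X Y : ObjectProperty C) (A : C) where
  K : C
  P : C
  i : K ⟶ P
  p : P ⟶ A
  zero : i ≫ p = 0
  shortExact : (ShortComplex.mk i p zero).ShortExact
  hP : X P
  hK : Y K

/-- A short exact sequence `0 ⟶ A ⟶ E ⟶ L ⟶ 0` with `E` in `Y` and `L` in `X`. -/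
structure SpecialPreenvelope (X Y : ObjectProperty C) (A : C) where
  E : C
  L : C
  j : A ⟶ E
  q : E ⟶ L
  zero : j ≫ q = 0
  shortExact : (ShortComplex.mk j q zero).ShortExact
  hE : Y E
  hL : X L

/-- The class `W` has the 2 out of 3 property on short exact sequences. -/
structure IsThick (W : ObjectProperty C) : Prop where
  left : ∀ S : ShortComplex C, S.ShortExact → W S.X₂ → W S.X₃ → W S.X₁
  middle : ∀ S : ShortComplex C, S.ShortExact → W S.X₁ → W S.X₃ → W S.X₂
  right : ∀ S : ShortComplex C, S.ShortExact → W S.X₁ → W S.X₂ → W S.X₃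

theorem shortExact_biprod (A B : C) :
    (ShortComplex.mk (biprod.inl : A ⟶ A ⊞ B) biprod.snd (by simp)).ShortExact :=
  ShortComplex.Splitting.shortExact
    { r := biprod.fst, s := biprod.inr, f_r := by simp, s_g := by simp
      id := by simp [biprod.total] }

variable [HasExt.{w} C]

/-- `(X, Y)` is a cotorsion pair: `Y` is the class of all `B` with `Ext¹(A, B) = 0` for all `A` in
`X`, and `X` is the class of all `A` with `Ext¹(A, B) = 0` for all `B` in `Y`. -/
structure IsCotorsionPair (X Y : ObjectProperty C) : Prop where
  right_iff : ∀ B, Y B ↔ ∀ A, X A → Subsingleton (Ext A B 1)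
  left_iff : ∀ A, X A ↔ ∀ B, Y B → Subsingleton (Ext A B 1)

/-- A complete cotorsion pair: a cotorsion pair with enough projectives and enough injectives. -/
structure IsCompleteCotorsionPair (X Y : ObjectProperty C) : Prop extends IsCotorsionPair X Y where
  enoughProjectives : ∀ A, Nonempty (SpecialPrecover X Y A)
  enoughInjectives : ∀ A, Nonempty (SpecialPreenvelope X Y A)

/-- `Extⁱ(A, B) = 0` for all `A` in `X`, `B` in `Y` and all `i ≥ 1`. -/
def IsHereditaryPair (X Y : ObjectProperty C) : Prop :=
  ∀ A B, X A → Y B → ∀ i : ℕ, 1 ≤ i → Subsingleton (Ext A B i)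

variable (C) in
/-- An abelian model structure on `C`: a triple `(Q, W, R)` of classes of objects such that `W` is
thick and `(Q, W ∩ R)`, `(Q ∩ W, R)` are complete cotorsion pairs. -/
structure AbelianModelStructure where
  /-- the cofibrant objects -/
  Q : ObjectProperty C
  /-- the trivial objects -/
  W : ObjectProperty C
  /-- the fibrant objects -/
  R : ObjectProperty C
  thick : IsThick W
  leftPair : IsCompleteCotorsionPair Q (W ⊓ R)
  rightPair : IsCompleteCotorsionPair (Q ⊓ W) R

/-! Elementary facts on lifting and extending morphisms. -/

/-- If `S` is exact and `Ext¹(T, ker S.f) = 0`, then any `g : T ⟶ S.X₂` that is killed by `S.g`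
lifts along `S.f`. -/
theorem exists_lift {S : ShortComplex C} (hS : S.Exact) {T : C}
    (h : Subsingleton (Ext T (kernel S.f) 1)) (g : T ⟶ S.X₂) (hg : g ≫ S.g = 0) :
    ∃ l : T ⟶ S.X₁, l ≫ S.f = g := by
  let E : ShortComplex C := ShortComplex.mk (kernel.ι S.f) (Abelian.factorThruImage S.f)
    (by rw [← cancel_mono (Abelian.image.ι S.f)]; simp)
  have hE : E.ShortExact :=
    { exact := by
        have h1 : (ShortComplex.mk (kernel.ι S.f) S.f (by simp)).Exact :=
          ShortComplex.exact_of_f_is_kernel _ (kernelIsKernel S.f)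
        let φ : E ⟶ ShortComplex.mk (kernel.ι S.f) S.f (by simp) :=
          { τ₁ := 𝟙 _, τ₂ := 𝟙 _, τ₃ := Abelian.image.ι S.f
            comm₁₂ := by simp [E], comm₂₃ := by simp [E] }
        have : Epi φ.τ₁ := by dsimp [φ]; infer_instance
        have : IsIso φ.τ₂ := by dsimp [φ]; infer_instance
        have : Mono φ.τ₃ := by dsimp [φ]; infer_instance
        exact (ShortComplex.exact_iff_of_epi_of_isIso_of_mono φ).2 h1
      mono_f := by dsimp [E]; infer_instance
      epi_g := by dsimp [E]; infer_instance }
  have hep : (ShortComplex.mk (Abelian.image.ι S.f) S.g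
      (by rw [← cancel_epi (Abelian.factorThruImage S.f)]; simp)).Exact := by
    let φ : S ⟶ ShortComplex.mk (Abelian.image.ι S.f) S.g
        (by rw [← cancel_epi (Abelian.factorThruImage S.f)]; simp) :=
      { τ₁ := Abelian.factorThruImage S.f, τ₂ := 𝟙 _, τ₃ := 𝟙 _ }
    have : Epi φ.τ₁ := by dsimp [φ]; infer_instance
    have : IsIso φ.τ₂ := by dsimp [φ]; infer_instance
    have : Mono φ.τ₃ := by dsimp [φ]; infer_instance
    exact (ShortComplex.exact_iff_of_epi_of_isIso_of_mono φ).1 hS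
  have : Mono (ShortComplex.mk (Abelian.image.ι S.f) S.g
      (by rw [← cancel_epi (Abelian.factorThruImage S.f)]; simp)).f := by
    dsimp; infer_instance
  let k : T ⟶ Abelian.image S.f := hep.lift g hg
  have hk : k ≫ Abelian.image.ι S.f = g := hep.lift_f g hg
  obtain ⟨x, hx⟩ := Ext.covariant_sequence_exact₃ T hE (Ext.mk₀ k) (zero_add 1)
    (Subsingleton.elim (α := Ext T (kernel S.f) 1) _ _)
  obtain ⟨l, rfl⟩ := (Ext.mk₀_bijective _ _).2 x
  rw [Ext.mk₀_comp_mk₀] at hx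
  have hx := (Ext.mk₀_bijective _ _).1 hx
  refine ⟨l, ?_⟩
  rw [← hk, ← hx]
  simp [E]

/-- If `S` is exact and `Ext¹(coker S.g, T) = 0`, then any `g : S.X₂ ⟶ T` that vanishes on `S.X₁`
extends along `S.g`. -/
theorem exists_extension {S : ShortComplex C} (hS : S.Exact) {T : C}
    (h : Subsingleton (Ext (cokernel S.g) T 1)) (g : S.X₂ ⟶ T) (hg : S.f ≫ g = 0) :
    ∃ l : S.X₃ ⟶ T, S.g ≫ l = g := by
  let E : ShortComplex C := ShortComplex.mk (Abelian.image.ι S.g) (cokernel.π S.g)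
    (by rw [← cancel_epi (Abelian.factorThruImage S.g)]; simp)
  have hE : E.ShortExact :=
    { exact := by
        have h1 : (ShortComplex.mk S.g (cokernel.π S.g) (by simp)).Exact :=
          ShortComplex.exact_of_g_is_cokernel _ (cokernelIsCokernel S.g)
        let φ : ShortComplex.mk S.g (cokernel.π S.g) (by simp) ⟶ E :=
          { τ₁ := Abelian.factorThruImage S.g, τ₂ := 𝟙 _, τ₃ := 𝟙 _
            comm₁₂ := by simp [E], comm₂₃ := by simp [E] }
        have : Epi φ.τ₁ := by dsimp [φ]; infer_instance
        have : IsIso φ.τ₂ := by dsimp [φ]; infer_instance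
        have : Mono φ.τ₃ := by dsimp [φ]; infer_instance
        exact (ShortComplex.exact_iff_of_epi_of_isIso_of_mono φ).1 h1
      mono_f := by dsimp [E]; infer_instance
      epi_g := by dsimp [E]; infer_instance }
  have hz : S.f ≫ Abelian.factorThruImage S.g = 0 := by
    rw [← cancel_mono (Abelian.image.ι S.g)]; simp
  have hep : (ShortComplex.mk S.f (Abelian.factorThruImage S.g) hz).Exact := by
    let φ : ShortComplex.mk S.f (Abelian.factorThruImage S.g) hz ⟶ S :=
      { τ₁ := 𝟙 _, τ₂ := 𝟙 _, τ₃ := Abelian.image.ι S.g }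
    have : Epi φ.τ₁ := by dsimp [φ]; infer_instance
    have : IsIso φ.τ₂ := by dsimp [φ]; infer_instance
    have : Mono φ.τ₃ := by dsimp [φ]; infer_instance
    exact (ShortComplex.exact_iff_of_epi_of_isIso_of_mono φ).2 hS
  have : Epi (ShortComplex.mk S.f (Abelian.factorThruImage S.g) hz).g := by
    dsimp; infer_instance
  let k : Abelian.image S.g ⟶ T := hep.desc g hg
  have hk : Abelian.factorThruImage S.g ≫ k = g := hep.g_desc g hg
  obtain ⟨x, hx⟩ := Ext.contravariant_sequence_exact₁ hE T (Ext.mk₀ k) (add_zero 1)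
    (Subsingleton.elim (α := Ext (cokernel S.g) T 1) _ _)
  obtain ⟨l, rfl⟩ := (Ext.mk₀_bijective _ _).2 x
  rw [Ext.mk₀_comp_mk₀] at hx
  have hx := (Ext.mk₀_bijective _ _).1 hx
  refine ⟨l, ?_⟩
  rw [← hk, ← hx]
  simp [E]

theorem exists_lift_shortExact {S : ShortComplex C} (hS : S.ShortExact) {T : C}
    (h : Subsingleton (Ext T S.X₁ 1)) (g : T ⟶ S.X₃) : ∃ l : T ⟶ S.X₂, l ≫ S.g = g := by
  obtain ⟨x, hx⟩ := Ext.covariant_sequence_exact₃ T hS (Ext.mk₀ g) (zero_add 1)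
    (Subsingleton.elim _ _)
  obtain ⟨l, rfl⟩ := (Ext.mk₀_bijective _ _).2 x
  rw [Ext.mk₀_comp_mk₀] at hx
  exact ⟨l, (Ext.mk₀_bijective _ _).1 hx⟩

theorem exists_extension_shortExact {S : ShortComplex C} (hS : S.ShortExact) {T : C}
    (h : Subsingleton (Ext S.X₃ T 1)) (g : S.X₁ ⟶ T) : ∃ l : S.X₂ ⟶ T, S.f ≫ l = g := by
  obtain ⟨x, hx⟩ := Ext.contravariant_sequence_exact₁ hS T (Ext.mk₀ g) (add_zero 1)
    (Subsingleton.elim _ _)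
  obtain ⟨l, rfl⟩ := (Ext.mk₀_bijective _ _).2 x
  rw [Ext.mk₀_comp_mk₀] at hx
  exact ⟨l, (Ext.mk₀_bijective _ _).1 hx⟩

theorem IsCotorsionPair.left_ext {X Y : ObjectProperty C} (h : IsCotorsionPair X Y)
    {S : ShortComplex C} (hS : S.ShortExact) (h1 : X S.X₁) (h3 : X S.X₃) : X S.X₂ := by
  rw [h.left_iff]
  intro B hB
  have i1 := (h.left_iff _).1 h1 B hB
  have i3 := (h.left_iff _).1 h3 B hB
  refine ⟨fun a b => ?_⟩
  have key : ∀ a : Ext S.X₂ B 1, a = 0 := fun a => by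
    obtain ⟨x, rfl⟩ := Ext.contravariant_sequence_exact₂ hS B a (Subsingleton.elim _ _)
    rw [Subsingleton.elim x 0, Ext.comp_zero]
  rw [key a, key b]

theorem IsCotorsionPair.right_ext {X Y : ObjectProperty C} (h : IsCotorsionPair X Y)
    {S : ShortComplex C} (hS : S.ShortExact) (h1 : Y S.X₁) (h3 : Y S.X₃) : Y S.X₂ := by
  rw [h.right_iff]
  intro A hA
  have i1 := (h.right_iff _).1 h1 A hA
  have i3 := (h.right_iff _).1 h3 A hA
  refine ⟨fun a b => ?_⟩
  have key : ∀ a : Ext A S.X₂ 1, a = 0 := fun a => by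
    obtain ⟨x, rfl⟩ := Ext.covariant_sequence_exact₂ A hS a (Subsingleton.elim _ _)
    rw [Subsingleton.elim x 0, Ext.zero_comp]
  rw [key a, key b]

theorem IsCotorsionPair.vanish {X Y : ObjectProperty C} (h : IsCotorsionPair X Y) {A B : C}
    (hA : X A) (hB : Y B) : Subsingleton (Ext A B 1) :=
  (h.left_iff A).1 hA B hB

end CotorsionPairs
end AbelianModel

namespace AbelianModel
open scoped ZeroObject

namespace AbelianModelStructure

variable {C : Type u} [Category.{v} C] [Abelian C] [HasExt.{w} C] (M : AbelianModelStructure.{w} C)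

/-- Both associated cotorsion pairs are hereditary. -/
structure IsHereditary : Prop where
  left : IsHereditaryPair M.Q (M.W ⊓ M.R)
  right : IsHereditaryPair (M.Q ⊓ M.W) M.R

/-- The core `ω = Q ∩ W ∩ R`. -/
def core : ObjectProperty C := M.Q ⊓ M.W ⊓ M.R

theorem core_iff {V : C} : M.core V ↔ M.Q V ∧ M.W V ∧ M.R V := by
  constructor
  · rintro ⟨⟨h1, h2⟩, h3⟩; exact ⟨h1, h2, h3⟩
  · rintro ⟨h1, h2, h3⟩; exact ⟨⟨h1, h2⟩, h3⟩

theorem core_biprod {U V : C} (hU : M.core U) (hV : M.core V) : M.core (U ⊞ V) := by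
  rw [core_iff] at *
  have h := shortExact_biprod U V
  exact ⟨M.leftPair.left_ext h hU.1 hV.1, M.thick.middle _ h hU.2.1 hV.2.1,
    M.rightPair.right_ext h hU.2.2 hV.2.2⟩

theorem exists_core : ∃ V, M.core V := by
  obtain ⟨S⟩ := M.leftPair.enoughProjectives (0 : C)
  have hW := M.thick.middle _ S.shortExact S.hK.1 ?_
  · refine ⟨S.P, M.core_iff.2 ⟨S.hP, hW, ?_⟩⟩
    refine M.rightPair.right_ext S.shortExact S.hK.2 ?_
    rw [M.rightPair.right_iff]
    intro A _
    refine ⟨fun a b => ?_⟩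
    have key : ∀ a : Abelian.Ext A (0 : C) 1, a = 0 := fun a => by
      rw [← Ext.comp_mk₀_id a, (isZero_zero C).eq_of_src (𝟙 (0 : C)) 0, Ext.mk₀_zero, Ext.comp_zero]
    rw [key a, key b]
  · refine M.thick.right (ShortComplex.mk (𝟙 S.K) (0 : S.K ⟶ (0 : C)) (by simp)) ?_ S.hK.1 S.hK.1
    exact ShortComplex.Splitting.shortExact
      { r := 𝟙 _, s := 0, f_r := by simp, s_g := (isZero_zero C).eq_of_src _ _
        id := by simp }

/-- The full homotopy relation: `f` and `g` are homotopic when `g - f` factors through an object of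
the core. -/
def homotopic : HomRel C := fun X Y f g =>
  ∃ (V : C) (_ : M.core V) (a : X ⟶ V) (b : V ⟶ Y), g - f = a ≫ b

theorem homotopic_add ⦃X Y : C⦄ (f₁ f₂ g₁ g₂ : X ⟶ Y) (hf : M.homotopic f₁ f₂)
    (hg : M.homotopic g₁ g₂) : M.homotopic (f₁ + g₁) (f₂ + g₂) := by
  obtain ⟨U, hU, a, b, h⟩ := hf
  obtain ⟨V, hV, c, d, h'⟩ := hg
  refine ⟨U ⊞ V, M.core_biprod hU hV, biprod.lift a c, biprod.desc b d, ?_⟩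
  rw [biprod.lift_desc, ← h, ← h']
  abel

theorem homotopic_refl {X Y : C} (f : X ⟶ Y) : M.homotopic f f := by
  obtain ⟨V, hV⟩ := M.exists_core
  exact ⟨V, hV, 0, 0, by simp⟩

instance : Congruence M.homotopic where
  comp_left := by
    rintro X Y Z f g g' ⟨V, hV, a, b, h⟩
    exact ⟨V, hV, f ≫ a, b, by rw [← Preadditive.comp_sub, h, Category.assoc]⟩
  comp_right := by
    rintro X Y Z f f' g ⟨V, hV, a, b, h⟩
    exact ⟨V, hV, a, b ≫ g, by rw [← Preadditive.sub_comp, h, Category.assoc]⟩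
  equivalence :=
    { refl := M.homotopic_refl
      symm := by
        rintro f g ⟨V, hV, a, b, h⟩
        exact ⟨V, hV, -a, b, by rw [Preadditive.neg_comp, ← h]; abel⟩
      trans := by
        intro f g k h1 h2
        have h3 := M.homotopic_add _ _ _ _ (M.homotopic_add _ _ _ _ h1 h2) (M.homotopic_refl (-g))
        have e1 : f + g + -g = f := by abel
        have e2 : g + k + -g = k := by abel
        rwa [e1, e2] at h3 }

/-- The stable category `St_ω`: same objects as `C`, morphisms taken modulo homotopy. -/
abbrev St := CategoryTheory.Quotient M.homotopic

/-- The projection `C ⥤ St_ω`. -/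
abbrev toSt : C ⥤ M.St := CategoryTheory.Quotient.functor M.homotopic

instance : Preadditive M.St := CategoryTheory.Quotient.preadditive _ M.homotopic_add

theorem toSt_add {X Y : C} (f g : X ⟶ Y) : M.toSt.map (f + g) = M.toSt.map f + M.toSt.map g := rfl

theorem toSt_eq_iff {X Y : C} (f g : X ⟶ Y) : M.toSt.map f = M.toSt.map g ↔ M.homotopic f g :=
  CategoryTheory.Quotient.functor_map_eq_iff _ _ _

/-! ### Bifibrant replacement and the homotopy category -/

/-- A chosen cofibrant replacement sequence `0 ⟶ K ⟶ QA ⟶ A ⟶ 0`, with `QA` cofibrant and `K`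
trivially fibrant. -/
def cofibrantSeq (A : C) : SpecialPrecover M.Q (M.W ⊓ M.R) A :=
  (M.leftPair.enoughProjectives A).some

/-- A chosen fibrant replacement sequence `0 ⟶ A ⟶ RA ⟶ L ⟶ 0`, with `RA` fibrant and `L`
trivially cofibrant. -/
def fibrantSeq (A : C) : SpecialPreenvelope (M.Q ⊓ M.W) M.R A :=
  (M.rightPair.enoughInjectives A).some

/-- The cofibrant replacement `QA`. -/
abbrev cofRep (A : C) : C := (M.cofibrantSeq A).P

/-- The projection `QA ⟶ A`. -/
abbrev cofRepπ (A : C) : M.cofRep A ⟶ A := (M.cofibrantSeq A).p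

/-- The bifibrant replacement `RQA`. -/
abbrev bifRep (A : C) : C := (M.fibrantSeq (M.cofRep A)).E

/-- The inclusion `QA ⟶ RQA`. -/
abbrev bifRepι (A : C) : M.cofRep A ⟶ M.bifRep A := (M.fibrantSeq (M.cofRep A)).j

theorem Q_bifRep (A : C) : M.Q (M.bifRep A) :=
  M.leftPair.left_ext (M.fibrantSeq (M.cofRep A)).shortExact (M.cofibrantSeq A).hP
    (M.fibrantSeq (M.cofRep A)).hL.1

theorem R_bifRep (A : C) : M.R (M.bifRep A) := (M.fibrantSeq (M.cofRep A)).hE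

theorem core_bifRep {A : C} (hA : M.W A) : M.core (M.bifRep A) :=
  M.core_iff.2 ⟨M.Q_bifRep A, M.thick.middle _ (M.fibrantSeq (M.cofRep A)).shortExact
    (M.thick.middle _ (M.cofibrantSeq A).shortExact (M.cofibrantSeq A).hK.1 hA)
    (M.fibrantSeq (M.cofRep A)).hL.2, M.R_bifRep A⟩

/-- `u : RQA ⟶ RQB` is of the form `R(Q(f))`: there is `g = Q(f) : QA ⟶ QB` making both squares
`QA ⟶ A`, `QB ⟶ B` and `QA ⟶ RQA`, `QB ⟶ RQB` commute. -/
def IsBifLift {A B : C} (f : A ⟶ B) (u : M.bifRep A ⟶ M.bifRep B) : Prop :=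
  ∃ g : M.cofRep A ⟶ M.cofRep B, g ≫ M.cofRepπ B = M.cofRepπ A ≫ f ∧ M.bifRepι A ≫ u = g ≫ M.bifRepι B

theorem exists_isBifLift {A B : C} (f : A ⟶ B) : ∃ u, M.IsBifLift f u := by
  obtain ⟨g, hg⟩ := exists_lift_shortExact (M.cofibrantSeq B).shortExact
    (M.leftPair.vanish (M.cofibrantSeq A).hP (M.cofibrantSeq B).hK) (M.cofRepπ A ≫ f)
  obtain ⟨u, hu⟩ := exists_extension_shortExact (M.fibrantSeq (M.cofRep A)).shortExact
    (M.rightPair.vanish (M.fibrantSeq (M.cofRep A)).hL (M.R_bifRep B)) (g ≫ M.bifRepι B)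
  exact ⟨u, g, hg, hu⟩

/-- A morphism from a cofibrant object to a trivially fibrant one factors through the core. -/
theorem factor_left {A V : C} (hA : M.Q A) (hV : M.W V ∧ M.R V) (f : A ⟶ V) :
    ∃ (U : C) (_ : M.core U) (a : A ⟶ U) (b : U ⟶ V), f = a ≫ b := by
  obtain ⟨S⟩ := M.leftPair.enoughProjectives V
  obtain ⟨l, hl⟩ := exists_lift_shortExact S.shortExact (M.leftPair.vanish hA S.hK) f
  exact ⟨S.P, M.core_iff.2 ⟨S.hP, M.thick.middle _ S.shortExact S.hK.1 hV.1,
    M.rightPair.right_ext S.shortExact S.hK.2 hV.2⟩, l, S.p, hl.symm⟩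

/-- A morphism from a trivially cofibrant object to a fibrant one factors through the core. -/
theorem factor_right {V B : C} (hV : M.Q V ∧ M.W V) (hB : M.R B) (f : V ⟶ B) :
    ∃ (U : C) (_ : M.core U) (a : V ⟶ U) (b : U ⟶ B), f = a ≫ b := by
  obtain ⟨S⟩ := M.rightPair.enoughInjectives V
  obtain ⟨l, hl⟩ := exists_extension_shortExact S.shortExact (M.rightPair.vanish S.hL hB) f
  exact ⟨S.E, M.core_iff.2 ⟨M.leftPair.left_ext S.shortExact hV.1 S.hL.1,
    M.thick.middle _ S.shortExact hV.2 S.hL.2, S.hE⟩, S.j, l, hl.symm⟩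

theorem IsBifLift.homotopic {A B : C} {f : A ⟶ B} {u u' : M.bifRep A ⟶ M.bifRep B}
    (hu : M.IsBifLift f u) (hu' : M.IsBifLift f u') : M.homotopic u u' := by
  obtain ⟨g, hg, hgu⟩ := hu
  obtain ⟨g', hg', hgu'⟩ := hu'
  let S := M.cofibrantSeq B
  let T := M.fibrantSeq (M.cofRep A)
  have hz : (g' - g) ≫ S.p = 0 := by
    rw [Preadditive.sub_comp]
    exact sub_eq_zero.2 (hg'.trans hg.symm)
  have : Mono S.i := S.shortExact.mono_f
  let k : M.cofRep A ⟶ S.K := S.shortExact.exact.lift (g' - g) hz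
  have hk : k ≫ S.i = g' - g := S.shortExact.exact.lift_f (g' - g) hz
  obtain ⟨m, hm⟩ := exists_extension_shortExact T.shortExact
    (M.leftPair.vanish T.hL.1 S.hK) k
  have hm : M.bifRepι A ≫ m = k := hm
  have hz2 : M.bifRepι A ≫ (u' - u - m ≫ S.i ≫ M.bifRepι B) = 0 := by
    rw [Preadditive.comp_sub, Preadditive.comp_sub, hgu, hgu', ← Category.assoc, hm,
      ← Category.assoc, hk, Preadditive.sub_comp]
    abel
  have : Epi T.q := T.shortExact.epi_g
  let c : T.L ⟶ M.bifRep B := T.shortExact.exact.desc _ hz2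
  have hc : T.q ≫ c = u' - u - m ≫ S.i ≫ M.bifRepι B := T.shortExact.exact.g_desc _ hz2
  obtain ⟨U, hU, a, b, hab⟩ := M.factor_left (M.Q_bifRep A) S.hK m
  obtain ⟨V, hV, a', b', hab'⟩ := M.factor_right T.hL (M.R_bifRep B) c
  refine ⟨U ⊞ V, M.core_biprod hU hV, biprod.lift a (T.q ≫ a'),
    biprod.desc (b ≫ S.i ≫ M.bifRepι B) b', ?_⟩
  rw [biprod.lift_desc, ← Category.assoc, ← hab, Category.assoc, ← hab', hc]
  abel

theorem isBifLift_id (A : C) : M.IsBifLift (𝟙 A) (𝟙 _) := ⟨𝟙 _, by simp, by simp⟩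

theorem IsBifLift.comp {A B D : C} {f : A ⟶ B} {g : B ⟶ D} {u : M.bifRep A ⟶ M.bifRep B}
    {t : M.bifRep B ⟶ M.bifRep D} (hu : M.IsBifLift f u) (ht : M.IsBifLift g t) :
    M.IsBifLift (f ≫ g) (u ≫ t) := by
  obtain ⟨a, ha, ha'⟩ := hu
  obtain ⟨b, hb, hb'⟩ := ht
  exact ⟨a ≫ b, by rw [Category.assoc, hb, ← Category.assoc, ha, Category.assoc],
    by rw [← Category.assoc, ha', Category.assoc, hb', Category.assoc]⟩

theorem IsBifLift.add {A B : C} {f g : A ⟶ B} {u t : M.bifRep A ⟶ M.bifRep B}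
    (hu : M.IsBifLift f u) (ht : M.IsBifLift g t) : M.IsBifLift (f + g) (u + t) := by
  obtain ⟨a, ha, ha'⟩ := hu
  obtain ⟨b, hb, hb'⟩ := ht
  exact ⟨a + b, by simp [Preadditive.add_comp, Preadditive.comp_add, ha, hb],
    by simp [Preadditive.add_comp, Preadditive.comp_add, ha', hb']⟩

/-- The homotopy category: same objects as `C`, and
`Ho(A, B) = Hom_ω(RQA, RQB)`. -/
abbrev Ho := InducedCategory M.St (fun A : C => M.toSt.obj (M.bifRep A))

/-- The canonical functor `C ⥤ Ho`: identity on objects, `f ↦ [R(Q(f))]` on morphisms. -/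
def γ : C ⥤ M.Ho where
  obj A := A
  map f := InducedCategory.homMk (M.toSt.map (M.exists_isBifLift f).choose)
  map_id A := by
    ext
    exact (M.toSt_eq_iff _ _).2
      ((M.exists_isBifLift (𝟙 A)).choose_spec.homotopic M (M.isBifLift_id A)) |>.trans
      (M.toSt.map_id _)
  map_comp f g := by
    ext
    exact ((M.toSt_eq_iff _ _).2 ((M.exists_isBifLift (f ≫ g)).choose_spec.homotopic M
      ((M.exists_isBifLift f).choose_spec.comp M (M.exists_isBifLift g).choose_spec))).trans
      (M.toSt.map_comp _ _)

theorem γ_map_eq {A B : C} {f : A ⟶ B} {u : M.bifRep A ⟶ M.bifRep B} (h : M.IsBifLift f u) :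
    (M.γ.map f).hom = M.toSt.map u := by
  exact (M.toSt_eq_iff _ _).2 ((M.exists_isBifLift f).choose_spec.homotopic M h)

theorem γ_map_add {A B : C} (f g : A ⟶ B) : M.γ.map (f + g) = M.γ.map f + M.γ.map g := by
  ext
  exact M.γ_map_eq ((M.exists_isBifLift f).choose_spec.add M (M.exists_isBifLift g).choose_spec)

theorem γ_map_eq_of_factor {A B V : C} (hV : M.W V) {f g : A ⟶ B} (a : A ⟶ V) (b : V ⟶ B)
    (h : g - f = a ≫ b) : M.γ.map f = M.γ.map g := by
  have h0 : M.γ.map a = 0 := by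
    ext
    refine (M.toSt_eq_iff _ _).2 ?_
    exact ⟨M.bifRep V, M.core_bifRep hV, -(M.exists_isBifLift a).choose, 𝟙 _,
      (zero_sub _).trans (Category.comp_id _).symm⟩
  have hg : g = f + a ≫ b := by rw [← h]; abel
  rw [hg, γ_map_add, Functor.map_comp, h0, Limits.zero_comp, add_zero]

/-! ### Loop and suspension functors -/

/-- A chosen short exact sequence `0 ⟶ K ⟶ P ⟶ RQA ⟶ 0` with `P` trivially cofibrant (in
particular trivial) and `K` fibrant. -/
def loopSeq (A : C) : SpecialPrecover (M.Q ⊓ M.W) M.R (M.bifRep A) :=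
  (M.rightPair.enoughProjectives (M.bifRep A)).some

/-- A chosen short exact sequence `0 ⟶ RQA ⟶ E ⟶ L ⟶ 0` with `E` trivially fibrant (in particular
trivial) and `L` cofibrant. -/
def suspSeq (A : C) : SpecialPreenvelope M.Q (M.W ⊓ M.R) (M.bifRep A) :=
  (M.leftPair.enoughInjectives (M.bifRep A)).some

/-- `k` is the map on kernels in a morphism of short exact sequences
from `loopSeq A` to `loopSeq B` completing `f : RQA ⟶ RQB`. -/
def IsLoopMap {A B : C} (f : M.bifRep A ⟶ M.bifRep B) (k : (M.loopSeq A).K ⟶ (M.loopSeq B).K) : Prop :=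
  ∃ h : (M.loopSeq A).P ⟶ (M.loopSeq B).P,
    h ≫ (M.loopSeq B).p = (M.loopSeq A).p ≫ f ∧ k ≫ (M.loopSeq B).i = (M.loopSeq A).i ≫ h

/-- `c` is the map on cokernels in a morphism of short exact sequences
from `suspSeq A` to `suspSeq B` completing `f : RQA ⟶ RQB`. -/
def IsSuspMap {A B : C} (f : M.bifRep A ⟶ M.bifRep B) (c : (M.suspSeq A).L ⟶ (M.suspSeq B).L) : Prop :=
  ∃ h : (M.suspSeq A).E ⟶ (M.suspSeq B).E,
    (M.suspSeq A).j ≫ h = f ≫ (M.suspSeq B).j ∧ (M.suspSeq A).q ≫ c = h ≫ (M.suspSeq B).q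

theorem exists_isLoopMap {A B : C} (f : M.bifRep A ⟶ M.bifRep B) : ∃ k, M.IsLoopMap f k := by
  let S := M.loopSeq A
  let T := M.loopSeq B
  obtain ⟨h, hh⟩ := exists_lift_shortExact T.shortExact (M.rightPair.vanish S.hP T.hK) (S.p ≫ f)
  have hh : h ≫ T.p = S.p ≫ f := hh
  have hz : (S.i ≫ h) ≫ T.p = 0 := by rw [Category.assoc, hh, ← Category.assoc, S.zero, zero_comp]
  have : Mono T.i := T.shortExact.mono_f
  exact ⟨T.shortExact.exact.lift (S.i ≫ h) hz, h, hh, T.shortExact.exact.lift_f (S.i ≫ h) hz⟩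

theorem exists_isSuspMap {A B : C} (f : M.bifRep A ⟶ M.bifRep B) : ∃ c, M.IsSuspMap f c := by
  let S := M.suspSeq A
  let T := M.suspSeq B
  obtain ⟨h, hh⟩ := exists_extension_shortExact S.shortExact (M.leftPair.vanish S.hL T.hE)
    (f ≫ T.j)
  have hh : S.j ≫ h = f ≫ T.j := hh
  have hz : S.j ≫ h ≫ T.q = 0 := by
    rw [← Category.assoc, hh, Category.assoc, T.zero, comp_zero]
  have : Epi S.q := S.shortExact.epi_g
  exact ⟨S.shortExact.exact.desc (h ≫ T.q) hz, h, hh, S.shortExact.exact.g_desc (h ≫ T.q) hz⟩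

theorem IsLoopMap.γ_eq {A B : C} {f f' : M.bifRep A ⟶ M.bifRep B} (hf : M.homotopic f f')
    {k k' : (M.loopSeq A).K ⟶ (M.loopSeq B).K} (hk : M.IsLoopMap f k) (hk' : M.IsLoopMap f' k') :
    M.γ.map k = M.γ.map k' := by
  obtain ⟨h, h1, h2⟩ := hk
  obtain ⟨h', h1', h2'⟩ := hk'
  obtain ⟨V, hV, a, b, hab⟩ := hf
  rw [core_iff] at hV
  let S := M.loopSeq A
  let T := M.loopSeq B
  obtain ⟨l, hl⟩ := exists_lift_shortExact T.shortExact
    (M.rightPair.vanish ⟨hV.1, hV.2.1⟩ T.hK) b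
  have hl : l ≫ T.p = b := hl
  have hz : (h' - h - S.p ≫ a ≫ l) ≫ T.p = 0 := by
    rw [Preadditive.sub_comp, Preadditive.sub_comp, h1, h1', Category.assoc, Category.assoc, hl,
      ← hab, Preadditive.comp_sub]
    abel
  have : Mono T.i := T.shortExact.mono_f
  refine M.γ_map_eq_of_factor S.hP.2 S.i (T.shortExact.exact.lift _ hz) ?_
  have hL : T.shortExact.exact.lift _ hz ≫ T.i = h' - h - S.p ≫ a ≫ l :=
    T.shortExact.exact.lift_f _ hz
  rw [← cancel_mono T.i, Category.assoc, hL, Preadditive.sub_comp, h2, h2',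
    Preadditive.comp_sub, Preadditive.comp_sub, ← Category.assoc S.i S.p, S.zero, zero_comp, sub_zero]

theorem IsSuspMap.γ_eq {A B : C} {f f' : M.bifRep A ⟶ M.bifRep B} (hf : M.homotopic f f')
    {c c' : (M.suspSeq A).L ⟶ (M.suspSeq B).L} (hc : M.IsSuspMap f c) (hc' : M.IsSuspMap f' c') :
    M.γ.map c = M.γ.map c' := by
  obtain ⟨h, h1, h2⟩ := hc
  obtain ⟨h', h1', h2'⟩ := hc'
  obtain ⟨V, hV, a, b, hab⟩ := hf
  rw [core_iff] at hV
  let S := M.suspSeq A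
  let T := M.suspSeq B
  obtain ⟨l, hl⟩ := exists_extension_shortExact S.shortExact
    (M.leftPair.vanish S.hL hV.2) a
  have hl : S.j ≫ l = a := hl
  have hz : S.j ≫ (h' - h - l ≫ b ≫ T.j) = 0 := by
    rw [Preadditive.comp_sub, Preadditive.comp_sub, h1, h1', ← Category.assoc, hl,
      ← Category.assoc, ← hab, Preadditive.sub_comp]
    abel
  have : Epi S.q := S.shortExact.epi_g
  refine M.γ_map_eq_of_factor T.hE.1 (S.shortExact.exact.desc _ hz) T.q ?_
  have hL : S.q ≫ S.shortExact.exact.desc _ hz = h' - h - l ≫ b ≫ T.j :=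
    S.shortExact.exact.g_desc _ hz
  rw [← cancel_epi S.q, ← Category.assoc, hL, Preadditive.comp_sub, h2, h2',
    Preadditive.sub_comp, Preadditive.sub_comp, Category.assoc, Category.assoc, T.zero,
    comp_zero, comp_zero, sub_zero]

theorem exists_rep {A B : M.Ho} (φ : A ⟶ B) : ∃ f : M.bifRep A ⟶ M.bifRep B, M.toSt.map f = φ.hom :=
  M.toSt.map_surjective φ.hom

theorem exists_loopMap {A B : M.Ho} (φ : A ⟶ B) :
    ∃ k : (M.loopSeq A).K ⟶ (M.loopSeq B).K, ∃ f, M.toSt.map f = φ.hom ∧ M.IsLoopMap f k := by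
  obtain ⟨f, hf⟩ := M.exists_rep φ
  obtain ⟨k, hk⟩ := M.exists_isLoopMap f
  exact ⟨k, f, hf, hk⟩

theorem exists_suspMap {A B : M.Ho} (φ : A ⟶ B) :
    ∃ c : (M.suspSeq A).L ⟶ (M.suspSeq B).L, ∃ f, M.toSt.map f = φ.hom ∧ M.IsSuspMap f c := by
  obtain ⟨f, hf⟩ := M.exists_rep φ
  obtain ⟨c, hc⟩ := M.exists_isSuspMap f
  exact ⟨c, f, hf, hc⟩

/-- The loop functor `Ω : Ho ⥤ Ho`: the object `ΩA` is the kernel of an epimorphism onto (the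
bifibrant replacement of) `A` from a trivial object, and `Ω[f] = [k]` when `f` completes to a
morphism of short exact sequences with map `k` on kernels. -/
def loop : M.Ho ⥤ M.Ho where
  obj A := M.γ.obj (M.loopSeq A).K
  map φ := M.γ.map (M.exists_loopMap φ).choose
  map_id A := by
    obtain ⟨f, hf, hk⟩ := (M.exists_loopMap (𝟙 A)).choose_spec
    refine (hk.γ_eq M ((M.toSt_eq_iff f (𝟙 _)).1 (hf.trans (M.toSt.map_id _).symm))
      ⟨𝟙 _, by simp, by simp⟩ : _ = M.γ.map (𝟙 _)).trans (M.γ.map_id _)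
  map_comp {A B D} φ ψ := by
    obtain ⟨f, hf, h, h1, h2⟩ := (M.exists_loopMap φ).choose_spec
    obtain ⟨g, hg, h', h1', h2'⟩ := (M.exists_loopMap ψ).choose_spec
    obtain ⟨e, he, hk⟩ := (M.exists_loopMap (φ ≫ ψ)).choose_spec
    rw [← Functor.map_comp]
    refine hk.γ_eq M ((M.toSt_eq_iff e (f ≫ g)).1 ?_) ⟨h ≫ h', ?_, ?_⟩
    · rw [he, Functor.map_comp, hf, hg]; rfl
    · rw [Category.assoc, h1', ← Category.assoc, h1, Category.assoc]
    · rw [Category.assoc, h2', ← Category.assoc, h2, Category.assoc]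

/-- The suspension functor `Σ : Ho ⥤ Ho`: the object `ΣA` is the cokernel of a monomorphism from
(the bifibrant replacement of) `A` into a trivial object, and `Σ[f] = [c]` when `f` completes to a
morphism of short exact sequences with map `c` on cokernels. -/
def susp : M.Ho ⥤ M.Ho where
  obj A := M.γ.obj (M.suspSeq A).L
  map φ := M.γ.map (M.exists_suspMap φ).choose
  map_id A := by
    obtain ⟨f, hf, hk⟩ := (M.exists_suspMap (𝟙 A)).choose_spec
    refine (hk.γ_eq M ((M.toSt_eq_iff f (𝟙 _)).1 (hf.trans (M.toSt.map_id _).symm))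
      ⟨𝟙 _, by simp, by simp⟩ : _ = M.γ.map (𝟙 _)).trans (M.γ.map_id _)
  map_comp {A B D} φ ψ := by
    obtain ⟨f, hf, h, h1, h2⟩ := (M.exists_suspMap φ).choose_spec
    obtain ⟨g, hg, h', h1', h2'⟩ := (M.exists_suspMap ψ).choose_spec
    obtain ⟨e, he, hk⟩ := (M.exists_suspMap (φ ≫ ψ)).choose_spec
    rw [← Functor.map_comp]
    refine hk.γ_eq M ((M.toSt_eq_iff e (f ≫ g)).1 ?_) ⟨h ≫ h', ?_, ?_⟩
    · rw [he, Functor.map_comp, hf, hg]; rfl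
    · rw [← Category.assoc, h1, Category.assoc, h1', Category.assoc]
    · rw [← Category.assoc, h2, Category.assoc, h2', Category.assoc]

/-- The iterate `F^n` of an endofunctor. -/
def iter {D : Type*} [Category* D] (F : D ⥤ D) : ℕ → (D ⥤ D)
  | 0 => 𝟭 D
  | n + 1 => iter F n ⋙ F

/-- `Ω^n` for `n : ℤ`, with the convention `Ω^{-n} = Σ^n` for `n > 0`. -/
def loopPow : ℤ → (M.Ho ⥤ M.Ho)
  | Int.ofNat n => iter M.loop n
  | Int.negSucc n => iter M.susp (n + 1)

/-- `Σ^n` for `n : ℤ`, with the convention `Σ^{-n} = Ω^n` for `n > 0`. -/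
def suspPow : ℤ → (M.Ho ⥤ M.Ho)
  | Int.ofNat n => iter M.susp n
  | Int.negSucc n => iter M.loop (n + 1)

end AbelianModelStructure
end AbelianModel

namespace AbelianModel
namespace AbelianModelStructure

variable {C : Type u} [Category.{v} C] [Abelian C] [HasExt.{w} C] (M : AbelianModelStructure.{w} C)

/-! ### Resolutions -/

/-- An `M`-resolution of `A`: an exact chain complex
`⋯ ⟶ X 1 ⟶ X 0 ⟶ X (-1) ⟶ X (-2) ⟶ ⋯` whose differential `X 0 ⟶ X (-1)` is `ε ≫ η`, where
`⋯ ⟶ X 1 ⟶ X 0 ⟶ A ⟶ 0` (with augmentation `ε`) is a resolution by trivially cofibrant objects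
with fibrant kernels and `0 ⟶ A ⟶ X (-1) ⟶ X (-2) ⟶ ⋯` (with coaugmentation `η`) is a
coresolution by trivially fibrant objects with cofibrant cokernels. -/
structure Resolution (A : C) where
  cx : ChainComplex C ℤ
  ε : cx.X 0 ⟶ A
  η : A ⟶ cx.X (-1)
  epi_ε : Epi ε
  mono_η : Mono η
  ε_η : ε ≫ η = cx.d 0 (-1)
  exact : ∀ n, cx.ExactAt n
  trivCof : ∀ n : ℤ, 0 ≤ n → (M.Q ⊓ M.W) (cx.X n)
  trivFib : ∀ n : ℤ, n ≤ -1 → (M.W ⊓ M.R) (cx.X n)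
  kernel_ε : M.R (kernel ε)
  kernel_d : ∀ i j : ℤ, j + 1 = i → 1 ≤ i → M.R (kernel (cx.d i j))
  cokernel_η : M.Q (cokernel η)
  cokernel_d : ∀ i j : ℤ, j + 1 = i → i ≤ -1 → M.Q (cokernel (cx.d i j))

variable {M}
variable {A B D : C}

/-- The chain map `φ : W_A ⟶ W_B` extends `f : A ⟶ B`. -/
structure Extends (WA : M.Resolution A) (WB : M.Resolution B) (f : A ⟶ B) (φ : WA.cx ⟶ WB.cx) :
    Prop where
  ε : φ.f 0 ≫ WB.ε = WA.ε ≫ f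
  η : WA.η ≫ φ.f (-1) = f ≫ WB.η

theorem Resolution.exact_triple (W : M.Resolution A) (i j k : ℤ) (hij : j + 1 = i)
    (hjk : k + 1 = j) : (ShortComplex.mk (W.cx.d i j) (W.cx.d j k) (by simp)).Exact := by
  have h := W.exact j
  rwa [W.cx.exactAt_iff' i j k (by simp [hij]) (by simp; lia)] at h

theorem Resolution.d_ε (W : M.Resolution A) : W.cx.d 1 0 ≫ W.ε = 0 := by
  have := W.mono_η
  rw [← cancel_mono W.η, Category.assoc, W.ε_η]
  simp

theorem Resolution.η_d (W : M.Resolution A) : W.η ≫ W.cx.d (-1) (-2) = 0 := by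
  have := W.epi_ε
  rw [← cancel_epi W.ε, ← Category.assoc, W.ε_η]
  simp

theorem Resolution.exact_ε (W : M.Resolution A) :
    (ShortComplex.mk (W.cx.d 1 0) W.ε W.d_ε).Exact := by
  let φ : ShortComplex.mk (W.cx.d 1 0) W.ε W.d_ε ⟶
      ShortComplex.mk (W.cx.d 1 0) (W.cx.d 0 (-1)) (by simp) :=
    { τ₁ := 𝟙 _, τ₂ := 𝟙 _, τ₃ := W.η
      comm₁₂ := by simp, comm₂₃ := by simp [W.ε_η] }
  have : Epi φ.τ₁ := by dsimp [φ]; infer_instance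
  have : IsIso φ.τ₂ := by dsimp [φ]; infer_instance
  have : Mono φ.τ₃ := W.mono_η
  exact (ShortComplex.exact_iff_of_epi_of_isIso_of_mono φ).2
    (W.exact_triple 1 0 (-1) (by simp) (by simp))

theorem Resolution.exact_η (W : M.Resolution A) :
    (ShortComplex.mk W.η (W.cx.d (-1) (-2)) W.η_d).Exact := by
  let φ : ShortComplex.mk (W.cx.d 0 (-1)) (W.cx.d (-1) (-2)) (by simp) ⟶
      ShortComplex.mk W.η (W.cx.d (-1) (-2)) W.η_d :=
    { τ₁ := W.ε, τ₂ := 𝟙 _, τ₃ := 𝟙 _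
      comm₁₂ := by simp [W.ε_η], comm₂₃ := by simp }
  have : Epi φ.τ₁ := W.epi_ε
  have : IsIso φ.τ₂ := by dsimp [φ]; infer_instance
  have : Mono φ.τ₃ := by dsimp [φ]; infer_instance
  exact (ShortComplex.exact_iff_of_epi_of_isIso_of_mono φ).1
    (W.exact_triple 0 (-1) (-2) (by simp) (by simp))

theorem exists_sequence {S : ℕ → Type v} (P : ∀ n, S n → Prop) (r : ∀ n, S n → S (n + 1) → Prop)
    (s : S 0) (hs : P 0 s) (h : ∀ n (x : S n), P n x → ∃ y, r n x y ∧ P (n + 1) y) :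
    ∃ f : ∀ n, S n, f 0 = s ∧ (∀ n, P n (f n)) ∧ ∀ n, r n (f n) (f (n + 1)) := by
  choose g hg using h
  let F : ∀ n, {x : S n // P n x} := fun n =>
    Nat.rec ⟨s, hs⟩ (fun n x => ⟨g n x.1 x.2, (hg n x.1 x.2).2⟩) n
  exact ⟨fun n => (F n).1, rfl, fun n => (F n).2, fun n => (hg n (F n).1 (F n).2).1⟩

/-- One step of lifting in nonnegative degrees. -/
theorem Resolution.lift_step (WB : M.Resolution B) {T : C} (hT : (M.Q ⊓ M.W) T) (i j k : ℤ)
    (hij : j + 1 = i) (hjk : k + 1 = j) (hj : 0 ≤ j) (g : T ⟶ WB.cx.X j)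
    (hg : g ≫ WB.cx.d j k = 0) : ∃ l : T ⟶ WB.cx.X i, l ≫ WB.cx.d i j = g :=
  exists_lift (WB.exact_triple i j k hij hjk)
    (M.rightPair.vanish hT (WB.kernel_d i j hij (by lia))) g hg

/-- One step of extending in negative degrees. -/
theorem Resolution.extend_step (WA : M.Resolution A) {T : C} (hT : (M.W ⊓ M.R) T) (i j k : ℤ)
    (hij : j + 1 = i) (hjk : k + 1 = j) (hj : j ≤ -1) (g : WA.cx.X j ⟶ T)
    (hg : WA.cx.d i j ≫ g = 0) : ∃ l : WA.cx.X k ⟶ T, WA.cx.d j k ≫ l = g :=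
  exists_extension (WA.exact_triple i j k hij hjk)
    (M.leftPair.vanish (WA.cokernel_d j k hjk hj) hT) g hg

/-- Existence part of the comparison of resolutions. -/
theorem exists_extends (WA : M.Resolution A) (WB : M.Resolution B) (f : A ⟶ B) :
    ∃ φ, Extends WA WB f φ := by
  -- the nonnegative part
  obtain ⟨p0, hp0⟩ : ∃ l : WA.cx.X 0 ⟶ WB.cx.X 0, l ≫ WB.ε = WA.ε ≫ f := by
    have := WB.epi_ε
    exact exists_lift (S := ShortComplex.mk WB.ε (0 : B ⟶ B) (by simp))
      ((ShortComplex.exact_iff_epi _ rfl).2 WB.epi_ε)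
      (M.rightPair.vanish (WA.trivCof 0 le_rfl) WB.kernel_ε) _ (by simp)
  obtain ⟨p, hp, -, hpr⟩ := exists_sequence
    (S := fun n : ℕ => WA.cx.X (n : ℤ) ⟶ WB.cx.X (n : ℤ))
    (P := fun n x => WA.cx.d (n + 1 : ℤ) n ≫ x ≫ WB.cx.d (n : ℤ) (n - 1) = 0)
    (r := fun n x y => y ≫ WB.cx.d (n + 1 : ℕ) n = WA.cx.d (n + 1 : ℕ) n ≫ x) p0
    (by
      have h : WB.cx.d 0 (-1) = WB.ε ≫ WB.η := WB.ε_η.symm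
      change WA.cx.d 1 0 ≫ p0 ≫ WB.cx.d 0 (-1) = 0
      rw [h, ← Category.assoc p0, hp0, Category.assoc, ← Category.assoc (WA.cx.d 1 0), WA.d_ε,
        zero_comp])
    (by
      intro n x hx
      obtain ⟨y, hy⟩ := WB.lift_step (WA.trivCof (n + 1 : ℤ) (by lia)) (n + 1) n (n - 1) rfl
        (by lia) (by lia) (WA.cx.d (n + 1 : ℤ) n ≫ x) (by rw [Category.assoc]; exact hx)
      refine ⟨y, hy, ?_⟩
      have e : ((n + 1 : ℕ) : ℤ) - 1 = n := by lia
      rw [e]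
      change _ ≫ y ≫ WB.cx.d (n + 1 : ℤ) n = 0
      rw [hy, ← Category.assoc]
      simp)
  -- the negative part
  obtain ⟨q0, hq0⟩ : ∃ l : WA.cx.X (-1) ⟶ WB.cx.X (-1), WA.η ≫ l = f ≫ WB.η := by
    exact exists_extension (S := ShortComplex.mk (0 : A ⟶ A) WA.η (by simp))
      ((ShortComplex.exact_iff_mono _ rfl).2 WA.mono_η)
      (M.leftPair.vanish WA.cokernel_η (WB.trivFib (-1) le_rfl)) _ (by simp)
  obtain ⟨q, hq, -, hqr⟩ := exists_sequence
    (S := fun n : ℕ => WA.cx.X (Int.negSucc n) ⟶ WB.cx.X (Int.negSucc n))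
    (P := fun n x => WA.cx.d (Int.negSucc n + 1) (Int.negSucc n) ≫ x ≫
      WB.cx.d (Int.negSucc n) (Int.negSucc (n + 1)) = 0)
    (r := fun n x y => WA.cx.d (Int.negSucc n) (Int.negSucc (n + 1)) ≫ y =
      x ≫ WB.cx.d (Int.negSucc n) (Int.negSucc (n + 1))) q0
    (by
      have h : WA.cx.d 0 (-1) = WA.ε ≫ WA.η := WA.ε_η.symm
      change WA.cx.d 0 (-1) ≫ q0 ≫ WB.cx.d (-1) (-2) = 0
      rw [h, Category.assoc, ← Category.assoc WA.η, hq0, Category.assoc, WB.η_d,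
        comp_zero, comp_zero])
    (by
      intro n x hx
      obtain ⟨y, hy⟩ := WA.extend_step (WB.trivFib (Int.negSucc (n + 1)) (by lia))
        (Int.negSucc n + 1) (Int.negSucc n) (Int.negSucc (n + 1)) rfl (by lia) (by lia)
        (x ≫ WB.cx.d (Int.negSucc n) (Int.negSucc (n + 1))) hx
      refine ⟨y, hy, ?_⟩
      have e : Int.negSucc (n + 1) + 1 = Int.negSucc n := by lia
      rw [e, ← Category.assoc, hy]
      simp)
  subst hp hq
  refine ⟨{ f := fun i => match i with
              | Int.ofNat n => p n
              | Int.negSucc n => q n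
            comm' := ?_ }, hp0, hq0⟩
  rintro i j hij
  have hij : j + 1 = i := hij
  subst hij
  rcases j with n | n
  · exact hpr n
  · rcases n with _ | n
    · change p 0 ≫ WB.cx.d 0 (-1) = WA.cx.d 0 (-1) ≫ q 0
      rw [← WA.ε_η, ← WB.ε_η, Category.assoc, hq0, ← Category.assoc, hp0, Category.assoc]
    · have e : Int.negSucc (n + 1) + 1 = Int.negSucc n := by lia
      exact (hqr n).symm

/-- A chain map extending the zero morphism is null-homotopic. -/
theorem exists_homotopy_zero (WA : M.Resolution A) (WB : M.Resolution B) (h : WA.cx ⟶ WB.cx)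
    (hh : Extends WA WB 0 h) : Nonempty (Homotopy h 0) := by
  obtain ⟨p0, hp0⟩ : ∃ l : WA.cx.X 0 ⟶ WB.cx.X 1, l ≫ WB.cx.d 1 0 = h.f 0 :=
    exists_lift WB.exact_ε
      (M.rightPair.vanish (WA.trivCof 0 le_rfl) (WB.kernel_d 1 0 (by simp) le_rfl)) _
      (by have := hh.ε; simpa using this)
  obtain ⟨p, hp, -, hpr⟩ := exists_sequence
    (S := fun n : ℕ => WA.cx.X (n : ℤ) ⟶ WB.cx.X (n + 1 : ℕ))
    (P := fun n x => WA.cx.d (n + 1 : ℕ) n ≫ (h.f n - x ≫ WB.cx.d (n + 1 : ℕ) n) = 0)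
    (r := fun n x y => WA.cx.d (n + 1 : ℕ) n ≫ x + y ≫ WB.cx.d (n + 1 + 1 : ℕ) (n + 1 : ℕ)
      = h.f (n + 1 : ℕ)) p0
    (by
      change WA.cx.d 1 0 ≫ (h.f 0 - p0 ≫ WB.cx.d 1 0) = 0
      rw [hp0]; simp)
    (by
      intro n x hx
      obtain ⟨y, hy⟩ := WB.lift_step (WA.trivCof (n + 1 : ℕ) (by lia))
        ((n + 1 + 1 : ℕ) : ℤ) ((n + 1 : ℕ) : ℤ) n rfl (by lia) (by lia)
        (h.f (n + 1 : ℕ) - WA.cx.d (n + 1 : ℕ) n ≫ x) (by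
          rw [Preadditive.sub_comp, h.comm, Category.assoc, ← Preadditive.comp_sub]
          exact hx)
      refine ⟨y, by rw [hy]; abel, ?_⟩
      have e : h.f (n + 1 : ℕ) - y ≫ WB.cx.d (n + 1 + 1 : ℕ) ((n + 1 : ℕ) : ℤ) =
        WA.cx.d (n + 1 : ℕ) n ≫ x := by rw [hy]; abel
      rw [e]
      simp)
  obtain ⟨q0, hq0⟩ : ∃ l : WA.cx.X (-2) ⟶ WB.cx.X (-1), WA.cx.d (-1) (-2) ≫ l = h.f (-1) :=
    exists_extension WA.exact_η
      (M.leftPair.vanish (WA.cokernel_d (-1) (-2) (by simp) le_rfl) (WB.trivFib (-1) le_rfl)) _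
      (by have := hh.η; simpa using this)
  obtain ⟨q, hq, -, hqr⟩ := exists_sequence
    (S := fun n : ℕ => WA.cx.X (Int.negSucc (n + 1)) ⟶ WB.cx.X (Int.negSucc n))
    (P := fun n x => (h.f (Int.negSucc n) - WA.cx.d (Int.negSucc n) (Int.negSucc (n + 1)) ≫ x) ≫
      WB.cx.d (Int.negSucc n) (Int.negSucc (n + 1)) = 0)
    (r := fun n x y => WA.cx.d (Int.negSucc (n + 1)) (Int.negSucc (n + 2)) ≫ y +
      x ≫ WB.cx.d (Int.negSucc n) (Int.negSucc (n + 1)) = h.f (Int.negSucc (n + 1))) q0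
    (by
      change (h.f (-1) - WA.cx.d (-1) (-2) ≫ q0) ≫ WB.cx.d (-1) (-2) = 0
      rw [hq0]; simp)
    (by
      intro n x hx
      obtain ⟨y, hy⟩ := WA.extend_step (WB.trivFib (Int.negSucc (n + 1)) (by lia))
        (Int.negSucc n) (Int.negSucc (n + 1)) (Int.negSucc (n + 2)) (by lia) (by lia) (by lia)
        (h.f (Int.negSucc (n + 1)) - x ≫ WB.cx.d (Int.negSucc n) (Int.negSucc (n + 1))) (by
          rw [Preadditive.comp_sub, ← h.comm, ← Category.assoc, ← Preadditive.sub_comp]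
          exact hx)
      refine ⟨y, by rw [hy]; abel, ?_⟩
      have e : h.f (Int.negSucc (n + 1)) -
          WA.cx.d (Int.negSucc (n + 1)) (Int.negSucc (n + 1 + 1)) ≫ y =
        x ≫ WB.cx.d (Int.negSucc n) (Int.negSucc (n + 1)) := by
        exact sub_eq_iff_eq_add.2 (by rw [← sub_eq_iff_eq_add']; exact hy.symm)
      rw [e]
      simp)
  subst hp hq
  let s : ∀ i : ℤ, WA.cx.X i ⟶ WB.cx.X (i + 1) := fun i => match i with
    | Int.ofNat n => p n
    | Int.negSucc 0 => 0
    | Int.negSucc (n + 1) => q n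
  have key : ∀ j : ℤ, h.f (j + 1) =
      WA.cx.d (j + 1) j ≫ s j + s (j + 1) ≫ WB.cx.d (j + 1 + 1) (j + 1) := by
    rintro (n | n)
    · exact (hpr n).symm
    · rcases n with _ | n
      · change h.f 0 = WA.cx.d 0 (-1) ≫ (0 : WA.cx.X (-1) ⟶ WB.cx.X 0) +
          (show WA.cx.X 0 ⟶ WB.cx.X 1 from p 0) ≫ WB.cx.d 1 0
        rw [hp0]; simp
      · rcases n with _ | n
        · change h.f (-1) = WA.cx.d (-1) (-2) ≫ (show WA.cx.X (-2) ⟶ WB.cx.X (-1) from q 0) +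
            (0 : WA.cx.X (-1) ⟶ WB.cx.X 0) ≫ WB.cx.d 0 (-1)
          rw [hq0]; simp
        · exact (hqr n).symm
  have t : ∀ i j : ℤ, i + 1 = j → WB.cx.X (i + 1) = WB.cx.X j := fun i j e => by rw [e]
  refine ⟨{ hom := fun i j => if e : i + 1 = j then s i ≫ eqToHom (t i j e) else 0
            zero := fun i j hij => dif_neg hij
            comm := ?_ }⟩
  intro i
  obtain ⟨j, rfl⟩ : ∃ j, i = j + 1 := ⟨i - 1, by lia⟩
  rw [dNext_eq _ (show (ComplexShape.down ℤ).Rel (j + 1) j from rfl),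
    prevD_eq _ (show (ComplexShape.down ℤ).Rel (j + 1 + 1) (j + 1) from rfl), dif_pos rfl,
    dif_pos rfl, key j]
  simp

theorem exists_homotopy (WA : M.Resolution A) (WB : M.Resolution B) {f : A ⟶ B}
    {φ ψ : WA.cx ⟶ WB.cx} (hφ : Extends WA WB f φ) (hψ : Extends WA WB f ψ) :
    Nonempty (Homotopy φ ψ) := by
  obtain ⟨H⟩ := exists_homotopy_zero WA WB (φ - ψ)
    ⟨by simp [Preadditive.sub_comp, hφ.ε, hψ.ε], by simp [Preadditive.comp_sub, hφ.η, hψ.η]⟩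
  exact ⟨(Homotopy.equivSubZero).symm H⟩

/-- A chosen chain map `W_A ⟶ W_B` extending `f`; it is unique up to chain homotopy. -/
def resMap (WA : M.Resolution A) (WB : M.Resolution B) (f : A ⟶ B) : WA.cx ⟶ WB.cx :=
  (exists_extends WA WB f).choose

theorem resMap_extends (WA : M.Resolution A) (WB : M.Resolution B) (f : A ⟶ B) :
    Extends WA WB f (resMap WA WB f) := (exists_extends WA WB f).choose_spec

theorem extends_id (W : M.Resolution A) : Extends W W (𝟙 A) (𝟙 _) := ⟨by simp, by simp⟩

theorem Extends.comp {WA : M.Resolution A} {WB : M.Resolution B} {WD : M.Resolution D} {f : A ⟶ B}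
    {g : B ⟶ D} {φ : WA.cx ⟶ WB.cx} {ψ : WB.cx ⟶ WD.cx} (hφ : Extends WA WB f φ)
    (hψ : Extends WB WD g ψ) : Extends WA WD (f ≫ g) (φ ≫ ψ) :=
  ⟨by rw [HomologicalComplex.comp_f, Category.assoc, hψ.ε, ← Category.assoc, hφ.ε, Category.assoc],
   by rw [HomologicalComplex.comp_f, ← Category.assoc, hφ.η, Category.assoc, hψ.η, Category.assoc]⟩

end AbelianModelStructure
end AbelianModel

namespace AbelianModel

section Splicing

variable {C : Type u} [Category.{v} C] [Abelian C]

theorem exact_splice {S : ShortComplex C} (hS : S.ShortExact) {E B : C} (e : E ⟶ S.X₁) (he : Epi e)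
    (m : S.X₃ ⟶ B) (hm : Mono m) : ∃ h : (e ≫ S.f) ≫ S.g ≫ m = 0,
      (ShortComplex.mk (e ≫ S.f) (S.g ≫ m) h).Exact := by
  have h : (e ≫ S.f) ≫ S.g ≫ m = 0 := by
    rw [Category.assoc, ← Category.assoc S.f, S.zero, zero_comp, comp_zero]
  refine ⟨h, ?_⟩
  have h' : (e ≫ S.f) ≫ S.g = 0 := by rw [Category.assoc, S.zero, comp_zero]
  let φ : ShortComplex.mk (e ≫ S.f) S.g h' ⟶ S := { τ₁ := e, τ₂ := 𝟙 _, τ₃ := 𝟙 _ }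
  let ψ : ShortComplex.mk (e ≫ S.f) S.g h' ⟶ ShortComplex.mk (e ≫ S.f) (S.g ≫ m) h :=
    { τ₁ := 𝟙 _, τ₂ := 𝟙 _, τ₃ := m }
  have : Epi φ.τ₁ := by assumption
  have : IsIso φ.τ₂ := by dsimp [φ]; infer_instance
  have : Mono φ.τ₃ := by dsimp [φ]; infer_instance
  have : Epi ψ.τ₁ := by dsimp [ψ]; infer_instance
  have : IsIso ψ.τ₂ := by dsimp [ψ]; infer_instance
  have : Mono ψ.τ₃ := by assumption
  exact (ShortComplex.exact_iff_of_epi_of_isIso_of_mono ψ).1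
    ((ShortComplex.exact_iff_of_epi_of_isIso_of_mono φ).2 hS.exact)

variable [HasExt.{w} C]

theorem IsCotorsionPair.right_iso {X Y : ObjectProperty C}
    (h : IsCotorsionPair X Y) {A B : C} (e : A ≅ B) (hA : Y A) : Y B := by
  rw [h.right_iff] at hA ⊢
  intro T hT
  have := hA T hT
  refine ⟨fun a b => ?_⟩
  have key : ∀ a : Abelian.Ext T B 1, a = 0 := fun a => by
    rw [← Ext.comp_mk₀_id a, ← e.inv_hom_id, ← Ext.mk₀_comp_mk₀,
      ← Ext.comp_assoc_of_third_deg_zero,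
      Subsingleton.elim (a.comp (Ext.mk₀ e.inv) (add_zero 1)) 0, Ext.zero_comp]
  rw [key a, key b]

theorem IsCotorsionPair.left_iso {X Y : ObjectProperty C}
    (h : IsCotorsionPair X Y) {A B : C} (e : A ≅ B) (hA : X A) : X B := by
  rw [h.left_iff] at hA ⊢
  intro T hT
  have := hA T hT
  refine ⟨fun a b => ?_⟩
  have key : ∀ a : Abelian.Ext B T 1, a = 0 := fun a => by
    rw [← Ext.mk₀_id_comp a, ← e.inv_hom_id, ← Ext.mk₀_comp_mk₀_assoc,
      Subsingleton.elim ((Ext.mk₀ e.hom).comp a (zero_add 1)) 0, Ext.comp_zero]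
  rw [key a, key b]

end Splicing
namespace AbelianModelStructure

variable {C : Type u} [Category.{v} C] [Abelian C] [HasExt.{w} C] (M : AbelianModelStructure.{w} C)

/-! ### Existence of resolutions -/

/-- The iterated kernels of chosen special precovers, starting from `A`. -/
def kerSeq (A : C) : ℕ → C
  | 0 => A
  | n + 1 => (M.rightPair.enoughProjectives (kerSeq A n)).some.K

/-- The iterated cokernels of chosen special preenvelopes, starting from `A`. -/
def cokSeq (A : C) : ℕ → C
  | 0 => A
  | n + 1 => (M.leftPair.enoughInjectives (cokSeq A n)).some.L

/-- The chosen special precover of the `n`-th iterated kernel. -/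
abbrev pre (A : C) (n : ℕ) : SpecialPrecover (M.Q ⊓ M.W) M.R (M.kerSeq A n) :=
  (M.rightPair.enoughProjectives (M.kerSeq A n)).some

/-- The chosen special preenvelope of the `n`-th iterated cokernel. -/
abbrev env (A : C) (n : ℕ) : SpecialPreenvelope M.Q (M.W ⊓ M.R) (M.cokSeq A n) :=
  (M.leftPair.enoughInjectives (M.cokSeq A n)).some

/-- The objects of the spliced complex. -/
def spliceX (A : C) : ℤ → C
  | Int.ofNat n => (M.pre A n).P
  | Int.negSucc n => (M.env A n).E

/-- The differentials of the spliced complex. -/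
def spliceD (A : C) : ∀ n : ℤ, M.spliceX A (n + 1) ⟶ M.spliceX A n
  | Int.ofNat n => (M.pre A (n + 1)).p ≫ (M.pre A n).i
  | Int.negSucc 0 => (M.pre A 0).p ≫ (M.env A 0).j
  | Int.negSucc (n + 1) => (M.env A n).q ≫ (M.env A (n + 1)).j

theorem splice_exact (A : C) (n : ℤ) : ∃ h : M.spliceD A (n + 1) ≫ M.spliceD A n = 0,
    (ShortComplex.mk (M.spliceD A (n + 1)) (M.spliceD A n) h).Exact := by
  have hp : ∀ n, Epi (M.pre A n).p := fun n => (M.pre A n).shortExact.epi_g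
  have hq : ∀ n, Epi (M.env A n).q := fun n => (M.env A n).shortExact.epi_g
  have hi : ∀ n, Mono (M.pre A n).i := fun n => (M.pre A n).shortExact.mono_f
  have hj : ∀ n, Mono (M.env A n).j := fun n => (M.env A n).shortExact.mono_f
  rcases n with n | n
  · exact exact_splice (M.pre A (n + 1)).shortExact (M.pre A (n + 2)).p (hp (n + 2))
      (M.pre A n).i (hi n)
  · rcases n with _ | n
    · exact exact_splice (M.pre A 0).shortExact (M.pre A 1).p (hp 1) (M.env A 0).j (hj 0)
    · rcases n with _ | n
      · exact exact_splice (M.env A 0).shortExact (M.pre A 0).p (hp 0) (M.env A 1).j (hj 1)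
      · exact exact_splice (M.env A (n + 1)).shortExact (M.env A n).q (hq n)
          (M.env A (n + 2)).j (hj (n + 2))

theorem R_kernel {A B : C} (S : SpecialPrecover (M.Q ⊓ M.W) M.R A) (m : A ⟶ B)
    (hm : Mono m) :
    M.R (kernel (S.p ≫ m)) :=
  have := S.shortExact.mono_f
  M.rightPair.right_iso ((IsLimit.conePointUniqueUpToIso S.shortExact.fIsKernel
    (kernelIsKernel S.p)).trans (kernelCompMono S.p m).symm) S.hK

theorem Q_cokernel {A B : C} (S : SpecialPreenvelope M.Q (M.W ⊓ M.R) A) (e : B ⟶ A)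
    (he : Epi e) :
    M.Q (cokernel (e ≫ S.j)) :=
  M.leftPair.left_iso ((IsColimit.coconePointUniqueUpToIso S.shortExact.gIsCokernel
    (cokernelIsCokernel S.j)).trans (cokernelEpiComp e S.j).symm) S.hL

theorem R_kernel_p {A : C} (S : SpecialPrecover (M.Q ⊓ M.W) M.R A) : M.R (kernel S.p) :=
  have := S.shortExact.mono_f
  M.rightPair.right_iso (IsLimit.conePointUniqueUpToIso S.shortExact.fIsKernel
    (limit.isLimit _)) S.hK

theorem Q_cokernel_j {A : C} (S : SpecialPreenvelope M.Q (M.W ⊓ M.R) A) : M.Q (cokernel S.j) :=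
  have := S.shortExact.epi_g
  M.leftPair.left_iso (IsColimit.coconePointUniqueUpToIso S.shortExact.gIsCokernel
    (colimit.isColimit _)) S.hL

/-- Every object has an `M`-resolution. -/
theorem nonempty_resolution (A : C) : Nonempty (M.Resolution A) := by
  let K : ChainComplex C ℤ := ChainComplex.of (M.spliceX A) (M.spliceD A)
    (fun n => (M.splice_exact A n).choose)
  have hd : ∀ n, K.d (n + 1) n = M.spliceD A n := fun n => ChainComplex.of_d _ _ n
  have hp : ∀ n, Epi (M.pre A n).p := fun n => (M.pre A n).shortExact.epi_g
  have hq : ∀ n, Epi (M.env A n).q := fun n => (M.env A n).shortExact.epi_g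
  have hi : ∀ n, Mono (M.pre A n).i := fun n => (M.pre A n).shortExact.mono_f
  have hj : ∀ n, Mono (M.env A n).j := fun n => (M.env A n).shortExact.mono_f
  refine ⟨{ cx := K, ε := (M.pre A 0).p, η := (M.env A 0).j, epi_ε := hp 0, mono_η := hj 0,
            ε_η := (hd (Int.negSucc 0)).symm, exact := ?_, trivCof := ?_, trivFib := ?_, kernel_ε := ?_,
            kernel_d := ?_, cokernel_η := ?_, cokernel_d := ?_ }⟩
  · intro n
    obtain ⟨m, rfl⟩ : ∃ m, n = m + 1 := ⟨n - 1, by lia⟩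
    rw [K.exactAt_iff' (m + 1 + 1) (m + 1) m (by simp) (by simp)]
    obtain ⟨h, hE⟩ := M.splice_exact A m
    have := hE
    simp only [← hd] at this
    exact this
  · rintro (n | n) hn
    · exact (M.pre A n).hP
    · exact absurd hn (by lia)
  · rintro (n | n) hn
    · exact absurd hn (by simp; lia)
    · exact (M.env A n).hE
  · exact M.R_kernel_p (M.pre A 0)
  · rintro i j rfl hij
    rw [hd]
    rcases j with n | n
    · exact M.R_kernel (M.pre A (n + 1)) (M.pre A n).i (hi n)
    · exact absurd hij (by lia)
  · exact M.Q_cokernel_j (M.env A 0)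
  · rintro i j rfl hij
    rw [hd]
    rcases j with n | n
    · exact absurd hij (by simp)
    · rcases n with _ | n
      · exact absurd hij (by simp)
      · exact M.Q_cokernel (M.env A (n + 1)) (M.env A n).q (hq n)

end AbelianModelStructure
end AbelianModel

namespace AbelianModel

variable {C : Type u} [Category.{v} C] [Abelian C]

/-- Passage to cochain notation: `K` viewed as a cochain complex with `K^n = K_{-n-1}`. -/
def toCochain : ChainComplex C ℤ ⥤ CochainComplex C ℤ where
  obj K :=
    { X := fun n => K.X (-n - 1)
      d := fun i j => K.d (-i - 1) (-j - 1)
      shape := fun i j hij => K.shape _ _ fun h => hij (by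
        change i + 1 = j
        have h : -j - 1 + 1 = -i - 1 := h
        lia) }
  map φ := { f := fun n => φ.f (-n - 1) }

/-- A chain homotopy, in cochain notation. -/
def toCochainHomotopy {K L : ChainComplex C ℤ} {φ ψ : K ⟶ L} (h : Homotopy φ ψ) :
    Homotopy (toCochain.map φ) (toCochain.map ψ) where
  hom i j := h.hom (-i - 1) (-j - 1)
  zero i j hij := h.zero _ _ fun e => hij (by
    change j + 1 = i
    have e : -i - 1 + 1 = -j - 1 := e
    lia)
  comm i := by
    have e1 : (ComplexShape.down ℤ).Rel (-i - 1) (-(i + 1) - 1) := by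
      change -(i + 1) - 1 + 1 = -i - 1; lia
    have e2 : (ComplexShape.down ℤ).Rel (-(i - 1) - 1) (-i - 1) := by
      change -i - 1 + 1 = -(i - 1) - 1; lia
    have := h.comm (-i - 1)
    rw [dNext_eq _ e1, prevD_eq _ e2] at this
    refine this.trans (congr_arg₂ _ (congr_arg₂ _ ?_ ?_) rfl)
    · exact (dNext_eq (C := toCochain.obj K) (D := toCochain.obj L)
        (fun i j => h.hom (-i - 1) (-j - 1))
        (show (ComplexShape.up ℤ).Rel i (i + 1) from rfl)).symm
    · exact (prevD_eq (C := toCochain.obj K) (D := toCochain.obj L)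
        (fun i j => h.hom (-i - 1) (-j - 1))
        (show (ComplexShape.up ℤ).Rel (i - 1) i from by simp)).symm

/-- The cochain complex `Hom(K, B)` of a chain complex `K`, with `Hom(K_n, B)` in degree `n`. -/
def homInto (K : ChainComplex C ℤ) (B : C) : CochainComplex AddCommGrpCat.{v} ℤ :=
  ((preadditiveYoneda.obj B).mapHomologicalComplex (ComplexShape.up ℤ)).obj
    ((HomologicalComplex.opFunctor C (ComplexShape.down ℤ)).obj (op K))

/-- Contravariant functoriality of `Hom(K, B)` in `K`. -/
def homIntoMapLeft {K L : ChainComplex C ℤ} (φ : K ⟶ L) (B : C) : homInto L B ⟶ homInto K B :=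
  ((preadditiveYoneda.obj B).mapHomologicalComplex (ComplexShape.up ℤ)).map
    ((HomologicalComplex.opFunctor C (ComplexShape.down ℤ)).map φ.op)

/-- Covariant functoriality of `Hom(K, B)` in `B`. -/
def homIntoMapRight (K : ChainComplex C ℤ) {B B' : C} (g : B ⟶ B') : homInto K B ⟶ homInto K B' :=
  (NatTrans.mapHomologicalComplex (preadditiveYoneda.map g) (ComplexShape.up ℤ)).app _

/-- The cochain complex `Hom(A, K)` of a cochain complex `K`, with `Hom(A, K^n)` in degree `n`. -/
def homFrom (A : C) (K : CochainComplex C ℤ) : CochainComplex AddCommGrpCat.{v} ℤ :=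
  ((preadditiveCoyoneda.obj (op A)).mapHomologicalComplex (ComplexShape.up ℤ)).obj K

/-- Contravariant functoriality of `Hom(A, K)` in `A`. -/
def homFromMapLeft {A A' : C} (f : A ⟶ A') (K : CochainComplex C ℤ) : homFrom A' K ⟶ homFrom A K :=
  (NatTrans.mapHomologicalComplex (preadditiveCoyoneda.map f.op) (ComplexShape.up ℤ)).app _

/-- Covariant functoriality of `Hom(A, K)` in `K`. -/
def homFromMapRight (A : C) {K L : CochainComplex C ℤ} (φ : K ⟶ L) : homFrom A K ⟶ homFrom A L :=
  ((preadditiveCoyoneda.obj (op A)).mapHomologicalComplex (ComplexShape.up ℤ)).map φ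

theorem homIntoMapLeft_id (K : ChainComplex C ℤ) (B : C) : homIntoMapLeft (𝟙 K) B = 𝟙 _ := by
  ext i x
  exact Category.id_comp x

theorem homIntoMapLeft_comp {K L N : ChainComplex C ℤ} (φ : K ⟶ L) (ψ : L ⟶ N) (B : C) :
    homIntoMapLeft (φ ≫ ψ) B = homIntoMapLeft ψ B ≫ homIntoMapLeft φ B := by
  ext i x
  exact Category.assoc _ _ _

theorem homIntoMapLeft_homotopy {K L : ChainComplex C ℤ} {φ ψ : K ⟶ L} (h : Homotopy φ ψ) (B : C)
    (n : ℤ) : HomologicalComplex.homologyMap (homIntoMapLeft φ B) n =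
      HomologicalComplex.homologyMap (homIntoMapLeft ψ B) n :=
  ((preadditiveYoneda.obj B).mapHomotopy h.op).homologyMap_eq n

theorem homFromMapRight_id (A : C) (K : CochainComplex C ℤ) : homFromMapRight A (𝟙 K) = 𝟙 _ :=
  CategoryTheory.Functor.map_id _ _

theorem homFromMapRight_comp (A : C) {K L N : CochainComplex C ℤ} (φ : K ⟶ L) (ψ : L ⟶ N) :
    homFromMapRight A (φ ≫ ψ) = homFromMapRight A φ ≫ homFromMapRight A ψ :=
  Functor.map_comp _ _ _

theorem homFromMapRight_homotopy (A : C) {K L : CochainComplex C ℤ} {φ ψ : K ⟶ L}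
    (h : Homotopy φ ψ) (n : ℤ) : HomologicalComplex.homologyMap (homFromMapRight A φ) n =
      HomologicalComplex.homologyMap (homFromMapRight A ψ) n :=
  ((preadditiveCoyoneda.obj (op A)).mapHomotopy h).homologyMap_eq n

namespace AbelianModelStructure

variable [HasExt.{w} C] {M : AbelianModelStructure.{w} C}

/-- The bifunctor `(A, B) ↦ ℓExt^n(A, B) = H^n(Hom(W_A, B))`, for a choice `W_A = res A` of an
`M`-resolution of every object. A morphism `f : A ⟶ A'` acts through any chain map
`W_A ⟶ W_A'` extending `f`. -/
def lExt (res : ∀ A : C, M.Resolution A) (n : ℤ) : Cᵒᵖ ⥤ C ⥤ AddCommGrpCat.{v} where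
  obj A :=
    { obj := fun B => (homInto (res A.unop).cx B).homology n
      map := fun g => HomologicalComplex.homologyMap (homIntoMapRight (res A.unop).cx g) n
      map_id := fun B => by
        rw [← HomologicalComplex.homologyMap_id]
        congr 1
        ext i x
        exact Category.comp_id x
      map_comp := fun g g' => by
        rw [← HomologicalComplex.homologyMap_comp]
        congr 1
        ext i x
        exact (Category.assoc _ _ _).symm }
  map {A A'} f :=
    { app := fun B => HomologicalComplex.homologyMap
        (homIntoMapLeft (resMap (res A'.unop) (res A.unop) f.unop) B) n
      naturality := fun B B' g => by
        dsimp only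
        rw [← HomologicalComplex.homologyMap_comp, ← HomologicalComplex.homologyMap_comp]
        congr 1
        ext i x
        exact (Category.assoc _ _ _).symm }
  map_id A := by
    ext1; funext B
    obtain ⟨h⟩ := exists_homotopy _ _ (resMap_extends (res A.unop) (res A.unop) (𝟙 A.unop))
      (extends_id _)
    refine (homIntoMapLeft_homotopy h B n).trans ?_
    rw [homIntoMapLeft_id, HomologicalComplex.homologyMap_id]
    rfl
  map_comp {A A' A''} f g := by
    ext1; funext B
    obtain ⟨h⟩ := exists_homotopy _ _
      (resMap_extends (res A''.unop) (res A.unop) (f ≫ g).unop)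
      ((resMap_extends (res A''.unop) (res A'.unop) g.unop).comp
        (resMap_extends (res A'.unop) (res A.unop) f.unop))
    refine (homIntoMapLeft_homotopy h B n).trans ?_
    rw [homIntoMapLeft_comp, HomologicalComplex.homologyMap_comp]
    rfl

/-- The bifunctor `(A, B) ↦ rExt^n(A, B) = H^n(Hom(A, W^B))`, where `W^B` is the
`M`-coresolution of `B` given by `res B` in cochain notation:
`⋯ ⟶ X 1 ⟶ X 0 ⟶ X (-1) ⟶ X (-2) ⟶ ⋯` with `X (-1)` in cohomological degree `0`. A morphism
`g : B ⟶ B'` acts through any chain map `W^B ⟶ W^B'` extending `g`. -/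
def rExt (res : ∀ B : C, M.Resolution B) (n : ℤ) : Cᵒᵖ ⥤ C ⥤ AddCommGrpCat.{v} where
  obj A :=
    { obj := fun B => (homFrom A.unop (toCochain.obj (res B).cx)).homology n
      map := fun {B B'} g => HomologicalComplex.homologyMap
        (homFromMapRight A.unop (toCochain.map (resMap (res B) (res B') g))) n
      map_id := fun B => by
        obtain ⟨h⟩ := exists_homotopy _ _ (resMap_extends (res B) (res B) (𝟙 B)) (extends_id _)
        refine (homFromMapRight_homotopy A.unop (toCochainHomotopy h) n).trans ?_
        rw [CategoryTheory.Functor.map_id, homFromMapRight_id, HomologicalComplex.homologyMap_id]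
      map_comp := fun {B B' B''} g g' => by
        obtain ⟨h⟩ := exists_homotopy _ _ (resMap_extends (res B) (res B'') (g ≫ g'))
          ((resMap_extends (res B) (res B') g).comp (resMap_extends (res B') (res B'') g'))
        refine (homFromMapRight_homotopy A.unop (toCochainHomotopy h) n).trans ?_
        rw [Functor.map_comp, homFromMapRight_comp, HomologicalComplex.homologyMap_comp] }
  map {A A'} f :=
    { app := fun B => HomologicalComplex.homologyMap
        (homFromMapLeft f.unop (toCochain.obj (res B).cx)) n
      naturality := fun B B' g => by
        dsimp only
        rw [← HomologicalComplex.homologyMap_comp, ← HomologicalComplex.homologyMap_comp]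
        congr 1
        ext i x
        exact (Category.assoc _ _ _).symm }
  map_id A := by
    ext1; funext B
    refine Eq.trans ?_ (HomologicalComplex.homologyMap_id _ n)
    dsimp only
    congr 1
    ext i x
    exact Category.id_comp x
  map_comp f g := by
    ext1; funext B
    refine Eq.trans ?_ (HomologicalComplex.homologyMap_comp _ _ n)
    dsimp only
    congr 1
    ext i x
    exact Category.assoc _ _ _

variable (M) in
/-- The bifunctor `(A, B) ↦ Ho(F A, G B)` on cofibrant objects `A` and fibrant objects `B`,
for endofunctors `F`, `G` of `Ho`. -/
def hoHom (F G : M.Ho ⥤ M.Ho) :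
    M.Q.FullSubcategoryᵒᵖ ⥤ M.R.FullSubcategory ⥤ AddCommGrpCat.{v} :=
  (M.Q.ι ⋙ M.γ ⋙ F).op ⋙ preadditiveCoyoneda ⋙
    (Functor.whiskeringLeft _ _ _).obj (M.R.ι ⋙ M.γ ⋙ G)

variable (M) in
/-- Restriction of a bifunctor on `C` to cofibrant objects in the first variable and fibrant
objects in the second. -/
def restrictCofFib (E : Cᵒᵖ ⥤ C ⥤ AddCommGrpCat.{v}) :
    M.Q.FullSubcategoryᵒᵖ ⥤ M.R.FullSubcategory ⥤ AddCommGrpCat.{v} :=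
  M.Q.ι.op ⋙ E ⋙ (Functor.whiskeringLeft _ _ _).obj M.R.ι

end AbelianModelStructure
end AbelianModel
end

noncomputable section

namespace AbelianModel
namespace AbelianModelStructure

variable {C : Type u} [Category.{v} C] [Abelian C] [HasExt.{w} C] (M : AbelianModelStructure.{w} C)

/-! Let `Z_n` be the cokernel of `X_{n+1} ⟶ X_n` in a resolution `W` of `A`. Exactness makes `0 ⟶
Z_{n+1} ⟶ X_n ⟶ Z_n ⟶ 0` short exact, and `Z_0 ≅ A`. All `X_n` are trivial. For `n ≥ 0` the kernel
`Z_{n+1}` is fibrant, so `Z_{n+1} ≅ Ω Z_n` in `Ho`. For `n ≤ -1` the object `X_n` is trivially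
fibrant, so `Z_n ≅ Σ Z_{n+1}`. Hence `Z_n ≅ Ωⁿ A` for every integer `n`, naturally with respect to
chain maps.

A degree `n` cocycle of `Hom(W_A, B)` is a map `Z_n ⟶ B`, and it is a coboundary when it extends
along `Z_n ⟶ X_{n-1}`. For `A` cofibrant, heredity makes all `Z_n` cofibrant; for `B` fibrant,
`Hom(Z_n, B) ⟶ Ho(Z_n, B)` is then surjective, and its kernel consists of the maps through the core
(`γ_map_surjective`, `exists_factor_of_γ_map_eq_zero`). Maps through the core are exactly the
coboundaries (`Resolution.γ_map_eq_zero_iff_source`): they extend because `Ext¹(Z_{n-1}, V) = 0` for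
`V` in the core, and conversely `X_{n-1}` is trivial. So the cohomology is `Ho(Z_n, B) ≅ Ho(Ωⁿ A,
B)`. The statement for `rExt` is dual, with `B` resolved and `Z_{-n} ≅ Σⁿ B`.

The middle isomorphism holds because `Ω` and `Σ` are mutually inverse: the middle term of the
sequence defining `Ω A` lies in the core, so the same sequence computes the suspension of `Ω A`; the
sequence defining `Σ A` starts at the fibrant object `RQA`, so it computes a loop object.

The technical burden is that syzygy sequences end in `X` rather than `RQX` and are not the chosen
ones. They are compared with the chosen ones along `X ⟵ QX ⟶ RQX`. The induced maps on kernels and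
cokernels are isomorphisms in `Ho` since `γ` inverts monomorphisms with trivial cokernel and
epimorphisms with trivial kernel (`isIso_γ_of_mono`, `isIso_γ_of_epi`), which rests on heredity. -/

instance : M.toSt.Additive where
  map_add := rfl

/-! ### Morphisms that vanish in the stable category -/

theorem toSt_eq_zero_iff {X Y : C} (f : X ⟶ Y) :
    M.toSt.map f = 0 ↔ ∃ (V : C) (_ : M.core V) (a : X ⟶ V) (b : V ⟶ Y), f = a ≫ b := by
  rw [eq_comm, ← M.toSt.map_zero, toSt_eq_iff]
  simp only [homotopic, sub_zero]

theorem toSt_eq_iff_sub {X Y : C} (f g : X ⟶ Y) :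
    M.toSt.map f = M.toSt.map g ↔ M.toSt.map (f - g) = 0 := by
  rw [Functor.map_sub, sub_eq_zero]

/-- A morphism from a cofibrant to a fibrant object that factors through a trivial object factors
through the core. -/
theorem toSt_eq_zero_of_factor {X V Y : C} (hX : M.Q X) (hV : M.W V) (hY : M.R Y)
    (a : X ⟶ V) (b : V ⟶ Y) : M.toSt.map (a ≫ b) = 0 := by
  -- `V` is replaced by the trivially cofibrant `S.P`: `a` lifts to it, and its maps to fibrant
  -- objects pass through the core.
  obtain ⟨S⟩ := M.leftPair.enoughProjectives V
  obtain ⟨l, hl⟩ := exists_lift_shortExact S.shortExact (M.leftPair.vanish hX S.hK) a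
  obtain ⟨U, hU, c, d, h⟩ := M.factor_right
    ⟨S.hP, M.thick.middle _ S.shortExact S.hK.1 hV⟩ hY (S.p ≫ b)
  refine (M.toSt_eq_zero_iff _).2 ⟨U, hU, l ≫ c, d, ?_⟩
  rw [Category.assoc, ← h, ← hl, Category.assoc]

theorem toSt_eq_zero_of_factor_left {X V Y : C} (hX : M.Q X) (hV : (M.W ⊓ M.R) V)
    (a : X ⟶ V) (b : V ⟶ Y) : M.toSt.map (a ≫ b) = 0 := by
  obtain ⟨U, hU, c, d, h⟩ := M.factor_left hX hV a
  exact (M.toSt_eq_zero_iff _).2 ⟨U, hU, c, d ≫ b, by rw [h, Category.assoc]⟩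

theorem toSt_eq_zero_of_factor_right {X V Y : C} (hV : (M.Q ⊓ M.W) V) (hY : M.R Y)
    (a : X ⟶ V) (b : V ⟶ Y) : M.toSt.map (a ≫ b) = 0 := by
  obtain ⟨U, hU, c, d, h⟩ := M.factor_right hV hY b
  exact (M.toSt_eq_zero_iff _).2 ⟨U, hU, a ≫ c, d, by rw [h, Category.assoc]⟩

/-- Two morphisms from a cofibrant object that agree after a trivial fibration are homotopic. -/
theorem toSt_eq_of_comp_eq {S : ShortComplex C} (hS : S.ShortExact) (hK : (M.W ⊓ M.R) S.X₁) {X : C}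
    (hX : M.Q X) {f g : X ⟶ S.X₂} (h : f ≫ S.g = g ≫ S.g) : M.toSt.map f = M.toSt.map g := by
  have := hS.mono_f
  rw [toSt_eq_iff_sub, ← hS.exact.lift_f (f - g) (by rw [Preadditive.sub_comp, h, sub_self])]
  exact M.toSt_eq_zero_of_factor_left hX hK _ _

/-- Two morphisms to a fibrant object that are homotopic before a trivial cofibration are
homotopic. -/
theorem toSt_eq_of_toSt_comp_eq {S : ShortComplex C} (hS : S.ShortExact) (hL : (M.Q ⊓ M.W) S.X₃)
    {Z : C} (hZ : M.R Z) {f g : S.X₂ ⟶ Z} (h : M.toSt.map (S.f ≫ f) = M.toSt.map (S.f ≫ g)) :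
    M.toSt.map f = M.toSt.map g := by
  have := hS.epi_g
  rw [toSt_eq_iff_sub, ← Preadditive.comp_sub, toSt_eq_zero_iff] at h
  obtain ⟨V, hV, a, b, hab⟩ := h
  obtain ⟨l, hl⟩ := exists_extension_shortExact hS
    (M.rightPair.vanish hL (M.core_iff.1 hV).2.2) a
  have h0 : S.f ≫ (f - g - l ≫ b) = 0 := by
    rw [Preadditive.comp_sub, hab, ← Category.assoc, hl, sub_self]
  -- Both summands vanish stably: the first passes through the core, the second through the
  -- trivially cofibrant cokernel.
  rw [toSt_eq_iff_sub, show f - g = l ≫ b + S.g ≫ hS.exact.desc _ h0 by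
    rw [hS.exact.g_desc]; abel, Functor.map_add,
    M.toSt_eq_zero_of_factor_right hL hZ, (M.toSt_eq_zero_iff _).2 ⟨V, hV, l, b, rfl⟩, add_zero]

/-! ### Replacements become isomorphisms -/

/-- With `exists_section`, this is how maps between replacements are carried back to `C`: the
cokernel of `QX ⟶ RQX` is trivially cofibrant, so `QX ⟶ X` extends over `RQX` when `X` is fibrant,
while `QX ⟶ X` splits when `X` is cofibrant. -/
theorem exists_retract (X : C) (hX : M.R X) :
    ∃ ρ : M.bifRep X ⟶ X, M.bifRepι X ≫ ρ = M.cofRepπ X :=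
  exists_extension_shortExact (M.fibrantSeq (M.cofRep X)).shortExact
    (M.rightPair.vanish (M.fibrantSeq (M.cofRep X)).hL hX) (M.cofRepπ X)

theorem exists_section (X : C) (hX : M.Q X) : ∃ s : X ⟶ M.cofRep X, s ≫ M.cofRepπ X = 𝟙 X :=
  exists_lift_shortExact (M.cofibrantSeq X).shortExact
    (M.leftPair.vanish hX (M.cofibrantSeq X).hK) (𝟙 X)

theorem toSt_bifRep_ext {A Z : C} (hZ : M.R Z) {f g : M.bifRep A ⟶ Z}
    (h : M.toSt.map (M.bifRepι A ≫ f) = M.toSt.map (M.bifRepι A ≫ g)) :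
    M.toSt.map f = M.toSt.map g :=
  M.toSt_eq_of_toSt_comp_eq (M.fibrantSeq (M.cofRep A)).shortExact
    (M.fibrantSeq (M.cofRep A)).hL hZ h

/-- The inverse `v` need not come from a morphism `B ⟶ A` of `C`; any stable inverse of a lift of
`f` suffices. -/
theorem isIso_γ_of_inverse {A B : C} {f : A ⟶ B} {u : M.bifRep A ⟶ M.bifRep B}
    (hu : M.IsBifLift f u) (v : M.bifRep B ⟶ M.bifRep A)
    (h : M.toSt.map (u ≫ v) = 𝟙 _) (h' : M.toSt.map (v ≫ u) = 𝟙 _) : IsIso (M.γ.map f) := by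
  refine ⟨InducedCategory.homMk (M.toSt.map v), ?_, ?_⟩
  · ext
    exact (congr_arg (· ≫ M.toSt.map v) (M.γ_map_eq hu)).trans ((M.toSt.map_comp _ _).symm.trans h)
  · ext
    exact (congr_arg (M.toSt.map v ≫ ·) (M.γ_map_eq hu)).trans ((M.toSt.map_comp _ _).symm.trans h')

/-- Lifts are unique up to homotopy, so a composite is shown to be a stable identity by exhibiting
any endomorphism of `QA` over `A` that it extends. -/
theorem IsBifLift.toSt_eq_id {A : C} {u : M.bifRep A ⟶ M.bifRep A} (hu : M.IsBifLift (𝟙 A) u) :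
    M.toSt.map u = 𝟙 _ :=
  ((M.toSt_eq_iff _ _).2 (hu.homotopic M (M.isBifLift_id A))).trans (M.toSt.map_id _)

/-- On cofibrant replacements `QA ⟶ A` may be lifted to `Q(QA) ⟶ QA`, which splits because `QA` is
cofibrant; the section induces the inverse. -/
instance isIso_γ_cofRepπ (A : C) : IsIso (M.γ.map (M.cofRepπ A)) := by
  obtain ⟨u, hu⟩ : ∃ u, M.bifRepι (M.cofRep A) ≫ u = M.cofRepπ (M.cofRep A) ≫ M.bifRepι A :=
    exists_extension_shortExact (M.fibrantSeq _).shortExact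
      (M.rightPair.vanish (M.fibrantSeq _).hL (M.R_bifRep A)) _
  obtain ⟨s, hs⟩ := M.exists_section (M.cofRep A) (M.cofibrantSeq A).hP
  obtain ⟨v, hv⟩ : ∃ v, M.bifRepι A ≫ v = s ≫ M.bifRepι (M.cofRep A) :=
    exists_extension_shortExact (M.fibrantSeq _).shortExact
      (M.rightPair.vanish (M.fibrantSeq _).hL (M.R_bifRep _)) _
  refine M.isIso_γ_of_inverse ⟨M.cofRepπ (M.cofRep A), rfl, hu⟩ v ?_ ?_
  · refine IsBifLift.toSt_eq_id M ⟨M.cofRepπ _ ≫ s, ?_, ?_⟩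
    · rw [Category.assoc, hs]
    · rw [← Category.assoc, hu, Category.assoc, hv, Category.assoc]
  · refine IsBifLift.toSt_eq_id M ⟨𝟙 _, by simp, ?_⟩
    rw [← Category.assoc, hv, Category.assoc, hu, ← Category.assoc, hs]

/-- A fibrant replacement of a cofibrant object becomes an isomorphism in `Ho`. -/
theorem isIso_γ_fibrant {S : ShortComplex C} (hS : S.ShortExact) (hL : (M.Q ⊓ M.W) S.X₃)
    (hX : M.Q S.X₁) (hE : M.R S.X₂) : IsIso (M.γ.map S.f) := by
  have hQ : M.Q S.X₂ := M.leftPair.left_ext hS hX hL.1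
  obtain ⟨u, g, hg, hu⟩ := M.exists_isBifLift S.f
  obtain ⟨s, hs⟩ := M.exists_section _ hX
  obtain ⟨s', hs'⟩ := M.exists_section _ hQ
  obtain ⟨ρ, hρ⟩ := M.exists_retract _ hE
  -- The inverse is `RQX₂ ⟶ X₂ ⟶ RQX₁`, where the second map `t` extends `X₁ ⟶ QX₁ ⟶ RQX₁`.
  obtain ⟨t, ht⟩ := exists_extension_shortExact hS (M.rightPair.vanish hL (M.R_bifRep S.X₁))
    (s ≫ M.bifRepι _)
  refine M.isIso_γ_of_inverse ⟨g, hg, hu⟩ (ρ ≫ t) ?_ ?_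
  · refine IsBifLift.toSt_eq_id M ⟨M.cofRepπ _ ≫ s, ?_, ?_⟩
    · rw [Category.assoc, hs]
    · rw [← Category.assoc, hu, Category.assoc, ← Category.assoc _ ρ, hρ, ← Category.assoc, hg,
        Category.assoc, ht, Category.assoc]
  -- It suffices to compare after restriction to `X₁`; there both maps come from maps `X₁ ⟶ QX₂`
  -- with the same image in `X₂`, and the kernel of `QX₂ ⟶ X₂` is trivially fibrant.
  · have h1 : M.toSt.map (t ≫ u) = M.toSt.map (s' ≫ M.bifRepι _) := by
      refine M.toSt_eq_of_toSt_comp_eq hS hL (M.R_bifRep _) ?_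
      rw [← Category.assoc, ht, Category.assoc, hu, ← Category.assoc, ← Category.assoc,
        M.toSt.map_comp, M.toSt.map_comp _ (M.bifRepι _)]
      congr 1
      refine M.toSt_eq_of_comp_eq (M.cofibrantSeq S.X₂).shortExact (M.cofibrantSeq S.X₂).hK hX ?_
      change (s ≫ g) ≫ M.cofRepπ _ = (S.f ≫ s') ≫ M.cofRepπ _
      rw [Category.assoc, hg, ← Category.assoc, hs, Category.assoc, hs']
      simp
    rw [Category.assoc, M.toSt.map_comp, h1, ← M.toSt.map_comp]
    refine IsBifLift.toSt_eq_id M ⟨M.cofRepπ _ ≫ s', ?_, ?_⟩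
    · rw [Category.assoc, hs']
    · rw [← Category.assoc, hρ, Category.assoc]

instance isIso_γ_bifRepι (A : C) : IsIso (M.γ.map (M.bifRepι A)) :=
  M.isIso_γ_fibrant (M.fibrantSeq _).shortExact (M.fibrantSeq _).hL (M.cofibrantSeq A).hP
    (M.R_bifRep A)

/-- The canonical isomorphism `RQA ≅ A` in `Ho`. -/
def bifIso (A : C) : M.γ.obj (M.bifRep A) ≅ M.γ.obj A :=
  (asIso (M.γ.map (M.bifRepι A))).symm ≪≫ asIso (M.γ.map (M.cofRepπ A))

theorem γ_bifRepι_bifIso (A : C) :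
    M.γ.map (M.bifRepι A) ≫ (M.bifIso A).hom = M.γ.map (M.cofRepπ A) := by
  simp [bifIso]

theorem bifIso_hom_eq {A : C} {ρ : M.bifRep A ⟶ A} (h : M.bifRepι A ≫ ρ = M.cofRepπ A) :
    (M.bifIso A).hom = M.γ.map ρ := by
  rw [← cancel_epi (M.γ.map (M.bifRepι A)), γ_bifRepι_bifIso, ← Functor.map_comp, h]

/-- A morphism of `Ho` need not come from `C`, so naturality of `bifIso` has to be checked on stable
classes; this identifies the class underlying `RQA ≅ A`. -/
theorem bifIso_hom_hom {A : C} {ρ : M.bifRep (M.bifRep A) ⟶ M.bifRep A}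
    (h : M.bifRepι (M.bifRep A) ≫ ρ = M.cofRepπ (M.bifRep A)) :
    (M.bifIso A).hom.hom = M.toSt.map ρ := by
  obtain ⟨v, g, hg, hv⟩ := M.exists_isBifLift (M.bifRepι A)
  obtain ⟨t, b, hb, ht⟩ := M.exists_isBifLift (M.cofRepπ A)
  have h1 : M.toSt.map (v ≫ ρ) = M.toSt.map t := by
    refine M.toSt_bifRep_ext (M.R_bifRep A) ?_
    rw [← Category.assoc, hv, Category.assoc, h, hg, ht, M.toSt.map_comp,
      M.toSt.map_comp b (M.bifRepι A)]
    congr 1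
    exact M.toSt_eq_of_comp_eq (M.cofibrantSeq A).shortExact (M.cofibrantSeq A).hK
      (M.cofibrantSeq _).hP hb.symm
  have h2 : M.γ.map (M.bifRepι A) ≫ InducedCategory.homMk (M.toSt.map ρ) =
      M.γ.map (M.bifRepι A) ≫ (M.bifIso A).hom := by
    rw [γ_bifRepι_bifIso]
    ext
    refine (congr_arg (· ≫ M.toSt.map ρ) (M.γ_map_eq ⟨g, hg, hv⟩)).trans ?_
    exact (M.toSt.map_comp _ _).symm.trans (h1.trans (M.γ_map_eq ⟨b, hb, ht⟩).symm)
  exact (congr_arg InducedCategory.Hom.hom ((cancel_epi _).1 h2)).symm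

/-- Naturality of `RQA ≅ A`: a morphism of `Ho` is determined by a representative. -/
theorem bifIso_naturality {A B : M.Ho} (φ : A ⟶ B) (u : M.bifRep A ⟶ M.bifRep B)
    (hu : M.toSt.map u = φ.hom) : M.γ.map u ≫ (M.bifIso B).hom = (M.bifIso A).hom ≫ φ := by
  obtain ⟨ρ, hρ⟩ := M.exists_retract (M.bifRep A) (M.R_bifRep A)
  obtain ⟨σ, hσ⟩ := M.exists_retract (M.bifRep B) (M.R_bifRep B)
  obtain ⟨t, g, hg, ht⟩ := M.exists_isBifLift u
  have key : M.toSt.map t ≫ M.toSt.map σ = M.toSt.map ρ ≫ M.toSt.map u := by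
    rw [← M.toSt.map_comp, ← M.toSt.map_comp]
    refine M.toSt_bifRep_ext (M.R_bifRep B) ?_
    rw [← Category.assoc, ht, Category.assoc, hσ, hg, ← Category.assoc, hρ]
  ext
  exact (congr_arg₂ (· ≫ ·) (M.γ_map_eq ⟨g, hg, ht⟩) (M.bifIso_hom_hom hσ)).trans
    (key.trans (congr_arg₂ (· ≫ ·) (M.bifIso_hom_hom hρ) hu.symm).symm)

/-- Morphisms in `Ho` from a cofibrant to a fibrant object are represented in `C`. -/
theorem γ_map_surjective {A B : C} (hA : M.Q A) (hB : M.R B) (φ : M.γ.obj A ⟶ M.γ.obj B) :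
    ∃ f : A ⟶ B, M.γ.map f = φ := by
  obtain ⟨u, hu⟩ : ∃ u : M.bifRep A ⟶ M.bifRep B, M.toSt.map u = φ.hom := M.exists_rep φ
  obtain ⟨s, hs⟩ := M.exists_section A hA
  obtain ⟨ρ, hρ⟩ := M.exists_retract B hB
  have h : M.γ.map s ≫ M.γ.map (M.bifRepι A) ≫ (M.bifIso A).hom = 𝟙 _ := by
    rw [γ_bifRepι_bifIso, ← Functor.map_comp, hs]
    exact M.γ.map_id A
  -- The representative is the composite `A ⟶ QA ⟶ RQA ⟶ RQB ⟶ B`.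
  refine ⟨s ≫ M.bifRepι A ≫ u ≫ ρ, ?_⟩
  have h' : M.γ.map u ≫ (M.bifIso B).hom = (M.bifIso A).hom ≫ φ := M.bifIso_naturality φ u hu
  rw [Functor.map_comp, Functor.map_comp, Functor.map_comp, ← M.bifIso_hom_eq hρ, h']
  simpa using congr_arg (· ≫ φ) h

/-- A morphism from a cofibrant to a fibrant object vanishes in `Ho` only if it factors through the
core. -/
theorem exists_factor_of_γ_map_eq_zero {A B : C} (hA : M.Q A) (hB : M.R B) {f : A ⟶ B}
    (hf : M.γ.map f = 0) :
    ∃ (V : C) (_ : M.core V) (a : A ⟶ V) (b : V ⟶ B), f = a ≫ b := by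
  obtain ⟨u, g, hg, hu⟩ := M.exists_isBifLift f
  obtain ⟨s, hs⟩ := M.exists_section A hA
  obtain ⟨ρ, hρ⟩ := M.exists_retract B hB
  have h0 : M.toSt.map u = 0 := by
    rw [← M.γ_map_eq ⟨g, hg, hu⟩, hf]; rfl
  rw [← toSt_eq_zero_iff]
  -- The section and the retraction recover `f` on the nose from its lift `u`, so stable vanishing
  -- of `u` passes to `f`.
  have h : f = s ≫ M.bifRepι A ≫ u ≫ ρ := by
    rw [← Category.assoc _ u, hu, Category.assoc, hρ, hg, ← Category.assoc, hs, Category.id_comp]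
  rw [h, M.toSt.map_comp, M.toSt.map_comp, M.toSt.map_comp u, h0, zero_comp, comp_zero, comp_zero]

instance : M.γ.Additive where
  map_add := M.γ_map_add _ _

theorem γ_map_eq_zero_of_factor {A B V : C} (hV : M.W V) (a : A ⟶ V) (b : V ⟶ B) :
    M.γ.map (a ≫ b) = 0 := by
  rw [← M.γ.map_zero]
  exact (M.γ_map_eq_of_factor hV a b (sub_zero _)).symm

end AbelianModelStructure
end AbelianModel

namespace AbelianModel

/-! ### Short exact sequences obtained from pullbacks and pushouts -/

section ShortExact

variable {C : Type u} [Category.{v} C] [Abelian C]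

/-- Since `S.f` is a monomorphism, existence of lifts already makes it a kernel; uniqueness is
automatic. -/
theorem shortExact_of_lift {S : ShortComplex C} (hf : Mono S.f) (hg : Epi S.g)
    (h : ∀ {T : C} (t : T ⟶ S.X₂), t ≫ S.g = 0 → ∃ l : T ⟶ S.X₁, l ≫ S.f = t) : S.ShortExact where
  exact := S.exact_of_f_is_kernel (KernelFork.IsLimit.ofι' S.f S.zero
    fun t ht => ⟨(h t ht).choose, (h t ht).choose_spec⟩)

theorem shortExact_of_desc {S : ShortComplex C} (hf : Mono S.f) (hg : Epi S.g)
    (h : ∀ {T : C} (t : S.X₂ ⟶ T), S.f ≫ t = 0 → ∃ l : S.X₃ ⟶ T, S.g ≫ l = t) : S.ShortExact where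
  exact := S.exact_of_g_is_cokernel (CokernelCofork.IsColimit.ofπ' S.g S.zero
    fun t ht => ⟨(h t ht).choose, (h t ht).choose_spec⟩)

/-- The pullback of a short exact sequence along a morphism to its quotient. -/
theorem shortExact_pullback {S : ShortComplex C} (hS : S.ShortExact) {X : C} (x : X ⟶ S.X₃) :
    (ShortComplex.mk (pullback.lift S.f 0 (by simp) : S.X₁ ⟶ pullback S.g x)
      (pullback.snd S.g x) (pullback.lift_snd _ _ _)).ShortExact := by
  have := hS.mono_f
  have := hS.epi_g
  refine shortExact_of_lift ?_ ?_ fun {T} t ht => ?_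
  · have : Mono ((pullback.lift S.f 0 (by simp) : S.X₁ ⟶ pullback S.g x) ≫ pullback.fst S.g x) := by
      rw [pullback.lift_fst]; infer_instance
    exact mono_of_mono _ (pullback.fst S.g x)
  · dsimp; infer_instance
  · dsimp at ht
    refine ⟨hS.exact.lift (t ≫ pullback.fst S.g x) ?_, ?_⟩
    · rw [Category.assoc, pullback.condition, ← Category.assoc, ht, zero_comp]
    · apply pullback.hom_ext
      · rw [Category.assoc, pullback.lift_fst, hS.exact.lift_f]
      · rw [Category.assoc, pullback.lift_snd, comp_zero, ht]

/-- The pushout of a short exact sequence along a morphism from its subobject. -/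
theorem shortExact_pushout {S : ShortComplex C} (hS : S.ShortExact) {X : C} (x : S.X₁ ⟶ X) :
    (ShortComplex.mk (pushout.inr S.f x)
      (pushout.desc S.g 0 (by simp) : pushout S.f x ⟶ S.X₃) (pushout.inr_desc _ _ _)).ShortExact := by
  have := hS.mono_f
  have := hS.epi_g
  refine shortExact_of_desc ?_ ?_ fun {T} t ht => ?_
  · dsimp; infer_instance
  · have : Epi (pushout.inl S.f x ≫ (pushout.desc S.g 0 (by simp) : pushout S.f x ⟶ S.X₃)) := by
      rw [pushout.inl_desc]; infer_instance
    exact epi_of_epi (pushout.inl S.f x) _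
  · dsimp at ht
    refine ⟨hS.exact.desc (pushout.inl S.f x ≫ t) ?_, ?_⟩
    · rw [← Category.assoc, pushout.condition, Category.assoc, ht, comp_zero]
    · apply pushout.hom_ext
      · rw [← Category.assoc, pushout.inl_desc, hS.exact.g_desc]
      · rw [← Category.assoc, pushout.inr_desc, zero_comp, ht]

/-- The pullback of an epimorphism along a monomorphism has the same cokernel. -/
theorem shortExact_pullback_mono {S : ShortComplex C} (hS : S.ShortExact) {P : C} (p : P ⟶ S.X₂)
    [Epi p] :
    (ShortComplex.mk (pullback.fst p S.f) (p ≫ S.g)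
      (by rw [← Category.assoc, pullback.condition, Category.assoc, S.zero, comp_zero])).ShortExact := by
  have := hS.mono_f
  have := hS.epi_g
  refine shortExact_of_lift ?_ ?_ fun {T} t ht => ?_
  · dsimp; infer_instance
  · dsimp; infer_instance
  · dsimp at ht
    exact ⟨pullback.lift t (hS.exact.lift (t ≫ p) (by simpa using ht))
      (hS.exact.lift_f _ _).symm, pullback.lift_fst _ _ _⟩

/-- The pushout of a monomorphism along an epimorphism has the same kernel. -/
theorem shortExact_pushout_epi {S : ShortComplex C} (hS : S.ShortExact) {E : C} (j : S.X₂ ⟶ E)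
    [Mono j] :
    (ShortComplex.mk (S.f ≫ j) (pushout.inl j S.g)
      (by rw [Category.assoc, pushout.condition, ← Category.assoc, S.zero, zero_comp])).ShortExact := by
  have := hS.mono_f
  have := hS.epi_g
  refine shortExact_of_desc ?_ ?_ fun {T} t ht => ?_
  · dsimp; infer_instance
  · dsimp; infer_instance
  · dsimp at ht
    exact ⟨pushout.desc t (hS.exact.desc (j ≫ t) (by simpa using ht))
      (hS.exact.g_desc _ _).symm, pushout.inl_desc _ _ _⟩

/-- For a morphism of short exact sequences, the kernel map and the middle map fit into a short
exact sequence whose quotient is a pullback. -/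
theorem shortExact_lift_pullback {S T : ShortComplex C} (hS : S.ShortExact) (hT : T.ShortExact)
    (φ : S ⟶ T) :
    (ShortComplex.mk (biprod.lift φ.τ₁ S.f : S.X₁ ⟶ T.X₁ ⊞ S.X₂)
      (biprod.desc (-(pullback.lift T.f 0 (by simp))) (pullback.lift φ.τ₂ S.g φ.comm₂₃) :
        T.X₁ ⊞ S.X₂ ⟶ pullback T.g φ.τ₃) (by
        apply pullback.hom_ext
        · simp [φ.comm₁₂, pullback.lift_fst]
        · simp [pullback.lift_snd])).ShortExact := by
  have := hS.mono_f
  have := hS.epi_g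
  have := hT.mono_f
  have := hT.epi_g
  refine shortExact_of_lift ?_ ?_ fun {Z} t ht => ?_
  · have : Mono ((biprod.lift φ.τ₁ S.f : S.X₁ ⟶ T.X₁ ⊞ S.X₂) ≫ biprod.snd) := by
      rw [biprod.lift_snd]; infer_instance
    exact mono_of_mono _ (biprod.snd : T.X₁ ⊞ S.X₂ ⟶ _)
  · refine Preadditive.epi_of_cancel_zero _ fun {Z} f hf => ?_
    dsimp at hf
    have h1 := congr_arg (biprod.inl ≫ ·) hf
    have h2 := congr_arg (biprod.inr ≫ ·) hf
    simp only [biprod.inl_desc_assoc, biprod.inr_desc_assoc, comp_zero, Preadditive.neg_comp,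
      neg_eq_zero] at h1 h2
    -- A test map `f` that kills `T.X₁` descends from the pullback to `S.X₃`; it also kills `S.X₂`,
    -- which surjects onto `S.X₃`, so it is zero.
    have hP := shortExact_pullback hT φ.τ₃
    have := hP.epi_g
    have h3 : pullback.snd T.g φ.τ₃ ≫ hP.exact.desc f h1 = f := hP.exact.g_desc f h1
    have h4 : S.g ≫ hP.exact.desc f h1 = 0 := by
      rw [← h2]; conv_rhs => rw [← h3]
      rw [← Category.assoc, pullback.lift_snd]
    rw [← h3, zero_of_epi_comp S.g h4]
    exact comp_zero
  · dsimp at ht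
    obtain ⟨a, b, rfl⟩ : ∃ a b, t = biprod.lift a b := ⟨t ≫ biprod.fst, t ≫ biprod.snd, by
      apply biprod.hom_ext <;> simp⟩
    rw [biprod.lift_desc] at ht
    have h1 := congr_arg (· ≫ pullback.fst T.g φ.τ₃) ht
    have h2 := congr_arg (· ≫ pullback.snd T.g φ.τ₃) ht
    simp only [Preadditive.add_comp, Category.assoc, Preadditive.neg_comp, Preadditive.comp_neg,
      pullback.lift_fst, pullback.lift_snd, comp_zero, neg_zero, zero_add, zero_comp] at h1 h2
    have h3 := hS.exact.lift_f b h2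
    refine ⟨hS.exact.lift b h2, ?_⟩
    apply biprod.hom_ext
    · rw [← cancel_mono T.f]
      simp only [biprod.lift_fst, Category.assoc]
      rw [φ.comm₁₂, ← Category.assoc, h3]
      exact (neg_add_eq_zero.1 h1).symm
    · simp [h3]

/-- For a morphism of short exact sequences, the middle map and the cokernel map fit into a short
exact sequence whose subobject is a pushout. -/
theorem shortExact_desc_pushout {S T : ShortComplex C} (hS : S.ShortExact) (hT : T.ShortExact)
    (φ : S ⟶ T) :
    (ShortComplex.mk (biprod.lift (-(pushout.desc φ.τ₂ T.f φ.comm₁₂.symm))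
        (pushout.desc S.g 0 (by simp)) : pushout S.f φ.τ₁ ⟶ T.X₂ ⊞ S.X₃)
      (biprod.desc T.g φ.τ₃ : T.X₂ ⊞ S.X₃ ⟶ T.X₃) (by
        apply pushout.hom_ext
        · simp [φ.comm₂₃, pushout.inl_desc_assoc]
        · simp [pushout.inr_desc_assoc])).ShortExact := by
  have := hS.mono_f
  have := hS.epi_g
  have := hT.mono_f
  have := hT.epi_g
  refine shortExact_of_desc ?_ ?_ fun {Z} t ht => ?_
  · refine Preadditive.mono_of_cancel_zero _ fun {Z} f hf => ?_
    dsimp at hf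
    have h1 := congr_arg (· ≫ biprod.fst) hf
    have h2 := congr_arg (· ≫ biprod.snd) hf
    simp only [Category.assoc, biprod.lift_fst, biprod.lift_snd, zero_comp, Preadditive.comp_neg,
      neg_eq_zero] at h1 h2
    -- A test map `f` that dies in `S.X₃` lifts to `T.X₁`; it also dies in `T.X₂`, into which `T.X₁`
    -- embeds, so it is zero.
    have hP := shortExact_pushout hS φ.τ₁
    have := hP.mono_f
    have h3 : hP.exact.lift f h2 ≫ pushout.inr S.f φ.τ₁ = f := hP.exact.lift_f f h2
    have h4 : hP.exact.lift f h2 ≫ T.f = 0 := by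
      rw [← h1]; conv_rhs => rw [← h3]
      rw [Category.assoc, pushout.inr_desc]
    rw [← h3, zero_of_comp_mono T.f h4]
    exact zero_comp
  · have : Epi (biprod.inl ≫ (biprod.desc T.g φ.τ₃ : T.X₂ ⊞ S.X₃ ⟶ T.X₃)) := by
      rw [biprod.inl_desc]; infer_instance
    exact epi_of_epi (biprod.inl : _ ⟶ T.X₂ ⊞ S.X₃) _
  · dsimp at ht
    obtain ⟨a, b, rfl⟩ : ∃ a b, t = biprod.desc a b := ⟨biprod.inl ≫ t, biprod.inr ≫ t, by
      apply biprod.hom_ext' <;> simp⟩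
    rw [biprod.lift_desc] at ht
    have h1 := congr_arg (pushout.inl S.f φ.τ₁ ≫ ·) ht
    have h2 := congr_arg (pushout.inr S.f φ.τ₁ ≫ ·) ht
    simp only [Preadditive.comp_add, Preadditive.neg_comp, Preadditive.comp_neg,
      pushout.inl_desc_assoc, pushout.inr_desc_assoc, comp_zero, zero_comp, add_zero,
      neg_eq_zero] at h1 h2
    have h3 := hT.exact.g_desc a h2
    refine ⟨hT.exact.desc a h2, ?_⟩
    apply biprod.hom_ext'
    · simp [h3]
    · rw [← cancel_epi S.g]
      simp only [biprod.inr_desc, biprod.inr_desc_assoc]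
      rw [← Category.assoc, ← φ.comm₂₃, Category.assoc, h3]
      exact neg_add_eq_zero.1 h1

end ShortExact

end AbelianModel

namespace AbelianModel
namespace AbelianModelStructure

variable {C : Type u} [Category.{v} C] [Abelian C] [HasExt.{w} C] {M : AbelianModelStructure.{w} C}

/-! ### Closure properties of hereditary model structures -/

/-- In the long exact sequence `Ext¹(X₁, B)` sits between `Ext¹(X₂, B)` and `Ext²(X₃, B)`, both zero
for `B` trivially fibrant. Only the degree 2 part of heredity is needed, here and dually in
`IsHereditary.R_cokernel`. -/
theorem IsHereditary.Q_kernel (hM : M.IsHereditary) {S : ShortComplex C} (hS : S.ShortExact)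
    (h2 : M.Q S.X₂) (h3 : M.Q S.X₃) : M.Q S.X₁ := by
  rw [M.leftPair.left_iff]
  intro B hB
  have i2 := M.leftPair.vanish h2 hB
  have i3 := hM.left _ _ h3 hB 2 (by lia)
  have key : ∀ a : Ext S.X₁ B 1, a = 0 := fun a => by
    obtain ⟨x, rfl⟩ := Ext.contravariant_sequence_exact₁ hS B a (show 1 + 1 = 2 from rfl)
      (Subsingleton.elim _ _)
    rw [Subsingleton.elim x 0, Ext.comp_zero]
  exact ⟨fun a b => by rw [key a, key b]⟩

theorem IsHereditary.R_cokernel (hM : M.IsHereditary) {S : ShortComplex C} (hS : S.ShortExact)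
    (h1 : M.R S.X₁) (h2 : M.R S.X₂) : M.R S.X₃ := by
  rw [M.rightPair.right_iff]
  intro A hA
  have i2 := M.rightPair.vanish hA h2
  have i3 := hM.right _ _ hA h1 2 (by lia)
  have key : ∀ a : Ext A S.X₃ 1, a = 0 := fun a => by
    obtain ⟨x, rfl⟩ := Ext.covariant_sequence_exact₃ A hS a (show 1 + 1 = 2 from rfl)
      (Subsingleton.elim _ _)
    rw [Subsingleton.elim x 0, Ext.zero_comp]
  exact ⟨fun a b => by rw [key a, key b]⟩

/-! ### Weak equivalences -/

/-- Applied to a map supplied by a lifting property whose composites with a map on either side are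
already known to be inverted. -/
theorem isIso_of_two_of_six {D : Type*} [Category* D] {X Y Z T : D} {f : X ⟶ Y} {g : Y ⟶ Z}
    {h : Z ⟶ T} (h1 : IsIso (f ≫ g)) (h2 : IsIso (g ≫ h)) : IsIso g := by
  have : IsSplitEpi g := ⟨⟨⟨inv (f ≫ g) ≫ f, by simp⟩⟩⟩
  have : Mono g := mono_of_mono g h
  exact isIso_of_mono_of_isSplitEpi g

/-- The difference factors through the trivial kernel. Unlike in the stable category, no cofibrancy
of `X` is needed, since `γ` kills every trivial object. -/
theorem γ_map_eq_of_comp_eq {S : ShortComplex C} (hS : S.ShortExact) (hK : M.W S.X₁) {X : C}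
    {f g : X ⟶ S.X₂} (h : f ≫ S.g = g ≫ S.g) : M.γ.map f = M.γ.map g := by
  have := hS.mono_f
  rw [← sub_eq_zero, ← M.γ.map_sub,
    ← hS.exact.lift_f (f - g) (by rw [Preadditive.sub_comp, h, sub_self])]
  exact M.γ_map_eq_zero_of_factor hK _ _

theorem γ_map_eq_of_eq_comp {S : ShortComplex C} (hS : S.ShortExact) (hL : M.W S.X₃) {Y : C}
    {f g : S.X₂ ⟶ Y} (h : S.f ≫ f = S.f ≫ g) : M.γ.map f = M.γ.map g := by
  have := hS.epi_g
  rw [← sub_eq_zero, ← M.γ.map_sub,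
    ← hS.exact.g_desc (f - g) (by rw [Preadditive.comp_sub, h, sub_self])]
  exact M.γ_map_eq_zero_of_factor hL _ _

/-- The replacement `QX₃ ⟶ X₃` lifts to `s : QX₃ ⟶ X₂`. In `QX₂ ⟶ QX₃ ⟶ X₂ ⟶ X₃` both two-step
composites become cofibrant replacements in `Ho`, so two-of-six inverts `s`, and then `S.g`. -/
theorem isIso_γ_trivFib {S : ShortComplex C} (hS : S.ShortExact) (hK : (M.W ⊓ M.R) S.X₁) :
    IsIso (M.γ.map S.g) := by
  obtain ⟨s, hs⟩ := exists_lift_shortExact hS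
    (M.leftPair.vanish (M.cofibrantSeq S.X₃).hP hK) (M.cofRepπ S.X₃)
  obtain ⟨t, ht⟩ : ∃ t, t ≫ M.cofRepπ S.X₃ = M.cofRepπ S.X₂ ≫ S.g :=
    exists_lift_shortExact (M.cofibrantSeq S.X₃).shortExact
      (M.leftPair.vanish (M.cofibrantSeq S.X₂).hP (M.cofibrantSeq S.X₃).hK) (M.cofRepπ S.X₂ ≫ S.g)
  have h1 : M.γ.map s ≫ M.γ.map S.g = M.γ.map (M.cofRepπ S.X₃) := by rw [← Functor.map_comp, hs]
  have h2 : M.γ.map t ≫ M.γ.map s = M.γ.map (M.cofRepπ S.X₂) := by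
    rw [← Functor.map_comp]
    exact γ_map_eq_of_comp_eq hS hK.1 (by rw [Category.assoc, hs, ht])
  have i1 : IsIso (M.γ.map s ≫ M.γ.map S.g) := by rw [h1]; infer_instance
  have i2 : IsIso (M.γ.map t ≫ M.γ.map s) := by rw [h2]; infer_instance
  have := isIso_of_two_of_six i2 i1
  exact IsIso.of_isIso_comp_left (M.γ.map s) _

/-- Two-of-six for `X₁ ⟶ X₂ ⟶ RX₁ ⟶ RX₂`. Cofibrancy of `X₁` enters because fibrant replacements are
so far known to be inverted only for cofibrant objects. -/
theorem isIso_γ_trivCof_of_cofibrant {S : ShortComplex C} (hS : S.ShortExact)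
    (hL : (M.Q ⊓ M.W) S.X₃) (hX : M.Q S.X₁) : IsIso (M.γ.map S.f) := by
  let T₁ := M.fibrantSeq S.X₁
  let T₂ := M.fibrantSeq S.X₂
  obtain ⟨s, hs⟩ := exists_extension_shortExact hS (M.rightPair.vanish hL T₁.hE) T₁.j
  obtain ⟨t, ht⟩ : ∃ t, T₁.j ≫ t = S.f ≫ T₂.j := exists_extension_shortExact T₁.shortExact
    (M.rightPair.vanish T₁.hL T₂.hE) (S.f ≫ T₂.j)
  have h1 : M.γ.map S.f ≫ M.γ.map s = M.γ.map T₁.j := by rw [← Functor.map_comp, hs]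
  have h2 : M.γ.map s ≫ M.γ.map t = M.γ.map T₂.j := by
    rw [← Functor.map_comp]
    exact γ_map_eq_of_eq_comp hS hL.2 (by rw [← Category.assoc, hs, ht])
  have i1 : IsIso (M.γ.map S.f ≫ M.γ.map s) := by
    rw [h1]; exact M.isIso_γ_fibrant T₁.shortExact T₁.hL hX T₁.hE
  have i2 : IsIso (M.γ.map s ≫ M.γ.map t) := by
    rw [h2]; exact M.isIso_γ_fibrant T₂.shortExact T₂.hL (M.leftPair.left_ext hS hX hL.1) T₂.hE
  have := isIso_of_two_of_six i1 i2
  exact IsIso.of_isIso_comp_right _ (M.γ.map s)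

/-- Reduction to a cofibrant source: the pullback of `QX₂ ⟶ X₂` along `S.f` is the kernel of `QX₂ ⟶
X₃`, which is cofibrant by heredity. -/
theorem isIso_γ_trivCof (hM : M.IsHereditary) {S : ShortComplex C} (hS : S.ShortExact)
    (hL : (M.Q ⊓ M.W) S.X₃) : IsIso (M.γ.map S.f) := by
  let T := M.cofibrantSeq S.X₂
  have : Epi T.p := T.shortExact.epi_g
  have h1 := shortExact_pullback_mono hS T.p
  have i1 := isIso_γ_trivCof_of_cofibrant h1 hL (hM.Q_kernel h1 T.hP hL.1)
  have i2 := isIso_γ_trivFib (shortExact_pullback T.shortExact S.f) T.hK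
  have i3 := isIso_γ_trivFib T.shortExact T.hK
  dsimp at i1 i2 i3
  have e : M.γ.map (pullback.snd T.p S.f) ≫ M.γ.map S.f =
      M.γ.map (pullback.fst T.p S.f) ≫ M.γ.map T.p := by
    rw [← Functor.map_comp, ← Functor.map_comp, pullback.condition]
  have i4 : IsIso (M.γ.map (pullback.snd T.p S.f) ≫ M.γ.map S.f) := by rw [e]; infer_instance
  exact IsIso.of_isIso_comp_left (M.γ.map (pullback.snd T.p S.f)) _

/-- A monomorphism with trivial cokernel becomes an isomorphism in `Ho`. -/
theorem isIso_γ_of_mono (hM : M.IsHereditary) {S : ShortComplex C} (hS : S.ShortExact)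
    (hL : M.W S.X₃) : IsIso (M.γ.map S.f) := by
  let T := M.cofibrantSeq S.X₃
  have hT : (M.Q ⊓ M.W) T.P := ⟨T.hP, M.thick.middle _ T.shortExact T.hK.1 hL⟩
  have i1 := isIso_γ_trivCof hM (shortExact_pullback hS T.p) hT
  have : Epi S.g := hS.epi_g
  have h2 := shortExact_pullback T.shortExact S.g
  have i2 := isIso_γ_trivFib h2 T.hK
  dsimp at i1 i2
  -- Through the pullback of `S.g` along `QX₃ ⟶ X₃`, `S.f` is a monomorphism with trivially
  -- cofibrant cokernel followed by an epimorphism with trivially fibrant kernel.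
  have e : S.f = (pullback.lift S.f 0 (by simp) : S.X₁ ⟶ pullback S.g T.p) ≫
      (pullbackSymmetry S.g T.p).hom ≫ pullback.snd T.p S.g := by
    rw [pullbackSymmetry_hom_comp_snd, pullback.lift_fst]
  rw [e, Functor.map_comp, Functor.map_comp]
  infer_instance

/-- An epimorphism with trivial kernel becomes an isomorphism in `Ho`. -/
theorem isIso_γ_of_epi (hM : M.IsHereditary) {S : ShortComplex C} (hS : S.ShortExact)
    (hK : M.W S.X₁) : IsIso (M.γ.map S.g) := by
  let T := M.fibrantSeq S.X₁
  have hT : (M.W ⊓ M.R) T.E := ⟨M.thick.middle _ T.shortExact hK T.hL.2, T.hE⟩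
  have i1 := isIso_γ_trivFib (shortExact_pushout hS T.j) hT
  have : Mono S.f := hS.mono_f
  have i2 := isIso_γ_trivCof hM (shortExact_pushout T.shortExact S.f) T.hL
  dsimp at i1 i2
  -- Dually, the factorization passes through the pushout of `S.f` along the fibrant replacement of
  -- `S.X₁`.
  have e : S.g = pushout.inr T.j S.f ≫ (pushoutSymmetry T.j S.f).hom ≫
      (pushout.desc S.g 0 (by simp) : pushout S.f T.j ⟶ S.X₃) := by
    rw [inr_comp_pushoutSymmetry_hom_assoc, pushout.inl_desc]
  rw [e, Functor.map_comp, Functor.map_comp]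
  infer_instance

theorem isIso_γ_biprod_fst (A : C) {V : C} (hV : M.W V) :
    IsIso (M.γ.map (biprod.fst : A ⊞ V ⟶ A)) := by
  refine ⟨M.γ.map biprod.inl, ?_, ?_⟩
  · rw [← Functor.map_comp, ← M.γ.map_id]
    exact M.γ_map_eq_of_factor hV biprod.snd biprod.inr (by rw [← biprod.total]; abel)
  · rw [← Functor.map_comp, biprod.inl_fst, M.γ.map_id]

theorem isIso_γ_biprod_inr (A : C) {V : C} (hV : M.W V) :
    IsIso (M.γ.map (biprod.inr : A ⟶ V ⊞ A)) := by
  refine ⟨M.γ.map biprod.snd, ?_, ?_⟩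
  · rw [← Functor.map_comp, biprod.inr_snd, M.γ.map_id]
  · rw [← Functor.map_comp, ← M.γ.map_id]
    exact M.γ_map_eq_of_factor hV biprod.fst biprod.inl (by rw [← biprod.total]; abel)

/-- For a morphism of short exact sequences, the kernel map becomes an isomorphism in `Ho` when the
middle object of the source and the pullback along the quotient map are trivial. -/
theorem isIso_γ_τ₁ (hM : M.IsHereditary) {S T : ShortComplex C} (hS : S.ShortExact)
    (hT : T.ShortExact) (φ : S ⟶ T) (h : M.W S.X₂) (h' : M.W (pullback T.g φ.τ₃)) :
    IsIso (M.γ.map φ.τ₁) := by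
  have i1 := isIso_γ_of_mono hM (shortExact_lift_pullback hS hT φ) h'
  have i2 := isIso_γ_biprod_fst T.X₁ h
  dsimp at i1
  -- The kernel map is the embedding of `S.X₁` into `T.X₁ ⊞ S.X₂`, with trivial cokernel, followed
  -- by projection away from the trivial summand.
  rw [← biprod.lift_fst φ.τ₁ S.f, Functor.map_comp]
  infer_instance

/-- Dual to `isIso_γ_τ₁`: the cokernel map is the inclusion of a summand with trivial complement
into `T.X₂ ⊞ S.X₃`, followed by an epimorphism whose kernel is the pushout. -/
theorem isIso_γ_τ₃ (hM : M.IsHereditary) {S T : ShortComplex C} (hS : S.ShortExact)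
    (hT : T.ShortExact) (φ : S ⟶ T) (h : M.W T.X₂) (h' : M.W (pushout S.f φ.τ₁)) :
    IsIso (M.γ.map φ.τ₃) := by
  have i1 := isIso_γ_of_epi hM (shortExact_desc_pushout hS hT φ) h'
  have i2 := isIso_γ_biprod_inr S.X₃ h
  dsimp at i1
  rw [← biprod.inr_desc T.g φ.τ₃, Functor.map_comp]
  infer_instance

/-! ### Comparison of short exact sequences -/

/-- The middle maps differ by a map into `T.X₁`, so the kernel maps differ by a map through the
trivial object `S.X₂`. This makes every later choice of completion harmless. -/
theorem γ_τ₁_eq {S T : ShortComplex C} (hT : T.ShortExact) (φ ψ : S ⟶ T) (hP : M.W S.X₂)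
    (h : φ.τ₃ = ψ.τ₃) : M.γ.map φ.τ₁ = M.γ.map ψ.τ₁ := by
  have := hT.mono_f
  have hz : (ψ.τ₂ - φ.τ₂) ≫ T.g = 0 := by rw [Preadditive.sub_comp, φ.comm₂₃, ψ.comm₂₃, h, sub_self]
  refine M.γ_map_eq_of_factor hP S.f (hT.exact.lift _ hz) ?_
  rw [← cancel_mono T.f, Category.assoc, hT.exact.lift_f, Preadditive.sub_comp,
    Preadditive.comp_sub, φ.comm₁₂, ψ.comm₁₂]

theorem γ_τ₃_eq {S T : ShortComplex C} (hS : S.ShortExact) (φ ψ : S ⟶ T) (hE : M.W T.X₂)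
    (h : φ.τ₁ = ψ.τ₁) : M.γ.map φ.τ₃ = M.γ.map ψ.τ₃ := by
  have := hS.epi_g
  have hz : S.f ≫ (ψ.τ₂ - φ.τ₂) = 0 := by
    rw [Preadditive.comp_sub, ← φ.comm₁₂, ← ψ.comm₁₂, h, sub_self]
  refine M.γ_map_eq_of_factor hE (hS.exact.desc _ hz) T.g ?_
  rw [← cancel_epi S.g, ← Category.assoc, hS.exact.g_desc, Preadditive.comp_sub,
    Preadditive.sub_comp, φ.comm₂₃, ψ.comm₂₃]

theorem exists_hom_of_τ₃ {S T : ShortComplex C} (hT : T.ShortExact)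
    (hP : (M.Q ⊓ M.W) S.X₂) (hK : M.R T.X₁) (f : S.X₃ ⟶ T.X₃) : ∃ φ : S ⟶ T, φ.τ₃ = f := by
  obtain ⟨h, hh⟩ := exists_lift_shortExact hT (M.rightPair.vanish hP hK) (S.g ≫ f)
  have := hT.mono_f
  have hz : (S.f ≫ h) ≫ T.g = 0 := by rw [Category.assoc, hh, ← Category.assoc, S.zero, zero_comp]
  exact ⟨{ τ₁ := hT.exact.lift _ hz, τ₂ := h, τ₃ := f, comm₁₂ := hT.exact.lift_f _ hz
           comm₂₃ := hh }, rfl⟩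

theorem exists_hom_of_τ₁ {S T : ShortComplex C} (hS : S.ShortExact)
    (hL : M.Q S.X₃) (hE : (M.W ⊓ M.R) T.X₂) (f : S.X₁ ⟶ T.X₁) : ∃ φ : S ⟶ T, φ.τ₁ = f := by
  obtain ⟨h, hh⟩ := exists_extension_shortExact hS (M.leftPair.vanish hL hE) (f ≫ T.f)
  have := hS.epi_g
  have hz : S.f ≫ h ≫ T.g = 0 := by rw [← Category.assoc, hh, Category.assoc, T.zero, comp_zero]
  exact ⟨{ τ₁ := f, τ₂ := h, τ₃ := hS.exact.desc _ hz, comm₁₂ := hh.symm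
           comm₂₃ := (hS.exact.g_desc _ hz).symm }, rfl⟩

end AbelianModelStructure
end AbelianModel

namespace AbelianModel
open scoped ZeroObject

/-! ### Loops and suspensions computed from arbitrary short exact sequences -/

section ShortComplexes

variable {C : Type u} [Category.{v} C] [Abelian C]

/-- The short exact sequence of a special precover. -/
abbrev SpecialPrecover.sc {X Y : ObjectProperty C} {A : C} (S : SpecialPrecover X Y A) :
    ShortComplex C := ShortComplex.mk S.i S.p S.zero

/-- The short exact sequence of a special preenvelope. -/
abbrev SpecialPreenvelope.sc {X Y : ObjectProperty C} {A : C} (S : SpecialPreenvelope X Y A) :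
    ShortComplex C := ShortComplex.mk S.j S.q S.zero

/-- Closure under isomorphism follows from 2-out-of-3: `0 ⟶ A ⟶ A ⟶ 0 ⟶ 0` puts the zero object in
`W`, then `0 ⟶ 0 ⟶ A ⟶ B ⟶ 0` gives `B`. -/
theorem IsThick.of_iso {W : ObjectProperty C} (hW : IsThick W) {A B : C} (e : A ≅ B) (hA : W A) :
    W B := by
  have h0 : W (0 : C) := hW.right (ShortComplex.mk (𝟙 A) (0 : A ⟶ (0 : C)) (by simp))
    (ShortComplex.Splitting.shortExact
      { r := 𝟙 _, s := 0, f_r := by simp, s_g := (isZero_zero C).eq_of_src _ _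
        id := by simp }) hA hA
  exact hW.right (ShortComplex.mk (0 : (0 : C) ⟶ A) e.hom (by simp))
    (ShortComplex.Splitting.shortExact
      { r := 0, s := e.inv, f_r := (isZero_zero C).eq_of_src _ _, s_g := by simp
        id := by simp }) h0 hA

end ShortComplexes

namespace AbelianModelStructure

variable {C : Type u} [Category.{v} C] [Abelian C] [HasExt.{w} C] {M : AbelianModelStructure.{w} C}

/-- Frees `Ω` on morphisms from the choices in its definition: any representative and any completion
may be used. -/
theorem loop_map_eq {A B : M.Ho} (φ : A ⟶ B) (ψ : (M.loopSeq A).sc ⟶ (M.loopSeq B).sc)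
    (h : M.toSt.map ψ.τ₃ = φ.hom) : M.loop.map φ = M.γ.map ψ.τ₁ := by
  obtain ⟨f, hf, hk⟩ := (M.exists_loopMap φ).choose_spec
  exact hk.γ_eq M ((M.toSt_eq_iff _ _).1 (hf.trans h.symm)) ⟨ψ.τ₂, ψ.comm₂₃, ψ.comm₁₂⟩

theorem susp_map_eq {A B : M.Ho} (φ : A ⟶ B) (ψ : (M.suspSeq A).sc ⟶ (M.suspSeq B).sc)
    (h : M.toSt.map ψ.τ₁ = φ.hom) : M.susp.map φ = M.γ.map ψ.τ₃ := by
  obtain ⟨f, hf, hk⟩ := (M.exists_suspMap φ).choose_spec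
  exact hk.γ_eq M ((M.toSt_eq_iff _ _).1 (hf.trans h.symm)) ⟨ψ.τ₂, ψ.comm₁₂.symm, ψ.comm₂₃.symm⟩

variable (M) in
/-- A chosen short exact sequence ending in `QX` through which short exact sequences ending in `X`
are compared. -/
def loopCover (X : C) : SpecialPrecover (M.Q ⊓ M.W) M.R (M.cofRep X) :=
  (M.rightPair.enoughProjectives (M.cofRep X)).some

variable (M) in
/-- A chosen short exact sequence starting in `QX` through which short exact sequences starting in
`X` are compared. -/
def suspCover (X : C) : SpecialPreenvelope M.Q (M.W ⊓ M.R) (M.cofRep X) :=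
  (M.leftPair.enoughInjectives (M.cofRep X)).some

/-- The sequences `S` and `loopSeq` end in `X` and `RQX`, so they are joined by a zigzag from a
sequence ending in `QX`, both of whose kernel maps are inverted by `γ`. The quantification over all
`a` and `b` lets naturality be checked with whatever fillers are at hand. -/
theorem exists_loopIso (hM : M.IsHereditary) {S : ShortComplex C} (hS : S.ShortExact)
    (hP : M.W S.X₂) (hK : M.R S.X₁) :
    ∃ e : M.γ.obj S.X₁ ≅ M.loop.obj (M.γ.obj S.X₃),
      ∀ (a : (M.loopCover S.X₃).sc ⟶ S) (b : (M.loopCover S.X₃).sc ⟶ (M.loopSeq S.X₃).sc),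
        a.τ₃ = M.cofRepπ S.X₃ → b.τ₃ = M.bifRepι S.X₃ →
          IsIso (M.γ.map a.τ₁) ∧ M.γ.map a.τ₁ ≫ e.hom = M.γ.map b.τ₁ := by
  let T := M.loopCover S.X₃
  let U := M.loopSeq S.X₃
  have hU := U.shortExact
  have := hU.epi_g
  obtain ⟨a, ha⟩ := exists_hom_of_τ₃ (S := T.sc) hS T.hP hK (M.cofRepπ S.X₃)
  obtain ⟨b, hb⟩ := exists_hom_of_τ₃ (S := T.sc) (T := U.sc) hU T.hP U.hK (M.bifRepι S.X₃)
  have ia : IsIso (M.γ.map a.τ₁) := by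
    refine isIso_γ_τ₁ hM T.shortExact hS a T.hP.2 ?_
    rw [ha]
    -- This pullback is an extension of the trivial `S.X₂` by the trivial kernel of `QX ⟶ X`.
    exact M.thick.of_iso (pullbackSymmetry _ _)
      (M.thick.middle _ (shortExact_pullback (M.cofibrantSeq S.X₃).shortExact S.g)
        (M.cofibrantSeq S.X₃).hK.1 hP)
  have ib : IsIso (M.γ.map b.τ₁) := by
    refine isIso_γ_τ₁ hM T.shortExact hU b T.hP.2 ?_
    rw [hb]
    -- This pullback is the kernel of an epimorphism from the trivial `U.P` onto the trivial
    -- cokernel of `QX ⟶ RQX`.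
    exact M.thick.left _ (shortExact_pullback_mono (M.fibrantSeq (M.cofRep S.X₃)).shortExact U.p)
      U.hP.2 (M.fibrantSeq (M.cofRep S.X₃)).hL.2
  refine ⟨(asIso (M.γ.map a.τ₁)).symm ≪≫ @asIso _ _ _ _ _ ib, fun a' b' ha' hb' => ?_⟩
  have ea := γ_τ₁_eq hS a' a T.hP.2 (ha'.trans ha.symm)
  have eb := γ_τ₁_eq hU b' b T.hP.2 (hb'.trans hb.symm)
  rw [ea, eb]
  exact ⟨ia, (asIso (M.γ.map a.τ₁)).hom_inv_id_assoc (M.γ.map b.τ₁)⟩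

/-- The same zigzag, now over the subobjects `X ⟵ QX ⟶ RQX`. Trivial fibrancy of `S.X₂` is what
allows the comparison map into `S` to be extended. -/
theorem exists_suspIso (hM : M.IsHereditary) {S : ShortComplex C} (hS : S.ShortExact)
    (hE : (M.W ⊓ M.R) S.X₂) :
    ∃ e : M.γ.obj S.X₃ ≅ M.susp.obj (M.γ.obj S.X₁),
      ∀ (a : (M.suspCover S.X₁).sc ⟶ S) (b : (M.suspCover S.X₁).sc ⟶ (M.suspSeq S.X₁).sc),
        a.τ₁ = M.cofRepπ S.X₁ → b.τ₁ = M.bifRepι S.X₁ →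
          IsIso (M.γ.map a.τ₃) ∧ M.γ.map a.τ₃ ≫ e.hom = M.γ.map b.τ₃ := by
  let T := M.suspCover S.X₁
  let U := M.suspSeq S.X₁
  have hU := U.shortExact
  have hT := T.shortExact
  have := hT.mono_f
  obtain ⟨a, ha⟩ := exists_hom_of_τ₁ (S := T.sc) hT T.hL hE (M.cofRepπ S.X₁)
  obtain ⟨b, hb⟩ := exists_hom_of_τ₁ (S := T.sc) (T := U.sc) hT T.hL U.hE (M.bifRepι S.X₁)
  have ia : IsIso (M.γ.map a.τ₃) := by
    refine isIso_γ_τ₃ hM hT hS a hE.1 ?_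
    rw [ha]
    -- The pushout is the quotient of the trivial `T.E` by the trivial kernel of `QX ⟶ X`.
    exact M.thick.right _ (shortExact_pushout_epi (M.cofibrantSeq S.X₁).shortExact T.j)
      (M.cofibrantSeq S.X₁).hK.1 T.hE.1
  have ib : IsIso (M.γ.map b.τ₃) := by
    refine isIso_γ_τ₃ hM hT hU b U.hE.1 ?_
    rw [hb]
    exact M.thick.of_iso (pushoutSymmetry _ _)
      (M.thick.middle _ (shortExact_pushout (M.fibrantSeq (M.cofRep S.X₁)).shortExact T.j)
        T.hE.1 (M.fibrantSeq (M.cofRep S.X₁)).hL.2)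
  refine ⟨(asIso (M.γ.map a.τ₃)).symm ≪≫ @asIso _ _ _ _ _ ib, fun a' b' ha' hb' => ?_⟩
  have ea := γ_τ₃_eq hT a' a hE.1 (ha'.trans ha.symm)
  have eb := γ_τ₃_eq hT b' b U.hE.1 (hb'.trans hb.symm)
  rw [ea, eb]
  exact ⟨ia, (asIso (M.γ.map a.τ₃)).hom_inv_id_assoc (M.γ.map b.τ₃)⟩

/-- The kernel of an epimorphism `P ⟶ X` from a trivial object computes `ΩX` when it is fibrant. -/
def loopIso (hM : M.IsHereditary) {S : ShortComplex C} (hS : S.ShortExact)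
    (hP : M.W S.X₂) (hK : M.R S.X₁) : M.γ.obj S.X₁ ≅ M.loop.obj (M.γ.obj S.X₃) :=
  (exists_loopIso hM hS hP hK).choose

/-- The cokernel of a monomorphism `X ⟶ E` to a trivially fibrant object computes `ΣX`. -/
def suspIso (hM : M.IsHereditary) {S : ShortComplex C} (hS : S.ShortExact)
    (hE : (M.W ⊓ M.R) S.X₂) : M.γ.obj S.X₃ ≅ M.susp.obj (M.γ.obj S.X₁) :=
  (exists_suspIso hM hS hE).choose

theorem comp_eq_of_epi {D : Type*} [Category* D] {X X' Y Y' Z Z' : D} {α : X ⟶ Y} [Epi α]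
    {α' : X' ⟶ Y'} {β : X ⟶ Z} {β' : X' ⟶ Z'} {c : X ⟶ X'} {f : Y ⟶ Y'} {d : Z ⟶ Z'} {e : Y ⟶ Z}
    {e' : Y' ⟶ Z'} (h1 : α ≫ e = β) (h2 : α' ≫ e' = β') (h3 : α ≫ f = c ≫ α')
    (h4 : β ≫ d = c ≫ β') : f ≫ e' = e ≫ d := by
  rw [← cancel_epi α, ← Category.assoc, h3, Category.assoc, h2, ← h4, ← h1, Category.assoc]

/-- The map `Q(φ.τ₃)` is completed to a map `c` of covers. By `γ_τ₁_eq` the squares of kernel maps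
commute in `Ho` as soon as the squares of quotient maps commute, and those are the squares defining
`R(Q(φ.τ₃))`. -/
theorem loopIso_naturality (hM : M.IsHereditary) {S T : ShortComplex C} (hS : S.ShortExact)
    (hT : T.ShortExact) (hP : M.W S.X₂) (hK : M.R S.X₁) (hP' : M.W T.X₂) (hK' : M.R T.X₁)
    (φ : S ⟶ T) :
    M.γ.map φ.τ₁ ≫ (loopIso hM hT hP' hK').hom =
      (loopIso hM hS hP hK).hom ≫ M.loop.map (M.γ.map φ.τ₃) := by
  let S₀ := M.loopCover S.X₃
  let T₀ := M.loopCover T.X₃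
  obtain ⟨u, g, hg, hu⟩ := M.exists_isBifLift φ.τ₃
  obtain ⟨a, ha⟩ := exists_hom_of_τ₃ (S := S₀.sc) hS S₀.hP hK (M.cofRepπ S.X₃)
  obtain ⟨b, hb⟩ := exists_hom_of_τ₃ (S := S₀.sc) (T := (M.loopSeq S.X₃).sc)
    (M.loopSeq S.X₃).shortExact S₀.hP (M.loopSeq S.X₃).hK (M.bifRepι S.X₃)
  obtain ⟨a', ha'⟩ := exists_hom_of_τ₃ (S := T₀.sc) hT T₀.hP hK' (M.cofRepπ T.X₃)
  obtain ⟨b', hb'⟩ := exists_hom_of_τ₃ (S := T₀.sc) (T := (M.loopSeq T.X₃).sc)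
    (M.loopSeq T.X₃).shortExact T₀.hP (M.loopSeq T.X₃).hK (M.bifRepι T.X₃)
  obtain ⟨c, hc⟩ := exists_hom_of_τ₃ (S := S₀.sc) (T := T₀.sc) T₀.shortExact S₀.hP T₀.hK g
  obtain ⟨d, hd⟩ := exists_hom_of_τ₃ (S := (M.loopSeq S.X₃).sc) (T := (M.loopSeq T.X₃).sc)
    (M.loopSeq T.X₃).shortExact (M.loopSeq S.X₃).hP (M.loopSeq T.X₃).hK u
  have e1 := (exists_loopIso hM hS hP hK).choose_spec a b ha hb
  have e2 := (exists_loopIso hM hT hP' hK').choose_spec a' b' ha' hb'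
  have e3 : M.loop.map (M.γ.map φ.τ₃) = M.γ.map d.τ₁ :=
    loop_map_eq _ d (by rw [hd]; exact (M.γ_map_eq ⟨g, hg, hu⟩).symm)
  have e4 : M.γ.map (a.τ₁ ≫ φ.τ₁) = M.γ.map (c.τ₁ ≫ a'.τ₁) :=
    γ_τ₁_eq hT (a ≫ φ) (c ≫ a') S₀.hP.2 (by simp [ha, ha', hc, hg])
  have e5 : M.γ.map (b.τ₁ ≫ d.τ₁) = M.γ.map (c.τ₁ ≫ b'.τ₁) :=
    γ_τ₁_eq (M.loopSeq T.X₃).shortExact (b ≫ d) (c ≫ b') S₀.hP.2 (by simp [hb, hb', hc, hd, hu])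
  rw [Functor.map_comp, Functor.map_comp] at e4 e5
  rw [e3]
  have := e1.1
  exact comp_eq_of_epi e1.2 e2.2 e4 e5

theorem suspIso_naturality (hM : M.IsHereditary) {S T : ShortComplex C} (hS : S.ShortExact)
    (hT : T.ShortExact) (hE : (M.W ⊓ M.R) S.X₂) (hE' : (M.W ⊓ M.R) T.X₂) (φ : S ⟶ T) :
    M.γ.map φ.τ₃ ≫ (suspIso hM hT hE').hom =
      (suspIso hM hS hE).hom ≫ M.susp.map (M.γ.map φ.τ₁) := by
  let S₀ := M.suspCover S.X₁
  let T₀ := M.suspCover T.X₁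
  obtain ⟨u, g, hg, hu⟩ := M.exists_isBifLift φ.τ₁
  obtain ⟨a, ha⟩ := exists_hom_of_τ₁ (S := S₀.sc) S₀.shortExact S₀.hL hE (M.cofRepπ S.X₁)
  obtain ⟨b, hb⟩ := exists_hom_of_τ₁ (S := S₀.sc) (T := (M.suspSeq S.X₁).sc)
    S₀.shortExact S₀.hL (M.suspSeq S.X₁).hE (M.bifRepι S.X₁)
  obtain ⟨a', ha'⟩ := exists_hom_of_τ₁ (S := T₀.sc) T₀.shortExact T₀.hL hE' (M.cofRepπ T.X₁)
  obtain ⟨b', hb'⟩ := exists_hom_of_τ₁ (S := T₀.sc) (T := (M.suspSeq T.X₁).sc)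
    T₀.shortExact T₀.hL (M.suspSeq T.X₁).hE (M.bifRepι T.X₁)
  obtain ⟨c, hc⟩ := exists_hom_of_τ₁ (S := S₀.sc) (T := T₀.sc) S₀.shortExact S₀.hL T₀.hE g
  obtain ⟨d, hd⟩ := exists_hom_of_τ₁ (S := (M.suspSeq S.X₁).sc) (T := (M.suspSeq T.X₁).sc)
    (M.suspSeq S.X₁).shortExact (M.suspSeq S.X₁).hL (M.suspSeq T.X₁).hE u
  have e1 := (exists_suspIso hM hS hE).choose_spec a b ha hb
  have e2 := (exists_suspIso hM hT hE').choose_spec a' b' ha' hb'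
  have e3 : M.susp.map (M.γ.map φ.τ₁) = M.γ.map d.τ₃ :=
    susp_map_eq _ d (by rw [hd]; exact (M.γ_map_eq ⟨g, hg, hu⟩).symm)
  have e4 : M.γ.map (a.τ₃ ≫ φ.τ₃) = M.γ.map (c.τ₃ ≫ a'.τ₃) :=
    γ_τ₃_eq S₀.shortExact (a ≫ φ) (c ≫ a') hE'.1 (by simp [ha, ha', hc, hg])
  have e5 : M.γ.map (b.τ₃ ≫ d.τ₃) = M.γ.map (c.τ₃ ≫ b'.τ₃) :=
    γ_τ₃_eq S₀.shortExact (b ≫ d) (c ≫ b') (M.suspSeq T.X₁).hE.1 (by simp [hb, hb', hc, hd, hu])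
  rw [Functor.map_comp, Functor.map_comp] at e4 e5
  rw [e3]
  have := e1.1
  exact comp_eq_of_epi e1.2 e2.2 e4 e5

theorem comp_inv_eq_inv_comp {D : Type*} [Category* D] {X X' Y Y' : D} {e : X ≅ X'} {e' : Y ≅ Y'}
    {f : X ⟶ Y} {g : X' ⟶ Y'} (h : f ≫ e'.hom = e.hom ≫ g) : g ≫ e'.inv = e.inv ≫ f := by
  rw [Iso.comp_inv_eq, Category.assoc, h, Iso.inv_hom_id_assoc]

/-! ### Loop and suspension are mutually inverse -/

theorem exists_loop_hom {A B : M.Ho} (φ : A ⟶ B) :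
    ∃ ψ : (M.loopSeq A).sc ⟶ (M.loopSeq B).sc, M.toSt.map ψ.τ₃ = φ.hom := by
  obtain ⟨f, hf⟩ := M.exists_rep φ
  obtain ⟨ψ, hψ⟩ := exists_hom_of_τ₃ (S := (M.loopSeq A).sc) (T := (M.loopSeq B).sc)
    (M.loopSeq B).shortExact (M.loopSeq A).hP (M.loopSeq B).hK f
  exact ⟨ψ, by rw [hψ]; exact hf⟩

theorem exists_susp_hom {A B : M.Ho} (φ : A ⟶ B) :
    ∃ ψ : (M.suspSeq A).sc ⟶ (M.suspSeq B).sc, M.toSt.map ψ.τ₁ = φ.hom := by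
  obtain ⟨f, hf⟩ := M.exists_rep φ
  obtain ⟨ψ, hψ⟩ := exists_hom_of_τ₁ (S := (M.suspSeq A).sc) (T := (M.suspSeq B).sc)
    (M.suspSeq A).shortExact (M.suspSeq A).hL (M.suspSeq B).hE f
  exact ⟨ψ, by rw [hψ]; exact hf⟩

instance : M.loop.Additive where
  map_add {A B φ φ'} := by
    obtain ⟨ψ, h⟩ := exists_loop_hom φ
    obtain ⟨ψ', h'⟩ := exists_loop_hom φ'
    rw [loop_map_eq φ ψ h, loop_map_eq φ' ψ' h', loop_map_eq (φ + φ') (ψ + ψ')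
      (congr_arg₂ (· + ·) h h')]
    exact M.γ.map_add

instance : M.susp.Additive where
  map_add {A B φ φ'} := by
    obtain ⟨ψ, h⟩ := exists_susp_hom φ
    obtain ⟨ψ', h'⟩ := exists_susp_hom φ'
    rw [susp_map_eq φ ψ h, susp_map_eq φ' ψ' h', susp_map_eq (φ + φ') (ψ + ψ')
      (congr_arg₂ (· + ·) h h')]
    exact M.γ.map_add

/-- An extension of fibrant objects is fibrant. This lets the loop sequence of `A` serve also as a
suspension sequence for its kernel. -/
theorem core_loopSeq (A : C) : (M.W ⊓ M.R) (M.loopSeq A).P :=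
  ⟨(M.loopSeq A).hP.2, M.rightPair.right_ext (M.loopSeq A).shortExact (M.loopSeq A).hK
    (M.R_bifRep A)⟩

/-- `ΣΩ ≅ 1`. -/
def loopSuspIso (hM : M.IsHereditary) : 𝟭 M.Ho ≅ M.loop ⋙ M.susp :=
  NatIso.ofComponents (fun A => (M.bifIso A).symm ≪≫
      suspIso hM (M.loopSeq A).shortExact (core_loopSeq (M := M) A)) fun {A B} φ => by
    obtain ⟨ψ, h⟩ := exists_loop_hom φ
    have h1 := suspIso_naturality hM (M.loopSeq A).shortExact (M.loopSeq B).shortExact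
      (core_loopSeq (M := M) A) (core_loopSeq (M := M) B) ψ
    have h2 := M.bifIso_naturality φ ψ.τ₃ h
    have h3 : φ ≫ (M.bifIso B).inv = (M.bifIso A).inv ≫ M.γ.map ψ.τ₃ :=
      comp_inv_eq_inv_comp h2
    have h4 : M.susp.map (M.loop.map φ) = M.susp.map (M.γ.map ψ.τ₁) := by
      rw [loop_map_eq φ ψ h]; rfl
    refine (Category.assoc _ _ _).symm.trans ((congr_arg (· ≫ _) h3).trans ?_)
    refine (Category.assoc _ _ _).trans ((congr_arg (_ ≫ ·) h1).trans ?_)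
    exact (Category.assoc _ _ _).symm.trans (congr_arg (_ ≫ ·) h4.symm)

/-- `ΩΣ ≅ 1`. -/
def suspLoopIso (hM : M.IsHereditary) : 𝟭 M.Ho ≅ M.susp ⋙ M.loop :=
  NatIso.ofComponents (fun A => (M.bifIso A).symm ≪≫
      -- The suspension sequence computes a loop object because its middle term is trivial and its
      -- kernel `RQA` is fibrant.
      loopIso hM (M.suspSeq A).shortExact (M.suspSeq A).hE.1 (M.R_bifRep A)) fun {A B} φ => by
    obtain ⟨ψ, h⟩ := exists_susp_hom φ
    have h1 := loopIso_naturality hM (M.suspSeq A).shortExact (M.suspSeq B).shortExact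
      (M.suspSeq A).hE.1 (M.R_bifRep A) (M.suspSeq B).hE.1 (M.R_bifRep B) ψ
    have h2 := M.bifIso_naturality φ ψ.τ₁ h
    have h3 : φ ≫ (M.bifIso B).inv = (M.bifIso A).inv ≫ M.γ.map ψ.τ₁ :=
      comp_inv_eq_inv_comp h2
    have h4 : M.loop.map (M.susp.map φ) = M.loop.map (M.γ.map ψ.τ₃) := by
      rw [susp_map_eq φ ψ h]; rfl
    refine (Category.assoc _ _ _).symm.trans ((congr_arg (· ≫ _) h3).trans ?_)
    refine (Category.assoc _ _ _).trans ((congr_arg (_ ≫ ·) h1).trans ?_)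
    exact (Category.assoc _ _ _).symm.trans (congr_arg (_ ≫ ·) h4.symm)

/-- `Ω` as an equivalence with inverse `Σ`. -/
def loopEquivalence (hM : M.IsHereditary) : M.Ho ≌ M.Ho :=
  CategoryTheory.Equivalence.mk M.loop M.susp (loopSuspIso hM) (suspLoopIso hM).symm

/-- `Ω` is left adjoint to `Σ`. -/
def loopSuspAdjunction (hM : M.IsHereditary) : M.loop ⊣ M.susp := (loopEquivalence hM).toAdjunction

/-- `Σ` is left adjoint to `Ω`. -/
def suspLoopAdjunction (hM : M.IsHereditary) : M.susp ⊣ M.loop :=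
  (loopEquivalence hM).symm.toAdjunction

/-! ### Iterated adjunctions and the middle isomorphism -/

section Iterates

variable {D : Type*} [Category* D]

/-- `F Fⁿ = Fⁿ F`. -/
def iterCommIso (F : D ⥤ D) : ∀ n, F ⋙ iter F n ≅ iter F n ⋙ F
  | 0 => F.rightUnitor ≪≫ F.leftUnitor.symm
  | n + 1 => (Functor.associator _ _ _).symm ≪≫ Functor.isoWhiskerRight (iterCommIso F n) F

/-- Iterates of adjoint functors are adjoint. -/
def iterAdjunction {F G : D ⥤ D} (adj : F ⊣ G) : ∀ n, iter F n ⊣ iter G n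
  | 0 => Adjunction.id
  -- The composite adjunction has right adjoint `G ⋙ iter G n`, the opposite order to that in
  -- `iter`.
  | n + 1 => ((iterAdjunction adj n).comp adj).ofNatIsoRight (iterCommIso G n)

instance iter_additive [Preadditive D] (F : D ⥤ D) [F.Additive] : ∀ n, (iter F n).Additive
  | 0 => inferInstanceAs (𝟭 D).Additive
  | n + 1 => have := iter_additive F n; inferInstanceAs (iter F n ⋙ F).Additive

end Iterates

instance (n : ℤ) : (M.loopPow n).Additive := by
  cases n <;> exact iter_additive _ _

/-- `Ωⁿ` is left adjoint to `Σⁿ`. -/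
def loopPowAdjunction (hM : M.IsHereditary) : ∀ n : ℤ, M.loopPow n ⊣ M.suspPow n
  | Int.ofNat n => iterAdjunction (loopSuspAdjunction hM) n
  -- For negative exponents the left adjoint is an iterate of `Σ`, so the adjunction in the other
  -- direction is needed.
  | Int.negSucc n => iterAdjunction (suspLoopAdjunction hM) (n + 1)

/-- `Ho(Ωⁿ A, B) ≅ Ho(A, Σⁿ B)`. -/
def hoHomLoopPowIso (hM : M.IsHereditary) (n : ℤ) :
    M.hoHom (M.loopPow n) (𝟭 _) ≅ M.hoHom (𝟭 _) (M.suspPow n) :=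
  NatIso.ofComponents (fun A => NatIso.ofComponents (fun B =>
      ((loopPowAdjunction hM n).homAddEquiv (M.γ.obj A.unop.obj)
        (M.γ.obj B.obj)).toAddCommGrpIso)
    fun {B B'} g => by
      ext x
      exact (loopPowAdjunction hM n).homEquiv_naturality_right x (M.γ.map g.hom))
    fun {A A'} f => by
      ext B x
      exact (loopPowAdjunction hM n).homEquiv_naturality_left (M.γ.map f.unop.hom) x

end AbelianModelStructure
end AbelianModel

namespace AbelianModel
namespace AbelianModelStructure

variable {C : Type u} [Category.{v} C] [Abelian C] [HasExt.{w} C] {M : AbelianModelStructure.{w} C}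

/-! ### The syzygies of a resolution -/

namespace Resolution

variable {A : C} (W : M.Resolution A)

theorem mono_fromOpcycles (i j : ℤ) (hij : j + 1 = i) : Mono (W.cx.fromOpcycles i j) := by
  obtain rfl : (ComplexShape.down ℤ).next i = j := (ComplexShape.down ℤ).next_eq' hij
  exact (W.exact i).mono_fromOpcycles

/-- The short exact sequence `0 ⟶ Z_i ⟶ X_j ⟶ Z_j ⟶ 0` for `i = j + 1`, where `Z` denotes the
cokernels of the differentials. -/
abbrev syzygySequence (i j : ℤ) : ShortComplex C :=
  ShortComplex.mk (W.cx.fromOpcycles i j) (W.cx.pOpcycles j) (by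
    rw [← cancel_epi (W.cx.pOpcycles i)]; simp)

theorem syzygySequence_shortExact (i j : ℤ) (hij : j + 1 = i) :
    (W.syzygySequence i j).ShortExact := by
  refine shortExact_of_desc (W.mono_fromOpcycles i j hij) (by dsimp; infer_instance)
    fun {T} t ht => ?_
  dsimp at ht
  exact ⟨W.cx.descOpcycles t i ((ComplexShape.down ℤ).prev_eq' hij) (by
    rw [← W.cx.p_fromOpcycles, Category.assoc, ht, comp_zero]), W.cx.p_descOpcycles _ _ _ _⟩

/-- The map `Z_0 ⟶ A` induced by the augmentation. -/
def opcyclesε : W.cx.opcycles 0 ⟶ A :=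
  W.cx.descOpcycles W.ε 1 ((ComplexShape.down ℤ).prev_eq' rfl) W.d_ε

theorem p_opcyclesε : W.cx.pOpcycles 0 ≫ W.opcyclesε = W.ε := W.cx.p_descOpcycles _ _ _ _

theorem opcyclesε_η : W.opcyclesε ≫ W.η = W.cx.fromOpcycles 0 (-1) := by
  rw [← cancel_epi (W.cx.pOpcycles 0), ← Category.assoc, p_opcyclesε, W.ε_η, W.cx.p_fromOpcycles]

/-- It is epi because `ε` factors through it, and mono because followed by `η` it is the embedding
of `Z_0` in `X_{-1}`. -/
instance : IsIso W.opcyclesε := by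
  have := W.epi_ε
  have : Epi W.opcyclesε := epi_of_epi_fac W.p_opcyclesε
  have := W.mono_fromOpcycles 0 (-1) rfl
  have : Mono W.opcyclesε := mono_of_mono_fac W.opcyclesε_η
  exact isIso_of_mono_of_epi _

/-- `Z_0 ≅ A`. -/
def opcyclesZeroIso : ∀ n : ℤ, n = 0 → (W.cx.opcycles n ≅ A)
  | _, rfl => asIso W.opcyclesε

/-- `Z_i` is the kernel of `X_j ⟶ Z_j`, hence of its composite with any monomorphism. The general
`m` covers the augmentation and the differentials at once. -/
theorem R_opcycles_of_kernel {i j : ℤ} (hij : j + 1 = i) {X : C} {x : W.cx.X j ⟶ X}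
    (m : W.cx.opcycles j ⟶ X) [Mono m] (h : W.cx.pOpcycles j ≫ m = x) (hx : M.R (kernel x)) :
    M.R (W.cx.opcycles i) := by
  have hS := W.syzygySequence_shortExact i j hij
  have := hS.mono_f
  subst h
  exact M.rightPair.right_iso ((kernelCompMono _ m).trans
    (IsLimit.conePointUniqueUpToIso (kernelIsKernel (W.cx.pOpcycles j)) hS.fIsKernel)) hx

theorem Q_opcycles_of_cokernel {i j : ℤ} (hij : j + 1 = i) {X : C} {x : X ⟶ W.cx.X j}
    (e : X ⟶ W.cx.opcycles i) [Epi e] (h : e ≫ W.cx.fromOpcycles i j = x)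
    (hx : M.Q (cokernel x)) : M.Q (W.cx.opcycles j) := by
  have hS := W.syzygySequence_shortExact i j hij
  have := hS.epi_g
  subst h
  exact M.leftPair.left_iso ((cokernelEpiComp e _).trans
    (IsColimit.coconePointUniqueUpToIso (cokernelIsCokernel (W.cx.fromOpcycles i j))
      hS.gIsCokernel)) hx

theorem R_opcycles_of_pos (n : ℤ) (hn : 1 ≤ n) : M.R (W.cx.opcycles n) := by
  obtain rfl | hn := hn.eq_or_lt
  · exact W.R_opcycles_of_kernel (j := 0) rfl W.opcyclesε W.p_opcyclesε W.kernel_ε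
  · have := W.mono_fromOpcycles (n - 1) (n - 2) (by lia)
    exact W.R_opcycles_of_kernel (j := n - 1) (by lia) (W.cx.fromOpcycles (n - 1) (n - 2))
      (W.cx.p_fromOpcycles _ _) (W.kernel_d _ _ (by lia) (by lia))

theorem Q_opcycles_of_neg (n : ℤ) (hn : n ≤ -1) : M.Q (W.cx.opcycles n) := by
  obtain rfl | hn := hn.eq_or_lt
  · exact W.Q_opcycles_of_cokernel (i := 0) rfl (inv W.opcyclesε)
      ((IsIso.inv_comp_eq _).2 W.opcyclesε_η.symm) W.cokernel_η
  · exact W.Q_opcycles_of_cokernel (i := n + 1) rfl (W.cx.pOpcycles (n + 1))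
      (W.cx.p_fromOpcycles _ _) (W.cokernel_d _ _ rfl (by lia))

theorem W_X (n : ℤ) : M.W (W.cx.X n) := by
  rcases le_or_gt 0 n with h | h
  · exact (W.trivCof n h).2
  · exact (W.trivFib n (by lia)).1

/-- Negative syzygies are cofibrant by the definition of a resolution. From `Z_0 ≅ A` one climbs
upwards by heredity, since `Z_{n+1}` is the kernel of an epimorphism between cofibrant objects. -/
theorem Q_opcycles (hM : M.IsHereditary) (hA : M.Q A) (n : ℤ) : M.Q (W.cx.opcycles n) := by
  rcases n with n | n
  · induction n with
    | zero => exact M.leftPair.left_iso (W.opcyclesZeroIso 0 rfl).symm hA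
    | succ n ih =>
      exact hM.Q_kernel (W.syzygySequence_shortExact (n + 1 : ℕ) n rfl)
        (W.trivCof n (by lia)).1 ih
  · exact W.Q_opcycles_of_neg _ (by lia)

/-- Here the positive syzygies are fibrant by definition, and heredity descends from `Z_0 ≅ A`
through cokernels. -/
theorem R_opcycles (hM : M.IsHereditary) (hA : M.R A) (n : ℤ) : M.R (W.cx.opcycles n) := by
  rcases le_or_gt 1 n with h | h
  · exact W.R_opcycles_of_pos n h
  · obtain ⟨m, rfl⟩ : ∃ m : ℕ, n = -m := ⟨(-n).toNat, by lia⟩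
    clear h
    induction m with
    | zero => exact M.rightPair.right_iso (W.opcyclesZeroIso _ (by simp)).symm hA
    | succ m ih =>
      exact hM.R_cokernel
        (W.syzygySequence_shortExact (-(m : ℤ)) (-((m + 1 : ℕ) : ℤ)) (by push_cast; ring)) ih
        (W.trivFib _ (by lia)).2

variable (hM : M.IsHereditary)

/-- The positive syzygies compute the iterated loop objects. -/
def opcyclesLoopIso : ∀ (m : ℕ) (n : ℤ), n = m →
    (M.γ.obj (W.cx.opcycles n) ≅ (iter M.loop m).obj (M.γ.obj A))
  | 0, n, hn => M.γ.mapIso (W.opcyclesZeroIso n hn)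
  | m + 1, n, hn => loopIso hM (W.syzygySequence_shortExact n (n - 1) (by lia)) (W.W_X _)
      (W.R_opcycles_of_pos n (by lia)) ≪≫ M.loop.mapIso (opcyclesLoopIso m (n - 1) (by lia))

/-- The negative syzygies compute the iterated suspensions. -/
def opcyclesSuspIso : ∀ (m : ℕ) (n : ℤ), n = -m →
    (M.γ.obj (W.cx.opcycles n) ≅ (iter M.susp m).obj (M.γ.obj A))
  | 0, n, hn => M.γ.mapIso (W.opcyclesZeroIso n (by simpa using hn))
  | m + 1, n, hn => suspIso hM (W.syzygySequence_shortExact (n + 1) n rfl) (W.trivFib n (by lia))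
      ≪≫ M.susp.mapIso (opcyclesSuspIso m (n + 1) (by lia))

/-- The `n`-th syzygy computes `Ωⁿ`. -/
def opcyclesLoopPowIso : ∀ n : ℤ, M.γ.obj (W.cx.opcycles n) ≅ (M.loopPow n).obj (M.γ.obj A)
  | Int.ofNat m => W.opcyclesLoopIso hM m _ rfl
  | Int.negSucc m => W.opcyclesSuspIso hM (m + 1) _ rfl

/-- The `-n`-th syzygy computes `Σⁿ`. -/
def opcyclesSuspPowIso : ∀ n k : ℤ, k = -n →
    (M.γ.obj (W.cx.opcycles k) ≅ (M.suspPow n).obj (M.γ.obj A))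
  | Int.ofNat m, _, h => W.opcyclesSuspIso hM m _ h
  | Int.negSucc m, _, h => W.opcyclesLoopIso hM (m + 1) _ (by rw [h]; rfl)

end Resolution

/-! ### Naturality of the syzygy isomorphisms -/

section Naturality

open Resolution

variable {A B : C} {WA : M.Resolution A} {WB : M.Resolution B} {f : A ⟶ B}
  {φ : WA.cx ⟶ WB.cx}

/-- The morphism of syzygy sequences induced by a chain map. -/
abbrev syzygyMap (φ : WA.cx ⟶ WB.cx) (i j : ℤ) : WA.syzygySequence i j ⟶ WB.syzygySequence i j where
  τ₁ := HomologicalComplex.opcyclesMap φ i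
  τ₂ := φ.f j
  τ₃ := HomologicalComplex.opcyclesMap φ j
  comm₁₂ := by rw [← cancel_epi (WA.cx.pOpcycles i)]; simp
  comm₂₃ := by simp

theorem opcyclesZeroIso_naturality (h : Extends WA WB f φ) (n : ℤ) (hn : n = 0) :
    HomologicalComplex.opcyclesMap φ n ≫ (WB.opcyclesZeroIso n hn).hom =
      (WA.opcyclesZeroIso n hn).hom ≫ f := by
  subst hn
  rw [← cancel_epi (WA.cx.pOpcycles 0)]
  change _ ≫ _ ≫ WB.opcyclesε = _ ≫ WA.opcyclesε ≫ f
  rw [HomologicalComplex.p_opcyclesMap_assoc, p_opcyclesε, h.ε, ← Category.assoc, p_opcyclesε]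

theorem comp_trans_naturality {D : Type*} [Category* D] {F : D ⥤ D} {X X' Y Y' Z Z' : D}
    {e : X ≅ F.obj Y} {e' : X' ≅ F.obj Y'} {g : Y ≅ Z} {g' : Y' ≅ Z'} {a : X ⟶ X'} {b : Y ⟶ Y'}
    {c : Z ⟶ Z'} (h1 : a ≫ e'.hom = e.hom ≫ F.map b) (h2 : b ≫ g'.hom = g.hom ≫ c) :
    a ≫ (e' ≪≫ F.mapIso g').hom = (e ≪≫ F.mapIso g).hom ≫ F.map c := by
  dsimp
  rw [← Category.assoc, h1, Category.assoc, ← F.map_comp, h2, F.map_comp, Category.assoc]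

variable (hM : M.IsHereditary)

theorem opcyclesLoopIso_naturality (h : Extends WA WB f φ) (m : ℕ) (n : ℤ) (hn : n = m) :
    M.γ.map (HomologicalComplex.opcyclesMap φ n) ≫ (WB.opcyclesLoopIso hM m n hn).hom =
      (WA.opcyclesLoopIso hM m n hn).hom ≫ (iter M.loop m).map (M.γ.map f) := by
  induction m generalizing n with
  | zero =>
    exact (M.γ.map_comp _ _).symm.trans ((congr_arg M.γ.map
      (opcyclesZeroIso_naturality h n hn)).trans (M.γ.map_comp _ _))
  | succ m ih =>
    exact comp_trans_naturality (loopIso_naturality hM _ _ _ _ _ _ (syzygyMap φ n (n - 1)))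
      (ih (n - 1) (by lia))

theorem opcyclesSuspIso_naturality (h : Extends WA WB f φ) (m : ℕ) (n : ℤ) (hn : n = -m) :
    M.γ.map (HomologicalComplex.opcyclesMap φ n) ≫ (WB.opcyclesSuspIso hM m n hn).hom =
      (WA.opcyclesSuspIso hM m n hn).hom ≫ (iter M.susp m).map (M.γ.map f) := by
  induction m generalizing n with
  | zero =>
    exact (M.γ.map_comp _ _).symm.trans ((congr_arg M.γ.map
      (opcyclesZeroIso_naturality h n (by simpa using hn))).trans (M.γ.map_comp _ _))
  | succ m ih =>
    exact comp_trans_naturality (suspIso_naturality hM _ _ _ _ (syzygyMap φ (n + 1) n))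
      (ih (n + 1) (by lia))

theorem opcyclesLoopPowIso_naturality (h : Extends WA WB f φ) (n : ℤ) :
    M.γ.map (HomologicalComplex.opcyclesMap φ n) ≫ (WB.opcyclesLoopPowIso hM n).hom =
      (WA.opcyclesLoopPowIso hM n).hom ≫ (M.loopPow n).map (M.γ.map f) := by
  cases n with
  | ofNat m => exact opcyclesLoopIso_naturality hM h m _ rfl
  | negSucc m => exact opcyclesSuspIso_naturality hM h (m + 1) _ rfl

theorem opcyclesSuspPowIso_naturality (h : Extends WA WB f φ) (n k : ℤ) (hk : k = -n) :
    M.γ.map (HomologicalComplex.opcyclesMap φ k) ≫ (WB.opcyclesSuspPowIso hM n k hk).hom =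
      (WA.opcyclesSuspPowIso hM n k hk).hom ≫ (M.suspPow n).map (M.γ.map f) := by
  cases n with
  | ofNat m => exact opcyclesSuspIso_naturality hM h m _ hk
  | negSucc m => exact opcyclesLoopIso_naturality hM h (m + 1) _ (by rw [hk]; rfl)

end Naturality

/-! ### Maps out of and into syzygies -/

/-- Translates vanishing in `Ho` into being a coboundary. A map through `V` in the core extends
along `Z_i ⟶ X_j` because `Z_j` is cofibrant and `V` trivially fibrant; conversely `X_j` is trivial.
-/
theorem Resolution.γ_map_eq_zero_iff_source {A B : C} (W : M.Resolution A) (hM : M.IsHereditary)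
    (hA : M.Q A) (hB : M.R B) (i j : ℤ) (hij : j + 1 = i) (f : W.cx.opcycles i ⟶ B) :
    M.γ.map f = 0 ↔ ∃ x : W.cx.X j ⟶ B, W.cx.fromOpcycles i j ≫ x = f := by
  constructor
  · intro hf
    obtain ⟨V, hV, a, b, rfl⟩ := M.exists_factor_of_γ_map_eq_zero (W.Q_opcycles hM hA i) hB hf
    obtain ⟨l, hl⟩ := exists_extension_shortExact (W.syzygySequence_shortExact i j hij)
      (M.leftPair.vanish (W.Q_opcycles hM hA j) (M.core_iff.1 hV).2) a
    exact ⟨l ≫ b, by rw [← Category.assoc]; exact congr_arg (· ≫ b) hl⟩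
  · rintro ⟨x, rfl⟩
    exact M.γ_map_eq_zero_of_factor (W.W_X j) _ _

/-- The dual: a map from `V` in the core lifts along `X_i ⟶ Z_i` because `V` is trivially cofibrant
and `Z_{i+1}` is fibrant. -/
theorem Resolution.γ_map_eq_zero_iff_target {A B : C} (W : M.Resolution B) (hM : M.IsHereditary)
    (hA : M.Q A) (hB : M.R B) (i : ℤ) (f : A ⟶ W.cx.opcycles i) :
    M.γ.map f = 0 ↔ ∃ x : A ⟶ W.cx.X i, x ≫ W.cx.pOpcycles i = f := by
  constructor
  · intro hf
    obtain ⟨V, hV, a, b, rfl⟩ := M.exists_factor_of_γ_map_eq_zero hA (W.R_opcycles hM hB i) hf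
    have hV := M.core_iff.1 hV
    obtain ⟨l, hl⟩ := exists_lift_shortExact (W.syzygySequence_shortExact (i + 1) i rfl)
      (M.rightPair.vanish ⟨hV.1, hV.2.1⟩ (W.R_opcycles hM hB (i + 1))) b
    exact ⟨a ≫ l, by rw [Category.assoc]; exact congr_arg (a ≫ ·) hl⟩
  · rintro ⟨x, rfl⟩
    exact M.γ_map_eq_zero_of_factor (W.W_X i) _ _

end AbelianModelStructure
end AbelianModel

namespace AbelianModel

/-! ### Homology of complexes of abelian groups via cycles modulo boundaries -/

section Homology

/-- Left homology data of a complex of abelian groups from a presentation of its cycles `K` and a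
surjection from `K` whose kernel consists of the boundaries. -/
def leftHomologyDataOfAddMonoidHom (S : ShortComplex AddCommGrpCat.{v}) {K H : AddCommGrpCat.{v}}
    (i : K ⟶ S.X₂) (π : K ⟶ H) (hi : Function.Injective i.hom)
    (hK : ∀ x, S.g.hom x = 0 ↔ ∃ k, i.hom k = x) (hπ : Function.Surjective π.hom)
    (hH : ∀ k, π.hom k = 0 ↔ ∃ x, S.f.hom x = i.hom k) : S.LeftHomologyData :=
  have wi : i ≫ S.g = 0 := by
    ext k
    exact (hK _).2 ⟨k, rfl⟩
  have : Mono (ShortComplex.mk i S.g wi).f := (AddCommGrpCat.mono_iff_injective i).2 hi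
  have hil : IsLimit (KernelFork.ofι i wi) :=
    ((ShortComplex.mk i S.g wi).ab_exact_iff.2 fun x hx => (hK x).1 hx).fIsKernel
  have : Epi π := (AddCommGrpCat.epi_iff_surjective π).2 hπ
  let f' := hil.lift (KernelFork.ofι S.f S.zero)
  have hf' : ∀ x, i.hom (f'.hom x) = S.f.hom x := fun x =>
    ConcreteCategory.congr_hom
      (hil.fac (KernelFork.ofι S.f S.zero) WalkingParallelPair.zero) x
  have wπ : f' ≫ π = 0 := by
    ext x
    exact (hH _).2 ⟨x, (hf' x).symm⟩
  have : Epi (ShortComplex.mk f' π wπ).g := this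
  { K := K
    H := H
    i := i
    π := π
    wi := wi
    hi := hil
    wπ := wπ
    hπ := ((ShortComplex.mk f' π wπ).ab_exact_iff.2 fun k hk => by
      obtain ⟨x, hx⟩ := (hH k).1 hk
      exact ⟨x, hi ((hf' x).trans hx)⟩).gIsCokernel }

/-- Compatibility with the boundary maps into `K` is automatic because `hT.i` is a monomorphism, so
only the squares on cycles and on homology remain. -/
theorem homologyMap_comm_of_leftHomologyData {S T : ShortComplex AddCommGrpCat.{v}}
    (φ : S ⟶ T) (hS : S.LeftHomologyData) (hT : T.LeftHomologyData) (φK : hS.K ⟶ hT.K)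
    (φH : hS.H ⟶ hT.H) (hi : φK ≫ hT.i = hS.i ≫ φ.τ₂) (hπ : hS.π ≫ φH = φK ≫ hT.π) :
    ShortComplex.homologyMap φ ≫ hT.homologyIso.hom = hS.homologyIso.hom ≫ φH :=
  ShortComplex.LeftHomologyMapData.homologyMap_comm (φ := φ) (h₁ := hS) (h₂ := hT)
    { φK := φK, φH := φH, commi := hi, commπ := hπ
      commf' := by
        rw [← cancel_mono hT.i, Category.assoc, hi, ← Category.assoc, hS.f'_i, Category.assoc,
          hT.f'_i, φ.comm₁₂] }

end Homology

/-! ### Both Ext functors as morphism groups of the homotopy category -/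

namespace AbelianModelStructure

variable {C : Type u} [Category.{v} C] [Abelian C] [HasExt.{w} C] {M : AbelianModelStructure.{w} C}

/-- The homology of `Hom(W_A, B)` is `Ho(Ωⁿ A, B)`. -/
def lExtData (hM : M.IsHereditary) {A B : C} (W : M.Resolution A) (hA : M.Q A) (hB : M.R B)
    (n : ℤ) : ((homInto W.cx B).sc n).LeftHomologyData :=
  leftHomologyDataOfAddMonoidHom _
    (K := AddCommGrpCat.of (W.cx.opcycles n ⟶ B))
    (H := AddCommGrpCat.of ((M.loopPow n).obj (M.γ.obj A) ⟶ M.γ.obj B))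
    (AddCommGrpCat.ofHom (AddMonoidHom.mk' (fun f => W.cx.pOpcycles n ≫ f)
      fun _ _ => Preadditive.comp_add _ _ _ _ _ _))
    (AddCommGrpCat.ofHom (AddMonoidHom.mk'
      (fun f => (W.opcyclesLoopPowIso hM n).inv ≫ M.γ.map f) fun _ _ => by
        rw [M.γ.map_add, Preadditive.comp_add]))
    (fun f g h => (cancel_epi (W.cx.pOpcycles n)).1 h)
    (fun x => by
      -- The Hom complex is indexed upwards and the resolution downwards, so its next degree is the
      -- previous one of `W`.
      have hp : (ComplexShape.down ℤ).prev n = (ComplexShape.up ℤ).next n := by simp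
      constructor
      · intro hx
        exact ⟨W.cx.descOpcycles x _ hp hx, W.cx.p_descOpcycles _ _ _ _⟩
      · rintro ⟨k, rfl⟩
        change W.cx.d _ n ≫ W.cx.pOpcycles n ≫ k = 0
        simp)
    (fun φ => by
      obtain ⟨f, hf⟩ := M.γ_map_surjective (W.Q_opcycles hM hA n) hB
        ((W.opcyclesLoopPowIso hM n).hom ≫ φ)
      refine ⟨f, ?_⟩
      change _ ≫ M.γ.map f = φ
      rw [hf, Iso.inv_hom_id_assoc])
    (fun f => by
      change (W.opcyclesLoopPowIso hM n).inv ≫ M.γ.map f = 0 ↔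
        ∃ x : W.cx.X _ ⟶ B, W.cx.d n _ ≫ x = W.cx.pOpcycles n ≫ f
      have h1 : (W.opcyclesLoopPowIso hM n).inv ≫ M.γ.map f = 0 ↔ M.γ.map f = 0 := by
        rw [← cancel_epi (W.opcyclesLoopPowIso hM n).inv, comp_zero]
      have h2 := W.γ_map_eq_zero_iff_source hM hA hB n ((ComplexShape.up ℤ).prev n)
        (by simp) f
      rw [h1, h2]
      -- Cancelling the epimorphism `X_n ⟶ Z_n` turns extension along the differential into
      -- extension along `Z_n ⟶ X_{n-1}`.
      simp only [← W.cx.p_fromOpcycles, Category.assoc, cancel_epi])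

/-- The homology of `Hom(A, W^B)` is `Ho(A, Σⁿ B)`. -/
def rExtData (hM : M.IsHereditary) {A B : C} (W : M.Resolution B) (hA : M.Q A) (hB : M.R B)
    (n : ℤ) : ((homFrom A (toCochain.obj W.cx)).sc n).LeftHomologyData :=
  -- As `W^n = X_{-n-1}`, the degree `n` cycles are the maps into `Z_{-n}`. That index is kept in
  -- the form `-(prev n) - 1`, in which the incoming differential of the Hom complex is written.
  have hp : -n - 1 + 1 = -(ComplexShape.up ℤ).prev n - 1 := by simp
  have hk : -(ComplexShape.up ℤ).prev n - 1 = -n := by rw [← hp]; ring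
  leftHomologyDataOfAddMonoidHom _
    (K := AddCommGrpCat.of (A ⟶ W.cx.opcycles (-(ComplexShape.up ℤ).prev n - 1)))
    (H := AddCommGrpCat.of (M.γ.obj A ⟶ (M.suspPow n).obj (M.γ.obj B)))
    (AddCommGrpCat.ofHom (AddMonoidHom.mk'
      (fun f => f ≫ W.cx.fromOpcycles (-(ComplexShape.up ℤ).prev n - 1) (-n - 1))
      fun _ _ => Preadditive.add_comp _ _ _ _ _ _))
    (AddCommGrpCat.ofHom (AddMonoidHom.mk'
      (fun f => M.γ.map f ≫ (W.opcyclesSuspPowIso hM n _ hk).hom) fun _ _ => by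
        rw [M.γ.map_add, Preadditive.add_comp]))
    (fun f g h => by
      have := W.mono_fromOpcycles _ _ hp
      exact (cancel_mono (W.cx.fromOpcycles _ (-n - 1))).1 h)
    (fun x => by
      have hn : -(ComplexShape.up ℤ).next n - 1 + 1 = -n - 1 := by
        rw [CochainComplex.next]; ring
      have := W.mono_fromOpcycles _ _ hp
      constructor
      · intro hx
        have hS := W.exact_triple _ _ _ hp hn
        have hx : x ≫ W.cx.d (-n - 1) (-(ComplexShape.up ℤ).next n - 1) = 0 := hx
        -- Replacing `X_{-n}` by its image `Z_{-n}` in `X_{-n-1}` preserves exactness, so a map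
        -- killed by the next differential lifts uniquely to `Z_{-n}`.
        have hE : (ShortComplex.mk (W.cx.fromOpcycles _ (-n - 1))
            (W.cx.d (-n - 1) (-(ComplexShape.up ℤ).next n - 1))
            (W.cx.fromOpcycles_d (-(ComplexShape.up ℤ).prev n - 1) _ _)).Exact := by
          let φ : ShortComplex.mk (W.cx.d (-(ComplexShape.up ℤ).prev n - 1) (-n - 1))
              (W.cx.d (-n - 1) (-(ComplexShape.up ℤ).next n - 1)) (by simp) ⟶
              ShortComplex.mk (W.cx.fromOpcycles _ (-n - 1))
                (W.cx.d (-n - 1) (-(ComplexShape.up ℤ).next n - 1))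
                (W.cx.fromOpcycles_d (-(ComplexShape.up ℤ).prev n - 1) _ _) :=
            { τ₁ := W.cx.pOpcycles _, τ₂ := 𝟙 _, τ₃ := 𝟙 _ }
          have : Epi φ.τ₁ := by dsimp [φ]; infer_instance
          have : IsIso φ.τ₂ := by dsimp [φ]; infer_instance
          have : Mono φ.τ₃ := by dsimp [φ]; infer_instance
          exact (ShortComplex.exact_iff_of_epi_of_isIso_of_mono φ).1 hS
        have : Mono (ShortComplex.mk (W.cx.fromOpcycles _ (-n - 1))
            (W.cx.d (-n - 1) (-(ComplexShape.up ℤ).next n - 1))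
            (W.cx.fromOpcycles_d (-(ComplexShape.up ℤ).prev n - 1) _ _)).f := this
        exact ⟨hE.lift x hx, hE.lift_f x hx⟩
      · rintro ⟨k, rfl⟩
        change (k ≫ W.cx.fromOpcycles _ _) ≫ W.cx.d _ _ = 0
        simp)
    (fun φ => by
      obtain ⟨f, hf⟩ := M.γ_map_surjective hA (W.R_opcycles hM hB _)
        (φ ≫ (W.opcyclesSuspPowIso hM n _ hk).inv)
      refine ⟨f, ?_⟩
      change M.γ.map f ≫ _ = φ
      rw [hf, Category.assoc, Iso.inv_hom_id, Category.comp_id])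
    (fun f => by
      change M.γ.map f ≫ (W.opcyclesSuspPowIso hM n _ hk).hom = 0 ↔
        ∃ x : A ⟶ W.cx.X _, x ≫ W.cx.d _ (-n - 1) = f ≫ W.cx.fromOpcycles _ (-n - 1)
      have := W.mono_fromOpcycles _ _ hp
      have h1 : M.γ.map f ≫ (W.opcyclesSuspPowIso hM n _ hk).hom = 0 ↔ M.γ.map f = 0 := by
        rw [← cancel_mono (W.opcyclesSuspPowIso hM n _ hk).hom, zero_comp]
      have h2 := W.γ_map_eq_zero_iff_target hM hA hB _ f
      rw [h1, h2]
      simp only [← W.cx.p_fromOpcycles, ← Category.assoc, cancel_mono])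

/-- `ℓExtⁿ(A, B) ≅ Ho(Ωⁿ A, B)`, naturally in `A` cofibrant and `B` fibrant. -/
def lExtIso (hM : M.IsHereditary) (res : ∀ A : C, M.Resolution A) (n : ℤ) :
    M.restrictCofFib (lExt res n) ≅ M.hoHom (M.loopPow n) (𝟭 _) :=
  NatIso.ofComponents (fun A => NatIso.ofComponents (fun B =>
      (lExtData hM (res A.unop.obj) A.unop.property B.property n).homologyIso)
    fun {B B'} g => by
      refine homologyMap_comm_of_leftHomologyData _
        (lExtData hM (res A.unop.obj) A.unop.property B.property n)
        (lExtData hM (res A.unop.obj) A.unop.property B'.property n)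
        (AddCommGrpCat.ofHom (AddMonoidHom.mk' (fun x => x ≫ g.hom)
          fun _ _ => Preadditive.add_comp _ _ _ _ _ _))
        (((M.hoHom (M.loopPow n) (𝟭 _)).obj A).map g) ?_ ?_
      · ext x
        exact (Category.assoc _ _ _).symm
      · ext x
        exact (Category.assoc _ _ _).trans (congr_arg (_ ≫ ·) (M.γ.map_comp _ _).symm))
    fun {A A'} f => by
      ext1; funext B
      refine homologyMap_comm_of_leftHomologyData _
        (lExtData hM (res A.unop.obj) A.unop.property B.property n)
        (lExtData hM (res A'.unop.obj) A'.unop.property B.property n)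
        (AddCommGrpCat.ofHom (AddMonoidHom.mk' (fun x => HomologicalComplex.opcyclesMap
          (resMap (res A'.unop.obj) (res A.unop.obj) f.unop.hom) n ≫ x)
          fun _ _ => Preadditive.comp_add _ _ _ _ _ _))
        (((M.hoHom (M.loopPow n) (𝟭 _)).map f).app B) ?_ ?_
      · ext x
        exact HomologicalComplex.p_opcyclesMap_assoc _ _ _
      · ext x
        -- The identification of classes precomposes with the inverse of `Z_n ≅ Ωⁿ A`, so the
        -- naturality square is needed in inverted form.
        have h := comp_inv_eq_inv_comp
          (opcyclesLoopPowIso_naturality hM (resMap_extends (res A'.unop.obj) (res A.unop.obj)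
            f.unop.hom) n)
        refine (Category.assoc _ _ _).symm.trans ((congr_arg (· ≫ M.γ.map x) h).trans ?_)
        exact (Category.assoc _ _ _).trans (congr_arg (_ ≫ ·) (M.γ.map_comp _ _).symm)

/-- `rExtⁿ(A, B) ≅ Ho(A, Σⁿ B)`, naturally in `A` cofibrant and `B` fibrant. -/
def rExtIso (hM : M.IsHereditary) (cores : ∀ B : C, M.Resolution B) (n : ℤ) :
    M.restrictCofFib (rExt cores n) ≅ M.hoHom (𝟭 _) (M.suspPow n) :=
  NatIso.ofComponents (fun A => NatIso.ofComponents (fun B =>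
      (rExtData hM (cores B.obj) A.unop.property B.property n).homologyIso)
    fun {B B'} g => by
      refine homologyMap_comm_of_leftHomologyData _
        (rExtData hM (cores B.obj) A.unop.property B.property n)
        (rExtData hM (cores B'.obj) A.unop.property B'.property n)
        (AddCommGrpCat.ofHom (AddMonoidHom.mk' (fun x => x ≫ HomologicalComplex.opcyclesMap
          (resMap (cores B.obj) (cores B'.obj) g.hom) _)
          fun _ _ => Preadditive.add_comp _ _ _ _ _ _))
        (((M.hoHom (𝟭 _) (M.suspPow n)).obj A).map g) ?_ ?_
      · ext x
        exact (Category.assoc _ _ _).trans ((congr_arg (x ≫ ·)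
          (syzygyMap (resMap (cores B.obj) (cores B'.obj) g.hom) _ (-n - 1)).comm₁₂).trans
          (Category.assoc _ _ _).symm)
      · ext x
        have h := opcyclesSuspPowIso_naturality hM
          (resMap_extends (cores B.obj) (cores B'.obj) g.hom) n
            (-(ComplexShape.up ℤ).prev n - 1) (by simp)
        refine (Category.assoc _ _ _).trans ((congr_arg (M.γ.map x ≫ ·) h.symm).trans ?_)
        exact (Category.assoc _ _ _).symm.trans (congr_arg (· ≫ _) (M.γ.map_comp _ _).symm))
    fun {A A'} f => by
      ext1; funext B
      refine homologyMap_comm_of_leftHomologyData _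
        (rExtData hM (cores B.obj) A.unop.property B.property n)
        (rExtData hM (cores B.obj) A'.unop.property B.property n)
        (AddCommGrpCat.ofHom (AddMonoidHom.mk' (fun x => f.unop.hom ≫ x)
          fun _ _ => Preadditive.comp_add _ _ _ _ _ _))
        (((M.hoHom (𝟭 _) (M.suspPow n)).map f).app B) ?_ ?_
      · ext x
        exact Category.assoc _ _ _
      · ext x
        exact (Category.assoc _ _ _).symm.trans (congr_arg (· ≫ _) (M.γ.map_comp _ _).symm)

end AbelianModelStructure
end AbelianModel
end

theorem mainTheorem6 {C : Type u} [Category.{v} C] [Abelian C] [HasExt.{w} C]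
    (M : AbelianModel.AbelianModelStructure.{w} C) (hM : M.IsHereditary)
    (res : ∀ A : C, M.Resolution A) (cores : ∀ B : C, M.Resolution B) (n : ℤ) :
    Nonempty (M.restrictCofFib (AbelianModel.AbelianModelStructure.lExt res n) ≅
      M.hoHom (M.loopPow n) (𝟭 _)) ∧
    Nonempty (M.hoHom (M.loopPow n) (𝟭 _) ≅ M.hoHom (𝟭 _) (M.suspPow n)) ∧
    Nonempty (M.hoHom (𝟭 _) (M.suspPow n) ≅
      M.restrictCofFib (AbelianModel.AbelianModelStructure.rExt cores n)) :=
  ⟨⟨AbelianModel.AbelianModelStructure.lExtIso hM res n⟩,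
    ⟨AbelianModel.AbelianModelStructure.hoHomLoopPowIso hM n⟩,
    ⟨(AbelianModel.AbelianModelStructure.rExtIso hM cores n).symm⟩⟩
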